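/- **Conventions.** Lorentzian metrics have signature $(+,-,-,-)$; the Ricci tensor is normalised to be positive on round spheres, and $L_{ab}=\frac1{n-2}\big(R_{ab}-\frac{R}{2(n-1)}g_{ab}\big)$ is the Schouten tensor in dimension $n\ge 3$. An *Einstein–Yang–Mills spacetime* is a four-manifold $\tilde{\mathcal M}$ with a metric $\tilde g$ and fields $A^{\mathfrak p}{}_a$, $F^{\mathfrak p}{}_{ab}$ with values in a finite-dimensional real Lie algebra with structure constants $C^{\mathfrak p}{}_{\mathfrak{qr}}$ such that $$\tilde R_{ab}-\tfrac12\tilde R\tilde g_{ab}+\lambda\tilde g_{ab}=\tfrac14\delta_{\mathfrak{pq}}F^{\mathfrak p}{}_{cd}F^{\mathfrak q\,cd}\tilde g_{ab}-\delta_{\mathfrak{pq}}F^{\mathfrak p}{}_{ac}F^{\mathfrak q}{}_b{}^c,$$ $$\tilde\nabla_aA^{\mathfrak p}{}_b-\tilde\nabla_bA^{\mathfrak p}{}_a+C^{\mathfrak p}{}_{\mathfrak{qr}}A^{\mathfrak q}{}_aA^{\mathfrak r}{}_b-F^{\mathfrak p}{}_{ab}=0,\qquad \tilde\nabla^aF^{\mathfrak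 p}{}_{ab}+C^{\mathfrak p}{}_{\mathfrak{qr}}A^{\mathfrak q\,a}F^{\mathfrak r}{}_{ab}=0 .$$ A *conformal extension of an anti-de Sitter-like spacetime* is a smooth four-manifold $\mathcal M$ with boundary, with a smooth Lorentzian metric $g$, smooth fields $A,F$ and a smooth function $\Xi$, such that $\Xi>0$ in the interior $\tilde{\mathcal M}$, $\Xi=0$ on the boundary $\mathscr I=\{\Xi=0\}$, and $(\tilde{\mathcal M},\tilde g=\Xi^{-2}g,A,F)$ is an Einstein–Yang–Mills spacetime with $\lambda>0$. (Then $\mathscr I$ is a timelike hypersurface.) Put $s=\tfrac14\nabla^c\nabla_c\Xi+\tfrac1{24}R\,\Xi$, and at points of $\mathscr I$ let $N=\sqrt{3/\lambda}\,\nabla^a\Xi$, the unit normal vector of $\mathscr I$ obtained from $\mathbf d\Xi$ by raising the index with $g$. Let $\tilde H=\tfrac16\lambda\tilde g$, and let $H$ be the tensor which on $\tilde{\mathcal M}$ is $$H_{ab}=\tilde H_{ab}-\big(\nabla_a\Upsilon_b+\Upsilon_a\Upsilon_b-\tfrac12 g^{cd}\Upsilon_c\Upsilon_d\,g_{ab}\big),\qquad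 \Upsilon=\Xi^{-1}\mathbf d\Xi,$$ and on $\mathscr I$ is given by its limits. A *conformal curve* in $(\mathcal M,g)$ is a curve $\gamma$ defined on an interval, with velocity $\dot x$, together with a covector $b$ along it, such that $$\nabla_{\dot x}\dot x=-2\langle b,\dot x\rangle\dot x+g(\dot x,\dot x)b^\sharp,\qquad \nabla_{\dot x}b=\langle b,\dot x\rangle b-\tfrac12g^\sharp(b,b)\dot x^\flat+H(\dot x,\cdot).$$ A vector field $e$ along $\gamma$ is *Weyl propagated* if $\nabla_{\dot x}e=-\langle b,e\rangle\dot x-\langle b,\dot x\rangle e+g(e,\dot x)b^\sharp$. A *conformal geodesic* of the conformal structure of $\mathscr I$, with respect to a representative metric $\ell$, is a curve in $\mathscr I$ with a covector along it that solves the conformal curve equations of $\ell$ with $H$ replaced by the (three-dimensional) Schouten tensor of $\ell$. **Lemma.** Let $(\mathcal M,g)$ be a conformal extension of an anti-de Sitter-like spacetime. Then $H$ is smooth up to $\mathscr I$. Let $(\gamma,b)$ be a conformal curve which passes through a point $p\in\mathscr I$, is tangent to $\mathscr I$ at $p$, and satisfies $\langle b,N\rangle|_p=-\sqrt{3/\lambda}\,s(p)$.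 Then: 1. $\gamma$ remains in $\mathscr I$. 2. $\gamma$, together with the pull-back of $b$ to $\mathscr I$, is a conformal geodesic of the conformal structure of $\mathscr I$, with respect to the metric induced by $g$ on $\mathscr I$. 3. There are $g$-orthonormal frames at $p$ whose last vector is normal to $\mathscr I$; and each of them extends to Weyl propagated vector fields along all of $\gamma$ which form a frame at every point of $\gamma$, the last of which is everywhere normal to $\mathscr I$ and the others everywhere tangent to $\mathscr I$. -/

import Mathlib

open Set Filter
open scoped Manifold ContDiff Topology

noncomputable section

namespace ConfBoundary

/-! ### Pseudo-Riemannian geometry in coordinates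

A metric in coordinates is a matrix-valued function `G` on a set `U` of `ℝⁿ`. All derivatives are
taken within `U`, which allows for charts at a boundary. -/

abbrev Coord (n : ℕ) : Type := EuclideanSpace ℝ (Fin n)

/-- The partial derivative `∂ᵢ f`. -/
def pd {n : ℕ} (U : Set (Coord n)) (i : Fin n) (f : Coord n → ℝ) (x : Coord n) : ℝ :=
  fderivWithin ℝ f U x (EuclideanSpace.single i 1)

section Local

variable {n : ℕ} (U : Set (Coord n)) (G : Coord n → Matrix (Fin n) (Fin n) ℝ)

/-- The Christoffel symbol `Γᵏᵢⱼ` of the Levi-Civita connection of `G`. -/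
def christoffel (k i j : Fin n) (x : Coord n) : ℝ :=
  (1 / 2) * ∑ l, (G x)⁻¹ k l *
    (pd U i (fun y => G y j l) x + pd U j (fun y => G y i l) x - pd U l (fun y => G y i j) x)

/-- The Ricci tensor `Rᵢⱼ` (positive on round spheres). -/
def ricci (i j : Fin n) (x : Coord n) : ℝ :=
  ∑ k, (pd U k (christoffel U G k i j) x - pd U j (christoffel U G k i k) x
    + ∑ l, (christoffel U G k k l x * christoffel U G l i j x
      - christoffel U G k j l x * christoffel U G l i k x))

/-- The Ricci scalar. -/
def scalarCurv (x : Coord n) : ℝ := ∑ i, ∑ j, (G x)⁻¹ i j * ricci U G i j x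

/-- The Schouten tensor in dimension `n ≥ 3`. -/
def schouten (i j : Fin n) (x : Coord n) : ℝ :=
  (1 / ((n : ℝ) - 2)) *
    (ricci U G i j x - scalarCurv U G x / (2 * ((n : ℝ) - 1)) * G x i j)

/-- The covariant derivative `∇ᵢ ωⱼ` of a covector field. -/
def nablaCovector (w : Coord n → Fin n → ℝ) (i j : Fin n) (x : Coord n) : ℝ :=
  pd U i (fun y => w y j) x - ∑ k, christoffel U G k i j x * w x k

/-- The covariant derivative `∇ₖ Fᵢⱼ` of a covariant tensor field of rank two. -/
def nablaTwo (F : Coord n → Fin n → Fin n → ℝ) (k i j : Fin n) (x : Coord n) : ℝ :=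
  pd U k (fun y => F y i j) x
    - ∑ l, christoffel U G l k i x * F x l j - ∑ l, christoffel U G l k j x * F x i l

/-- The differential of a function, in components. -/
def dComp (f : Coord n → ℝ) (x : Coord n) (i : Fin n) : ℝ := pd U i f x

/-- The metric product `G(z, w)` of two vectors. -/
def dotVec (x : Coord n) (z w : Fin n → ℝ) : ℝ := ∑ i, ∑ j, G x i j * z i * w j

/-- The contravariant metric product `G♯(α, β)` of two covectors. -/
def dotCov (x : Coord n) (a b : Fin n → ℝ) : ℝ := ∑ i, ∑ j, (G x)⁻¹ i j * a i * b j

/-- Raising an index: `β♯`. -/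
def sharp (x : Coord n) (b : Fin n → ℝ) (k : Fin n) : ℝ := ∑ i, (G x)⁻¹ k i * b i

/-- Lowering an index: `z♭`. -/
def flat (x : Coord n) (z : Fin n → ℝ) (k : Fin n) : ℝ := ∑ i, G x k i * z i

/-- The pairing `⟨β, z⟩`. -/
def pair (b z : Fin n → ℝ) : ℝ := ∑ i, b i * z i

/-- The conformal curve equations at the parameter value `τ`, for the metric `G`, the rank two
tensor `H`, a curve `x` with velocity `z` and a covector `b` along it:
`x' = z`, `∇_z z = -2⟨b,z⟩ z + G(z,z) b♯`, `∇_z b = ⟨b,z⟩ b - ½ G♯(b,b) z♭ + H(z,·)`. -/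
structure ConformalCurveEqAt (H : Coord n → Fin n → Fin n → ℝ) (J : Set ℝ)
    (x : ℝ → Coord n) (z b : ℝ → Fin n → ℝ) (τ : ℝ) : Prop where
  position : ∀ k, HasDerivWithinAt (fun t => x t k) (z τ k) J τ
  velocity : ∀ k, HasDerivWithinAt (fun t => z t k)
    (-(∑ i, ∑ j, christoffel U G k i j (x τ) * z τ i * z τ j)
      - 2 * pair (b τ) (z τ) * z τ k
      + dotVec G (x τ) (z τ) (z τ) * sharp G (x τ) (b τ) k) J τ
  covector : ∀ k, HasDerivWithinAt (fun t => b t k)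
    ((∑ i, ∑ j, christoffel U G j i k (x τ) * z τ i * b τ j)
      + pair (b τ) (z τ) * b τ k
      - (1 / 2) * dotCov G (x τ) (b τ) (b τ) * flat G (x τ) (z τ) k
      + ∑ i, H (x τ) i k * z τ i) J τ

/-- The Weyl propagation equation at `τ` for a vector `e` along the curve:
`∇_z e = -⟨b,e⟩ z - ⟨b,z⟩ e + G(e,z) b♯`. -/
def WeylEqAt (J : Set ℝ) (x : ℝ → Coord n) (z b e : ℝ → Fin n → ℝ) (τ : ℝ) : Prop :=
  ∀ k, HasDerivWithinAt (fun t => e t k)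
    (-(∑ i, ∑ j, christoffel U G k i j (x τ) * z τ i * e τ j)
      - pair (b τ) (e τ) * z τ k
      - pair (b τ) (z τ) * e τ k
      + dotVec G (x τ) (e τ) (z τ) * sharp G (x τ) (b τ) k) J τ

variable {ι : Type*} [Fintype ι]

/-- The energy-momentum tensor
`Tᵢⱼ = ¼ δ_pq Fᵖ_cd F^{q cd} gᵢⱼ - δ_pq Fᵖ_ic F^q_j^c` of the gauge fields. -/
def ymStress (F : ι → Coord n → Fin n → Fin n → ℝ) (i j : Fin n) (x : Coord n) : ℝ :=
  (1 / 4) * (∑ p, ∑ a, ∑ b, ∑ c, ∑ d,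
      (G x)⁻¹ a c * (G x)⁻¹ b d * F p x a b * F p x c d) * G x i j
    - ∑ p, ∑ c, ∑ d, (G x)⁻¹ c d * F p x i c * F p x j d

/-- The Einstein-Yang-Mills equations at `x`, with cosmological constant `lam`, structure
constants `C p q r` (upper index first), gauge potentials `A` and gauge fields `F`. -/
structure EinsteinYangMillsAt (lam : ℝ) (C : ι → ι → ι → ℝ) (A : ι → Coord n → Fin n → ℝ)
    (F : ι → Coord n → Fin n → Fin n → ℝ) (x : Coord n) : Prop where
  einstein : ∀ i j, ricci U G i j x - (1 / 2) * scalarCurv U G x * G x i j + lam * G x i j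
    = ymStress G F i j x
  field : ∀ p i j, nablaCovector U G (A p) i j x - nablaCovector U G (A p) j i x
    + ∑ q, ∑ r, C p q r * A q x i * A r x j - F p x i j = 0
  yangMills : ∀ p j, (∑ i, ∑ k, (G x)⁻¹ k i * nablaTwo U G (F p) k i j x)
    + ∑ q, ∑ r, ∑ i, ∑ k, C p q r * (G x)⁻¹ k i * A q x k * F r x i j = 0

end Local

/-! ### Tensors on a four-manifold with boundary, and their components in charts -/

section Manifold

variable {M : Type*} [TopologicalSpace M] [ChartedSpace (EuclideanHalfSpace 4) M]
  [IsManifold (𝓡∂ 4) ∞ M]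

/-- The domain in the half-space of the coordinates of the chart centred at `c`. -/
abbrev dom (c : M) : Set (Coord 4) := (extChartAt (𝓡∂ 4) c).target

/-- The point of `M` with coordinates `x` in the chart centred at `c`. -/
abbrev pt (c : M) (x : Coord 4) : M := (extChartAt (𝓡∂ 4) c).symm x

/-- The coordinate vector `∂ᵢ` at `q` of the chart centred at `c`. -/
def coordVec (c q : M) (i : Fin 4) : TangentSpace (𝓡∂ 4) q :=
  tangentCoordChange (𝓡∂ 4) c q q (EuclideanSpace.single i (1 : ℝ))

/-- The components of a tangent vector at `q` in the chart centred at `c`. -/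
def vecComp (c q : M) (w : TangentSpace (𝓡∂ 4) q) (k : Fin 4) : ℝ :=
  (show Coord 4 from tangentCoordChange (𝓡∂ 4) q c q w) k

/-- The components of a covector at `q` in the chart centred at `c`. -/
def covComp (c q : M) (b : TangentSpace (𝓡∂ 4) q →L[ℝ] ℝ) (k : Fin 4) : ℝ :=
  b (coordVec c q k)

/-- The components of a covector field in the chart centred at `c`. -/
def fieldComp (w : (q : M) → TangentSpace (𝓡∂ 4) q →L[ℝ] ℝ) (c : M)
    (x : Coord 4) (i : Fin 4) : ℝ :=
  w (pt c x) (coordVec c (pt c x) i)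

/-- The components of a covariant rank two tensor field in the chart centred at `c`. -/
def twoComp
    (T : (q : M) → TangentSpace (𝓡∂ 4) q →L[ℝ] TangentSpace (𝓡∂ 4) q →L[ℝ] ℝ) (c : M)
    (x : Coord 4) (i j : Fin 4) : ℝ :=
  T (pt c x) (coordVec c (pt c x) i) (coordVec c (pt c x) j)

/-- Four vectors are orthonormal for a bilinear form of signature `(+,-,-,-)`. -/
def IsOrthonormalFrame {V : Type*} [AddCommGroup V] [Module ℝ V] [TopologicalSpace V]
    (h : V →L[ℝ] V →L[ℝ] ℝ) (e : Fin 4 → V) : Prop :=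
  ∀ a b, h (e a) (e b) = if a = b then (if a = 0 then 1 else -1) else 0

end Manifold

/-- The structure constants `C^p_qr` of a Lie algebra in a basis. -/
def structureConstants {𝔤 ι : Type*} [LieRing 𝔤] [LieAlgebra ℝ 𝔤]
    (B : Module.Basis ι ℝ 𝔤) (p q r : ι) : ℝ :=
  B.repr ⁅B q, B r⁆ p

/-- A (smooth) conformal extension `(M, g, A, F)`, `g = Ξ² g̃`, of an anti-de Sitter-like
Einstein-Yang-Mills spacetime: `M` is a four-manifold with boundary, the physical spacetime is its
interior with the metric `g̃ = Ξ⁻² g`, which satisfies the Einstein-Yang-Mills equations with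
`λ > 0` (signature `(+,-,-,-)`), and the conformal boundary `{Ξ = 0}` is the boundary of `M`.
The gauge fields are smooth up to the boundary. -/
structure AdSLikeExtension (M : Type*) [TopologicalSpace M]
    [ChartedSpace (EuclideanHalfSpace 4) M] [IsManifold (𝓡∂ 4) ∞ M]
    {𝔤 ι : Type*} [LieRing 𝔤] [LieAlgebra ℝ 𝔤] [Fintype ι] (B : Module.Basis ι ℝ 𝔤) where
  lam : ℝ
  lam_pos : 0 < lam
  g : (q : M) → TangentSpace (𝓡∂ 4) q →L[ℝ] TangentSpace (𝓡∂ 4) q →L[ℝ] ℝ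
  g_symm : ∀ q u w, g q u w = g q w u
  g_lorentz : ∀ q, ∃ e, IsOrthonormalFrame (g q) e
  g_smooth : ∀ c i j, ContDiffOn ℝ ∞ (fun x => twoComp g c x i j) (dom c)
  Ξ : M → ℝ
  Ξ_smooth : ContMDiff (𝓡∂ 4) 𝓘(ℝ, ℝ) ∞ Ξ
  Ξ_pos : ∀ q ∈ (𝓡∂ 4).interior M, 0 < Ξ q
  Ξ_zero : ∀ q ∈ (𝓡∂ 4).boundary M, Ξ q = 0
  A : ι → (q : M) → TangentSpace (𝓡∂ 4) q →L[ℝ] ℝ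
  A_smooth : ∀ p c i, ContDiffOn ℝ ∞ (fun x => fieldComp (A p) c x i) (dom c)
  F : ι → (q : M) → TangentSpace (𝓡∂ 4) q →L[ℝ] TangentSpace (𝓡∂ 4) q →L[ℝ] ℝ
  F_smooth : ∀ p c i j, ContDiffOn ℝ ∞ (fun x => twoComp (F p) c x i j) (dom c)
  einsteinYangMills : ∀ c, ∀ x ∈ dom c, Ξ (pt c x) ≠ 0 →
    EinsteinYangMillsAt (dom c) (fun y => (Ξ (pt c y) ^ 2)⁻¹ • Matrix.of (twoComp g c y))
      lam (structureConstants B) (fun p => fieldComp (A p) c) (fun p => twoComp (F p) c) x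

namespace AdSLikeExtension

variable {M : Type*} [TopologicalSpace M] [ChartedSpace (EuclideanHalfSpace 4) M]
  [IsManifold (𝓡∂ 4) ∞ M]
  {𝔤 ι : Type*} [LieRing 𝔤] [LieAlgebra ℝ 𝔤] [Fintype ι] {B : Module.Basis ι ℝ 𝔤}
  (X : AdSLikeExtension M B)

/-- The conformal boundary `𝓘 = {Ξ = 0}`. -/
def scri : Set M := {q | X.Ξ q = 0}

/-- The unphysical metric `g` in the chart centred at `c`. -/
def metric (c : M) (x : Coord 4) : Matrix (Fin 4) (Fin 4) ℝ := Matrix.of (twoComp X.g c x)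

/-- The physical metric `g̃ = Ξ⁻² g` in the chart centred at `c` (where `Ξ ≠ 0`). -/
def physMetric (c : M) (x : Coord 4) : Matrix (Fin 4) (Fin 4) ℝ :=
  (X.Ξ (pt c x) ^ 2)⁻¹ • X.metric c x

/-- The conformal factor in the chart centred at `c`. -/
def factor (c : M) (x : Coord 4) : ℝ := X.Ξ (pt c x)

/-- `Υ = Ξ⁻¹ dΞ` (where `Ξ ≠ 0`). -/
def upsilon (c : M) (x : Coord 4) (i : Fin 4) : ℝ :=
  (X.factor c x)⁻¹ * dComp (dom c) (X.factor c) x i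

/-- The tensor `H` obtained on the physical spacetime from `H̃ = (λ/6) g̃` by the transformation
law of the Schouten tensor under `g = Ξ² g̃`:
`H = H̃ - (∇ᵢΥⱼ + ΥᵢΥⱼ - ½ g♯(Υ,Υ) gᵢⱼ)`. -/
def interiorH (c : M) (x : Coord 4) (i j : Fin 4) : ℝ :=
  X.lam / 6 * X.physMetric c x i j
    - (nablaCovector (dom c) (X.metric c) (X.upsilon c) i j x
      + X.upsilon c x i * X.upsilon c x j
      - (1 / 2) * dotCov (X.metric c) x (X.upsilon c x) (X.upsilon c x) * X.metric c x i j)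

/-- The tensor `H` on `M`: it is given by the transformation law off `𝓘`, and extended to `𝓘`
by its limiting values. -/
def H (c : M) (x : Coord 4) (i j : Fin 4) : ℝ :=
  if X.factor c x = 0 then
    limUnder (𝓝[{y | y ∈ dom c ∧ X.factor c y ≠ 0}] x) (fun y => X.interiorH c y i j)
  else X.interiorH c x i j

/-- The scalar `s = ¼ ∇ᶜ∇_c Ξ + (1/24) R Ξ`. -/
def s (q : M) : ℝ :=
  let x := extChartAt (𝓡∂ 4) q q
  (1 / 4) * (∑ i, ∑ j, (X.metric q x)⁻¹ i j *
      nablaCovector (dom q) (X.metric q) (dComp (dom q) (X.factor q)) i j x)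
    + (1 / 24) * scalarCurv (dom q) (X.metric q) x * X.factor q x

/-- The differential of `Ξ`. -/
def dΞ (q : M) : TangentSpace (𝓡∂ 4) q →L[ℝ] ℝ := mfderiv (𝓡∂ 4) 𝓘(ℝ, ℝ) X.Ξ q

/-- The vector `w` at a point of `𝓘` is tangent to `𝓘`. -/
def IsTangentToScri (q : M) (w : TangentSpace (𝓡∂ 4) q) : Prop := X.dΞ q w = 0

/-- The vector `w` at a point of `𝓘` is normal to `𝓘`. -/
def IsNormalToScri (q : M) (w : TangentSpace (𝓡∂ 4) q) : Prop :=
  ∀ u, X.IsTangentToScri q u → X.g q w u = 0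

/-- `N` is the vector `√(3/λ) ∇Ξ`, the gradient being taken with the metric `g`. At a point of
`𝓘` it is a unit normal of `𝓘`. -/
def IsUnitNormal (q : M) (N : TangentSpace (𝓡∂ 4) q) : Prop :=
  ∀ u, X.g q N u = √(3 / X.lam) * X.dΞ q u

/-- `(γ, b)`, with velocity `v`, is a conformal curve on `J`, for the metric `g` and the
tensor `H`: the equations hold in all charts. -/
def IsConformalCurve (J : Set ℝ) (γ : ℝ → M) (v : (t : ℝ) → TangentSpace (𝓡∂ 4) (γ t))
    (b : (t : ℝ) → TangentSpace (𝓡∂ 4) (γ t) →L[ℝ] ℝ) : Prop :=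
  ContinuousOn γ J ∧
  ∀ τ ∈ J, ∀ c : M, γ τ ∈ (extChartAt (𝓡∂ 4) c).source →
    ConformalCurveEqAt (dom c) (X.metric c) (X.H c) J
      (fun t => extChartAt (𝓡∂ 4) c (γ t))
      (fun t => vecComp c (γ t) (v t)) (fun t => covComp c (γ t) (b t)) τ

/-- The vector field `e` along `γ` is Weyl propagated on `J`. -/
def IsWeylPropagated (J : Set ℝ) (γ : ℝ → M) (v : (t : ℝ) → TangentSpace (𝓡∂ 4) (γ t))
    (b : (t : ℝ) → TangentSpace (𝓡∂ 4) (γ t) →L[ℝ] ℝ)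
    (e : (t : ℝ) → TangentSpace (𝓡∂ 4) (γ t)) : Prop :=
  ∀ τ ∈ J, ∀ c : M, γ τ ∈ (extChartAt (𝓡∂ 4) c).source →
    WeylEqAt (dom c) (X.metric c) J (fun t => extChartAt (𝓡∂ 4) c (γ t))
      (fun t => vecComp c (γ t) (v t)) (fun t => covComp c (γ t) (b t))
      (fun t => vecComp c (γ t) (e t)) τ

/-- The point of the half-space with coordinates `(0, y)`. A chart of `M` at a boundary point
induces the chart of `𝓘` with coordinates `y`. -/
def bdryPt (y : Coord 3) : Coord 4 := WithLp.toLp 2 (Fin.cons 0 (fun i => y i))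

/-- The domain of the coordinates of `𝓘` induced by the chart centred at `c`. -/
def bdryDom (c : M) : Set (Coord 3) := {y | bdryPt y ∈ dom c}

/-- The metric `ℓ` induced by `g` on `𝓘`, in the coordinates induced by the chart at `c`. -/
def bdryMetric (c : M) (y : Coord 3) : Matrix (Fin 3) (Fin 3) ℝ :=
  Matrix.of fun i j => X.metric c (bdryPt y) i.succ j.succ

/-- `γ` is a curve in `𝓘` which, together with the pull-back of `b` to `𝓘`, satisfies the
conformal geodesic equations of the induced metric `ℓ` of `𝓘`, that is, the conformal curve
equations of `ℓ` in which `H` is the three-dimensional Schouten tensor of `ℓ`. -/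
def IsBoundaryConformalGeodesic (J : Set ℝ) (γ : ℝ → M)
    (v : (t : ℝ) → TangentSpace (𝓡∂ 4) (γ t))
    (b : (t : ℝ) → TangentSpace (𝓡∂ 4) (γ t) →L[ℝ] ℝ) : Prop :=
  ContinuousOn γ J ∧
  ∀ τ ∈ J, γ τ ∈ X.scri ∧ X.IsTangentToScri (γ τ) (v τ) ∧
    ∀ c : M, γ τ ∈ (extChartAt (𝓡∂ 4) c).source →
      ConformalCurveEqAt (bdryDom c) (X.bdryMetric c)
        (fun y i j => schouten (bdryDom c) (X.bdryMetric c) i j y) J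
        (fun t => WithLp.toLp 2 (fun i : Fin 3 => extChartAt (𝓡∂ 4) c (γ t) i.succ))
        (fun t i => vecComp c (γ t) (v t) i.succ)
        (fun t i => covComp c (γ t) (b t) i.succ) τ

/-- A `g`-orthonormal frame at a point of `𝓘` whose last vector is normal to `𝓘`. -/
def IsAdaptedFrame (q : M) (E : Fin 4 → TangentSpace (𝓡∂ 4) q) : Prop :=
  IsOrthonormalFrame (X.g q) E ∧ X.IsNormalToScri q (E 3)

end AdSLikeExtension

end ConfBoundary

end

/-!
The proof rests on three equations for the conformal factor, which hold up to the conformal boundary,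
and on uniqueness for linear ordinary differential equations.

*The tensor `H`.* In the interior, the transformation law of the Ricci tensor under `g = Ξ² g̃`
(`IsSmoothMetric.ricci_rescaled`) and Einstein's equations, whose source `T` is trace-free in dimension
four, give `H = L - ½ Ξ² T`, where `L` is the Schouten tensor of `g` and `T` is formed with `g`
(`IsLocalExtension.smoothH_eq`). The right-hand side is smooth on all of `M` and the interior is dense,
so it is also the limit that defines `H` on `𝓘` (`AdSLikeExtension.H_eq_smoothH`).

*The conformal field equations.* Rewriting `H` in terms of the Hessian of `Ξ` gives
`∇∇Ξ = -Ξ H + s g` and `|dΞ|² + λ/3 = 2 Ξ s`; differentiating the latter gives `∇s = -H(·,∇Ξ)`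
(`hessian`, `norm_dComp` and `pd_friedrichScalar`, in the namespace `IsLocalExtension`). By density they
hold on `𝓘` as well.

*The curve stays in `𝓘`.* Let `z` be the velocity. By these equations, the functions `Ξ`, `⟨dΞ,z⟩` and
`⟨b,∇Ξ⟩ + s` along a conformal curve satisfy a homogeneous linear system with locally bounded
coefficients (`IsLocalExtension.exists_bound`). The hypotheses at `p` say that all three vanish there,
so they vanish identically (`IsConformalCurve.boundary_conditions`).

*The induced conformal geodesic.* At `Ξ = 0` the Hessian equation says that `𝓘` is umbilical. The
Gauss equation, and the Ricci identity for `dΞ`, which determines the normal components of the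
curvature, show that the Schouten tensor of the induced metric `ℓ` is `H` plus a multiple of `ℓ`
(`IsLocalExtension.schouten_inducedMetric`). The condition `⟨b,∇Ξ⟩ = -s` fixes the normal component of
`b` in such a way that this multiple, the normal part of `g♯(b,b)` and the second fundamental form cancel
(`IsLocalExtension.conformalCurveEqAt_inducedMetric`).

*Frames.* Weyl propagation is a linear differential equation. It is independent of the chart by the
transformation law of the Christoffel symbols (`IsConformalCurve.weylIn_change`), and local solutions in
charts are unique and can be joined along the curve (`IsConformalCurve.exists_weylPropagated`). It
satisfies `g(e,f)' = -2⟨b,z⟩ g(e,f)`, and `⟨dΞ,e⟩' = -⟨b,z⟩ ⟨dΞ,e⟩` along the curve in `𝓘`. Hence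
orthogonality, nonvanishing norms and tangency to `𝓘` persist
(`IsConformalCurve.frame_of_isAdaptedFrame`).
-/

noncomputable section

namespace ConfBoundary

/-! ### Partial derivatives within a set -/

section Calculus

variable {n : ℕ} {U : Set (Coord n)} {f h : Coord n → ℝ} {x : Coord n}

lemma pd_congr (hfh : EqOn f h U) (hx : x ∈ U) (i : Fin n) : pd U i f x = pd U i h x := by
  unfold pd; rw [fderivWithin_congr hfh (hfh hx)]

lemma ContDiffOn.diffWithin (hf : ContDiffOn ℝ ∞ f U) (hx : x ∈ U) :
    DifferentiableWithinAt ℝ f U x :=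
  (hf x hx).differentiableWithinAt (by simp)

lemma contDiffOn_pd (hU : UniqueDiffOn ℝ U) (hf : ContDiffOn ℝ ∞ f U) (i : Fin n) :
    ContDiffOn ℝ ∞ (pd U i f) U := by
  unfold pd
  exact (hf.fderivWithin hU (m := ∞) (by simp)).clm_apply contDiffOn_const

lemma pd_const (c : ℝ) (i : Fin n) : pd U i (fun _ => c) x = 0 := by
  simp [pd]

lemma pd_add (hU : UniqueDiffOn ℝ U) (hx : x ∈ U) (hf : ContDiffOn ℝ ∞ f U)
    (hh : ContDiffOn ℝ ∞ h U) (i : Fin n) :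
    pd U i (fun y => f y + h y) x = pd U i f x + pd U i h x := by
  unfold pd
  rw [fderivWithin_fun_add (hU x hx) (ContDiffOn.diffWithin hf hx) (ContDiffOn.diffWithin hh hx)]; rfl

lemma pd_sub (hU : UniqueDiffOn ℝ U) (hx : x ∈ U) (hf : ContDiffOn ℝ ∞ f U)
    (hh : ContDiffOn ℝ ∞ h U) (i : Fin n) :
    pd U i (fun y => f y - h y) x = pd U i f x - pd U i h x := by
  unfold pd
  rw [fderivWithin_fun_sub (hU x hx) (ContDiffOn.diffWithin hf hx) (ContDiffOn.diffWithin hh hx)]; rfl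

lemma pd_neg (hU : UniqueDiffOn ℝ U) (hx : x ∈ U) (i : Fin n) :
    pd U i (fun y => -f y) x = -pd U i f x := by
  unfold pd
  rw [fderivWithin_fun_neg (hU x hx)]; rfl

lemma pd_mul (hU : UniqueDiffOn ℝ U) (hx : x ∈ U) (hf : ContDiffOn ℝ ∞ f U)
    (hh : ContDiffOn ℝ ∞ h U) (i : Fin n) :
    pd U i (fun y => f y * h y) x = pd U i f x * h x + f x * pd U i h x := by
  unfold pd
  rw [fderivWithin_fun_mul (hU x hx) (ContDiffOn.diffWithin hf hx) (ContDiffOn.diffWithin hh hx)]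
  simp; ring

lemma pd_const_mul (hU : UniqueDiffOn ℝ U) (hx : x ∈ U) (hf : ContDiffOn ℝ ∞ f U) (c : ℝ)
    (i : Fin n) : pd U i (fun y => c * f y) x = c * pd U i f x := by
  rw [pd_mul hU hx contDiffOn_const hf, pd_const]; ring

lemma pd_sum {α : Type*} (s : Finset α) {F : α → Coord n → ℝ} (hU : UniqueDiffOn ℝ U) (hx : x ∈ U)
    (hF : ∀ a, ContDiffOn ℝ ∞ (F a) U) (i : Fin n) :
    pd U i (fun y => ∑ a ∈ s, F a y) x = ∑ a ∈ s, pd U i (F a) x := by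
  unfold pd
  rw [fderivWithin_fun_sum (hU x hx) (fun a _ => ContDiffOn.diffWithin (hF a) hx)]
  simp

lemma pd_inv (hU : UniqueDiffOn ℝ U) (hx : x ∈ U) (hf : ContDiffOn ℝ ∞ f U) (h0 : f x ≠ 0)
    (i : Fin n) : pd U i (fun y => (f y)⁻¹) x = -pd U i f x / f x ^ 2 := by
  unfold pd
  have := ((hasDerivAt_inv h0).comp_hasFDerivWithinAt x
    (ContDiffOn.diffWithin hf hx).hasFDerivWithinAt).fderivWithin (hU x hx)
  have e : Inv.inv ∘ f = fun y => (f y)⁻¹ := rfl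
  rw [e] at this
  rw [this]
  simp; ring

lemma contDiffOn_fun_inv (hf : ContDiffOn ℝ ∞ f U) (h0 : ∀ y ∈ U, f y ≠ 0) :
    ContDiffOn ℝ ∞ (fun y => (f y)⁻¹) U := hf.inv h0

/-- Restricting to a relatively open subset does not change partial derivatives. -/
lemma pd_of_mem_nhdsWithin {W : Set (Coord n)}
    (hW : W ∈ 𝓝[U] x) (hWU : W ⊆ U) (i : Fin n) :
    pd W i f x = pd U i f x := by
  unfold pd
  rw [fderivWithin_congr_set]
  have h1 := mem_nhdsWithin_iff_eventually.1 hW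
  filter_upwards [h1] with y hy
  exact propext ⟨fun h => hWU h, fun h => hy h⟩

lemma two_le_smooth : minSmoothness ℝ 2 ≤ (∞ : WithTop ℕ∞) := by
  rw [minSmoothness_of_isRCLikeNormedField]
  exact WithTop.coe_le_coe.2 le_top

lemma pd_comm (hU : UniqueDiffOn ℝ U) (hcl : U ⊆ closure (interior U)) (hx : x ∈ U)
    (hf : ContDiffOn ℝ ∞ f U) (i j : Fin n) :
    pd U i (pd U j f) x = pd U j (pd U i f) x := by
  have hs := (hf x hx).isSymmSndFDerivWithinAt two_le_smooth hU
    (hcl hx) hx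
  have key : ∀ a b : Fin n, pd U a (pd U b f) x =
      fderivWithin ℝ (fderivWithin ℝ f U) U x (EuclideanSpace.single a 1)
        (EuclideanSpace.single b 1) := by
    intro a b
    have hd : DifferentiableWithinAt ℝ (fderivWithin ℝ f U) U x :=
      ((hf.fderivWithin hU (m := ∞) (by simp)) x hx).differentiableWithinAt (by simp)
    unfold pd
    rw [fderivWithin_clm_apply (hU x hx) hd (differentiableWithinAt_const _)]
    simp
  rw [key, key]
  exact hs.eq _ _

lemma fderivWithin_apply_eq_sum (w : Coord n) :
    fderivWithin ℝ f U x w = ∑ i, pd U i f x * w i := by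
  have : w = ∑ i, w i • EuclideanSpace.single i (1 : ℝ) := by
    ext j; simp [Finset.sum_apply, Pi.single_apply]
  conv_lhs => rw [this]
  rw [map_sum]
  refine Finset.sum_congr rfl fun i _ => ?_
  simp [pd, mul_comm]

lemma hasDerivWithinAt_of_coords {J : Set ℝ} {c : ℝ → Coord n} {z : Fin n → ℝ} {τ : ℝ}
    (hc : ∀ k, HasDerivWithinAt (fun t => c t k) (z k) J τ) :
    HasDerivWithinAt c (WithLp.toLp 2 z) J τ := by
  have h1 : HasDerivWithinAt (fun t => WithLp.ofLp (c t)) z J τ := by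
    rw [hasDerivWithinAt_pi]; exact hc
  have := ((EuclideanSpace.equiv (Fin n) ℝ).symm.toContinuousLinearMap.hasFDerivAt
      (x := (WithLp.ofLp (c τ)))).comp_hasDerivWithinAt τ h1
  exact this

/-- The chain rule along a curve that stays in `U` near the parameter value `τ`. -/
lemma hasDerivWithinAt_comp_curve {J : Set ℝ} {c : ℝ → Coord n} {z : Fin n → ℝ} {τ : ℝ}
    (hf : ContDiffOn ℝ ∞ f U) (hτ : τ ∈ J) (hcU : ∀ᶠ t in 𝓝[J] τ, c t ∈ U)
    (hc : ∀ k, HasDerivWithinAt (fun t => c t k) (z k) J τ) :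
    HasDerivWithinAt (fun t => f (c t)) (∑ i, pd U i f (c τ) * z i) J τ := by
  have hm : {t | c t ∈ U} ∩ J ∈ 𝓝[J] τ := inter_mem hcU self_mem_nhdsWithin
  have h1 : HasDerivWithinAt c (WithLp.toLp 2 z) ({t | c t ∈ U} ∩ J) τ :=
    (hasDerivWithinAt_of_coords hc).mono inter_subset_right
  have hxU : c τ ∈ U := hcU.self_of_nhdsWithin hτ
  have h2 := ((ContDiffOn.diffWithin hf hxU).hasFDerivWithinAt.comp_hasDerivWithinAt τ h1
    (fun t ht => ht.1))
  have h3 := h2.mono_of_mem_nhdsWithin hm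
  rw [fderivWithin_apply_eq_sum] at h3
  exact h3

end Calculus

/-! ### Smooth metrics and the Levi-Civita connection -/

section Metric

variable {n : ℕ} {U : Set (Coord n)} {G : Coord n → Matrix (Fin n) (Fin n) ℝ} {x : Coord n}

/-- A smooth pseudo-Riemannian metric, in coordinates ranging over a set `U` which may have
boundary points but is contained in the closure of its interior (so that mixed partial derivatives
commute). Only symmetry and nondegeneracy are required; the signature is arbitrary. -/
structure IsSmoothMetric (U : Set (Coord n)) (G : Coord n → Matrix (Fin n) (Fin n) ℝ) :
    Prop where
  uniqueDiff : UniqueDiffOn ℝ U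
  subset_closure : U ⊆ closure (interior U)
  smooth : ∀ i j, ContDiffOn ℝ ∞ (fun y => G y i j) U
  symm : ∀ y ∈ U, ∀ i j, G y i j = G y j i
  det_ne : ∀ y ∈ U, (G y).det ≠ 0

lemma contDiffOn_det {m : ℕ} {P : Coord n → Matrix (Fin m) (Fin m) ℝ}
    (hP : ∀ i j, ContDiffOn ℝ ∞ (fun y => P y i j) U) :
    ContDiffOn ℝ ∞ (fun y => (P y).det) U := by
  simp only [Matrix.det_apply']
  exact ContDiffOn.sum fun σ _ => contDiffOn_const.mul (contDiffOn_prod fun i _ => hP _ _)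

lemma contDiffOn_inv {m : ℕ} {P : Coord n → Matrix (Fin m) (Fin m) ℝ}
    (hP : ∀ i j, ContDiffOn ℝ ∞ (fun y => P y i j) U) (h0 : ∀ y ∈ U, (P y).det ≠ 0)
    (i j : Fin m) : ContDiffOn ℝ ∞ (fun y => (P y)⁻¹ i j) U := by
  have h1 : ContDiffOn ℝ ∞ (fun y => ((P y).det)⁻¹ * (P y).adjugate i j) U := by
    refine ((contDiffOn_det hP).inv h0).mul ?_
    simp only [Matrix.adjugate_apply]
    refine contDiffOn_det fun a b => ?_
    simp only [Matrix.updateRow_apply]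
    split_ifs
    · exact contDiffOn_const
    · exact hP a b
  refine h1.congr fun y hy => ?_
  rw [Matrix.inv_def, Ring.inverse_eq_inv']
  simp

/-- The Christoffel symbols of the first kind, `Γ_{l,ij}`. -/
def christoffelFirst (U : Set (Coord n)) (G : Coord n → Matrix (Fin n) (Fin n) ℝ)
    (l i j : Fin n) (x : Coord n) : ℝ :=
  (1 / 2) * (pd U i (fun y => G y j l) x + pd U j (fun y => G y i l) x
    - pd U l (fun y => G y i j) x)

lemma christoffel_eq_sum_first (k i j : Fin n) (x : Coord n) :
    christoffel U G k i j x = ∑ l, (G x)⁻¹ k l * christoffelFirst U G l i j x := by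
  unfold christoffel christoffelFirst
  rw [Finset.mul_sum]
  exact Finset.sum_congr rfl fun l _ => by ring

namespace IsSmoothMetric

variable (hG : IsSmoothMetric U G)
include hG

lemma smooth_inv (i j : Fin n) : ContDiffOn ℝ ∞ (fun y => (G y)⁻¹ i j) U :=
  contDiffOn_inv hG.smooth hG.det_ne i j

lemma smooth_first (l i j : Fin n) : ContDiffOn ℝ ∞ (christoffelFirst U G l i j) U := by
  unfold christoffelFirst
  exact contDiffOn_const.mul (((contDiffOn_pd hG.uniqueDiff (hG.smooth _ _) _).add
    (contDiffOn_pd hG.uniqueDiff (hG.smooth _ _) _)).sub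
    (contDiffOn_pd hG.uniqueDiff (hG.smooth _ _) _))

lemma smooth_christoffel (k i j : Fin n) : ContDiffOn ℝ ∞ (christoffel U G k i j) U := by
  have : christoffel U G k i j = fun y => ∑ l, (G y)⁻¹ k l * christoffelFirst U G l i j y := by
    ext y; exact christoffel_eq_sum_first k i j y
  rw [this]
  exact ContDiffOn.sum fun l _ => (hG.smooth_inv _ _).mul (hG.smooth_first _ _ _)

lemma smooth_ricci (i j : Fin n) : ContDiffOn ℝ ∞ (ricci U G i j) U := by
  unfold ricci
  have h := hG.smooth_christoffel
  have h' := fun k i j m => contDiffOn_pd hG.uniqueDiff (h k i j) m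
  refine ContDiffOn.sum fun k _ => ContDiffOn.add ((h' _ _ _ _).sub (h' _ _ _ _))
    (ContDiffOn.sum fun l _ => ((h _ _ _).mul (h _ _ _)).sub ((h _ _ _).mul (h _ _ _)))

lemma smooth_scalarCurv : ContDiffOn ℝ ∞ (scalarCurv U G) U := by
  unfold scalarCurv
  exact ContDiffOn.sum fun i _ => ContDiffOn.sum fun j _ =>
    (hG.smooth_inv _ _).mul (hG.smooth_ricci _ _)

lemma smooth_nablaCovector {w : Coord n → Fin n → ℝ}
    (hw : ∀ i, ContDiffOn ℝ ∞ (fun y => w y i) U) (i j : Fin n) :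
    ContDiffOn ℝ ∞ (nablaCovector U G w i j) U := by
  unfold nablaCovector
  exact (contDiffOn_pd hG.uniqueDiff (hw _) _).sub
    (ContDiffOn.sum fun k _ => (hG.smooth_christoffel _ _ _).mul (hw _))

omit hG in
lemma first_symm (hx : x ∈ U) (hs : ∀ y ∈ U, ∀ i j, G y i j = G y j i) (l i j : Fin n) :
    christoffelFirst U G l i j x = christoffelFirst U G l j i x := by
  unfold christoffelFirst
  rw [pd_congr (f := fun y => G y i j) (h := fun y => G y j i) (fun y hy => hs y hy i j) hx]
  ring

lemma christoffel_symm (hx : x ∈ U) (k i j : Fin n) :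
    christoffel U G k i j x = christoffel U G k j i x := by
  rw [christoffel_eq_sum_first, christoffel_eq_sum_first]
  exact Finset.sum_congr rfl fun l _ => by rw [first_symm hx hG.symm]

lemma inv_mul (hx : x ∈ U) (i j : Fin n) :
    ∑ k, (G x)⁻¹ i k * G x k j = if i = j then 1 else 0 := by
  have := congrFun (congrFun (Matrix.nonsing_inv_mul (G x) (Ne.isUnit (hG.det_ne x hx))) i) j
  rw [Matrix.mul_apply, Matrix.one_apply] at this
  exact this

lemma mul_inv (hx : x ∈ U) (i j : Fin n) :
    ∑ k, G x i k * (G x)⁻¹ k j = if i = j then 1 else 0 := by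
  have := congrFun (congrFun (Matrix.mul_nonsing_inv (G x) (Ne.isUnit (hG.det_ne x hx))) i) j
  rw [Matrix.mul_apply, Matrix.one_apply] at this
  exact this

lemma inv_symm (hx : x ∈ U) (i j : Fin n) : (G x)⁻¹ i j = (G x)⁻¹ j i := by
  have h1 : (G x).transpose = G x := by
    ext a b; exact hG.symm x hx b a
  have := Matrix.transpose_nonsing_inv (G x)
  rw [h1] at this
  exact (congrFun (congrFun this j) i)

lemma flat_sharp (hx : x ∈ U) (b : Fin n → ℝ) : flat G x (sharp G x b) = b := by
  have : flat G x (sharp G x b) = (G x).mulVec ((G x)⁻¹.mulVec b) := rfl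
  rw [this, Matrix.mulVec_mulVec, Matrix.mul_nonsing_inv _ (Ne.isUnit (hG.det_ne x hx)),
    Matrix.one_mulVec]

lemma sharp_flat (hx : x ∈ U) (z : Fin n → ℝ) : sharp G x (flat G x z) = z := by
  have : sharp G x (flat G x z) = (G x)⁻¹.mulVec ((G x).mulVec z) := rfl
  rw [this, Matrix.mulVec_mulVec, Matrix.nonsing_inv_mul _ (Ne.isUnit (hG.det_ne x hx)),
    Matrix.one_mulVec]

/-- `g_{lk} Γᵏᵢⱼ = Γ_{l,ij}`. -/
lemma lower_christoffel (hx : x ∈ U) (l i j : Fin n) :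
    ∑ k, G x l k * christoffel U G k i j x = christoffelFirst U G l i j x := by
  have h1 : (fun k => christoffel U G k i j x)
      = sharp G x (fun l => christoffelFirst U G l i j x) := by
    ext k; exact christoffel_eq_sum_first k i j x
  have h2 := congrFun (hG.flat_sharp hx (fun l => christoffelFirst U G l i j x)) l
  rw [← h1] at h2
  exact h2

/-- Metric compatibility of the Levi-Civita connection. -/
lemma pd_metric_first (hx : x ∈ U) (m i j : Fin n) :
    pd U m (fun y => G y i j) x
      = christoffelFirst U G j m i x + christoffelFirst U G i m j x := by
  unfold christoffelFirst
  rw [pd_congr (f := fun y => G y j i) (h := fun y => G y i j) (fun y hy => hG.symm y hy j i) hx]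
  ring

lemma pd_metric (hx : x ∈ U) (m i j : Fin n) :
    pd U m (fun y => G y i j) x
      = ∑ k, (G x i k * christoffel U G k m j x + G x j k * christoffel U G k m i x) := by
  rw [Finset.sum_add_distrib, hG.lower_christoffel hx, hG.lower_christoffel hx,
    hG.pd_metric_first hx]
  ring

/-- Metric compatibility for the contravariant metric. -/
lemma pd_inv_metric (hx : x ∈ U) (m i j : Fin n) :
    pd U m (fun y => (G y)⁻¹ i j) x
      = -∑ k, ((G x)⁻¹ i k * christoffel U G j m k x + (G x)⁻¹ j k * christoffel U G i m k x) := by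
  have e1 : ∀ a, ∑ k, (pd U m (fun y => (G y)⁻¹ i k) x * G x k a
      + (G x)⁻¹ i k * pd U m (fun y => G y k a) x) = 0 := by
    intro a
    have h := pd_congr (f := fun y => ∑ k, (G y)⁻¹ i k * G y k a)
      (h := fun _ => if i = a then (1 : ℝ) else 0) (fun y hy => hG.inv_mul hy i a) hx m
    rw [pd_const, pd_sum _ hG.uniqueDiff hx
      (fun k => (hG.smooth_inv i k).mul (hG.smooth k a))] at h
    rw [← h]
    exact Finset.sum_congr rfl fun k _ =>
      (pd_mul hG.uniqueDiff hx (hG.smooth_inv i k) (hG.smooth k a) m).symm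
  have e2 : ∀ a, ∑ k, (G x)⁻¹ i k * pd U m (fun y => G y k a) x
      = christoffel U G i m a x + ∑ k, (G x)⁻¹ i k * ∑ l, G x a l * christoffel U G l m k x := by
    intro a
    have e3 : ∑ k, (G x)⁻¹ i k * ∑ l, G x k l * christoffel U G l m a x
        = christoffel U G i m a x :=
      congrFun (hG.sharp_flat hx (fun l => christoffel U G l m a x)) i
    rw [← e3, ← Finset.sum_add_distrib]
    refine Finset.sum_congr rfl fun k _ => ?_
    rw [hG.pd_metric hx, Finset.sum_add_distrib, mul_add]
  have e4 : pd U m (fun y => (G y)⁻¹ i j) x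
      = ∑ a, (∑ k, pd U m (fun y => (G y)⁻¹ i k) x * G x k a) * (G x)⁻¹ a j := by
    simp_rw [Finset.sum_mul, mul_assoc]
    rw [Finset.sum_comm]
    simp_rw [← Finset.mul_sum, hG.mul_inv hx]
    simp
  have e5 : ∀ a, ∑ k, pd U m (fun y => (G y)⁻¹ i k) x * G x k a
      = -(christoffel U G i m a x + ∑ k, (G x)⁻¹ i k * ∑ l, G x a l * christoffel U G l m k x) := by
    intro a
    have := e1 a
    rw [Finset.sum_add_distrib, e2 a] at this
    linarith
  rw [e4]
  simp_rw [e5]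
  have e6 : ∑ a, (∑ k, (G x)⁻¹ i k * ∑ l, G x a l * christoffel U G l m k x) * (G x)⁻¹ a j
      = ∑ k, (G x)⁻¹ i k * christoffel U G j m k x := by
    have : ∀ k, christoffel U G j m k x
        = ∑ a, (∑ l, G x a l * christoffel U G l m k x) * (G x)⁻¹ a j := by
      intro k
      have := congrFun (hG.sharp_flat hx (fun l => christoffel U G l m k x)) j
      rw [← this]
      unfold sharp flat
      exact Finset.sum_congr rfl fun a _ => by rw [hG.inv_symm hx j a, mul_comm]
    simp_rw [this, Finset.mul_sum, Finset.sum_mul]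
    rw [Finset.sum_comm]
    refine Finset.sum_congr rfl fun k _ => Finset.sum_congr rfl fun a _ => ?_
    rw [Finset.mul_sum]
    refine Finset.sum_congr rfl fun l _ => ?_
    ring
  rw [Finset.sum_add_distrib, ← e6]
  simp_rw [neg_mul, add_mul]
  rw [Finset.sum_neg_distrib, Finset.sum_add_distrib]
  have e7 : ∑ a, christoffel U G i m a x * (G x)⁻¹ a j
      = ∑ k, (G x)⁻¹ j k * christoffel U G i m k x :=
    Finset.sum_congr rfl fun a _ => by rw [hG.inv_symm hx j a, mul_comm]
  rw [e7]; ring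

end IsSmoothMetric

end Metric

/-! ### Conformal change of the Ricci tensor -/

section ConformalAlgebra

variable {n : ℕ}

/-- The difference `Sᵏᵢⱼ = -(δᵏᵢ uⱼ + δᵏⱼ uᵢ - gᵢⱼ uᵏ)` of the Levi-Civita connections of
`e^{-2f} g` and `g`, where `u = df` and `V = u♯`. -/
def confShift (g : Fin n → Fin n → ℝ) (u V : Fin n → ℝ) (k i j : Fin n) : ℝ :=
  -((if k = i then u j else 0) + (if k = j then u i else 0) - g i j * V k)

variable (Γ : Fin n → Fin n → Fin n → ℝ) (g : Fin n → Fin n → ℝ) (u V : Fin n → ℝ)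

lemma sum_confShift (hV : ∀ i, ∑ k, g i k * V k = u i) (i : Fin n) :
    ∑ k, confShift g u V k i k = -(n : ℝ) * u i := by
  unfold confShift
  simp only [Finset.sum_neg_distrib, Finset.sum_add_distrib, Finset.sum_sub_distrib, hV]
  simp

lemma sum_christoffel_mul_confShift (i j : Fin n) :
    ∑ k, ∑ l, Γ k k l * confShift g u V l i j
      = -(∑ k, Γ k k i * u j + ∑ k, Γ k k j * u i - g i j * ∑ k, ∑ l, Γ k k l * V l) := by
  unfold confShift
  simp only [mul_neg, mul_add, mul_sub, Finset.sum_neg_distrib, Finset.sum_add_distrib,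
    Finset.sum_sub_distrib, mul_ite, mul_zero, Finset.mul_sum]
  simp
  refine Finset.sum_congr rfl fun k _ => Finset.sum_congr rfl fun l _ => by ring

lemma sum_christoffel_mul_confShift' (i j : Fin n) :
    ∑ k, ∑ l, Γ k j l * confShift g u V l i k
      = -(∑ k, Γ k j i * u k + ∑ k, Γ k j k * u i - ∑ k, ∑ l, Γ k j l * g i k * V l) := by
  unfold confShift
  simp only [mul_neg, mul_add, mul_sub, Finset.sum_neg_distrib, Finset.sum_add_distrib,
    Finset.sum_sub_distrib, mul_ite, mul_zero]
  simp [mul_assoc]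

lemma sum_confShift_mul (P : Fin n → Fin n → ℝ) (j : Fin n) :
    ∑ k, ∑ l, confShift g u V k j l * P l k
      = -(∑ l, u l * P l j + u j * ∑ k, P k k - ∑ l, ∑ k, g j l * P l k * V k) := by
  unfold confShift
  simp only [neg_mul, add_mul, sub_mul, Finset.sum_neg_distrib, Finset.sum_add_distrib,
    Finset.sum_sub_distrib, ite_mul, zero_mul, Finset.mul_sum]
  simp
  rw [Finset.sum_comm]
  refine Finset.sum_congr rfl fun k _ => Finset.sum_congr rfl fun l _ => by ring

lemma sum_mul_confShift (w : Fin n → ℝ) (i j : Fin n) :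
    ∑ l, w l * confShift g u V l i j
      = -(w i * u j + w j * u i - g i j * ∑ l, w l * V l) := by
  unfold confShift
  simp only [mul_neg, mul_add, mul_sub, Finset.sum_neg_distrib, Finset.sum_add_distrib,
    Finset.sum_sub_distrib, mul_ite, mul_zero, Finset.mul_sum]
  simp
  refine Finset.sum_congr rfl fun l _ => by ring

/-- The algebra behind the conformal change of the Ricci tensor at a point. The left-hand side is
what the Ricci tensor gains when the connection `Γ` is replaced by `Γ + S`, with `S` the conformal
shift and its derivative written out. `du`, `dV` and `dg` stand for the partial derivatives of `u`,
`V` and `g`, and `hdg` is metric compatibility of `Γ`. -/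
lemma ricci_confShift (du dV : Fin n → Fin n → ℝ) (dg : Fin n → Fin n → Fin n → ℝ)
    (hΓ : ∀ k i j, Γ k i j = Γ k j i) (hg : ∀ i j, g i j = g j i)
    (hV : ∀ i, ∑ k, g i k * V k = u i) (hdu : ∀ i j, du i j = du j i)
    (hdg : ∀ m i j, dg m i j = ∑ k, (g i k * Γ k m j + g j k * Γ k m i))
    (i j : Fin n) :
    ∑ k, ((-((if k = i then du k j else 0) + (if k = j then du k i else 0)
            - (dg k i j * V k + g i j * dV k k)))
        + ∑ l, ((Γ k k l + confShift g u V k k l) * (Γ l i j + confShift g u V l i j)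
          - (Γ k j l + confShift g u V k j l) * (Γ l i k + confShift g u V l i k)))
      + n * du j i
    = ∑ k, ∑ l, (Γ k k l * Γ l i j - Γ k j l * Γ l i k)
      + (n - 2) * (du i j - ∑ k, Γ k i j * u k + u i * u j - (∑ k, u k * V k) * g i j)
      + (∑ k, (dV k k + ∑ l, Γ k k l * V l)) * g i j := by
  have hS : ∀ i, ∑ k, confShift g u V k k i = -(n : ℝ) * u i := by
    intro i
    rw [← sum_confShift g u V hV i]
    refine Finset.sum_congr rfl fun k _ => ?_
    unfold confShift; rw [hg k i]; ring
  -- the products of the two connections, term by term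
  have t1 := sum_christoffel_mul_confShift Γ g u V i j
  have t2 := sum_christoffel_mul_confShift' Γ g u V i j
  have t3 := sum_confShift_mul g u V (fun l k => Γ l i k) j
  have t4 := sum_confShift_mul g u V (fun l k => confShift g u V l i k) j
  have t5 : ∑ k, ∑ l, confShift g u V k k l * Γ l i j = -(n : ℝ) * ∑ l, u l * Γ l i j := by
    rw [Finset.sum_comm, Finset.mul_sum]
    refine Finset.sum_congr rfl fun l _ => ?_
    rw [← Finset.sum_mul, hS]; ring
  have t6 : ∑ k, ∑ l, confShift g u V k k l * confShift g u V l i j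
      = -(n : ℝ) * ∑ l, u l * confShift g u V l i j := by
    rw [Finset.sum_comm, Finset.mul_sum]
    refine Finset.sum_congr rfl fun l _ => ?_
    rw [← Finset.sum_mul, hS]; ring
  have t7 := sum_mul_confShift g u V u i j
  have t8 : ∑ l, ∑ k, g j l * confShift g u V l i k * V k
      = -(g j i * ∑ k, u k * V k + u i * u j - u i * u j) := by
    have : ∀ k, ∑ l, g j l * confShift g u V l i k
        = -(g j i * u k + g j k * u i - g i k * u j) := by
      intro k; rw [sum_mul_confShift, hV j]
    rw [Finset.sum_comm]
    simp_rw [← Finset.sum_mul, this]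
    simp only [neg_mul, add_mul, sub_mul, Finset.sum_neg_distrib, Finset.sum_add_distrib,
      Finset.sum_sub_distrib, Finset.mul_sum]
    have a1 : ∑ k, g j k * u i * V k = u i * u j := by
      rw [← hV j, Finset.mul_sum]; exact Finset.sum_congr rfl fun k _ => by ring
    have a2 : ∑ k, g i k * u j * V k = u i * u j := by
      rw [← hV i, Finset.sum_mul]; exact Finset.sum_congr rfl fun k _ => by ring
    rw [a1, a2]
    congr 3
    exact Finset.sum_congr rfl fun k _ => by ring
  have t9 : ∑ l, u l * confShift g u V l i j = -(2 * u i * u j - g i j * ∑ l, u l * V l) := by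
    rw [t7]; ring
  have t10 := sum_confShift g u V hV i
  have d1 : ∑ k, (-((if k = i then du k j else 0) + (if k = j then du k i else 0)
            - (dg k i j * V k + g i j * dV k k)))
      = -(du i j + du j i - (∑ k, dg k i j * V k + g i j * ∑ k, dV k k)) := by
    simp only [Finset.sum_neg_distrib, Finset.sum_add_distrib, Finset.sum_sub_distrib,
      Finset.mul_sum]
    simp
  have d2 : ∑ k, dg k i j * V k
      = ∑ k, ∑ l, Γ k j l * g i k * V l + ∑ l, ∑ k, g j l * Γ l i k * V k := by
    simp_rw [hdg, Finset.sum_mul]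
    rw [Finset.sum_comm, ← Finset.sum_add_distrib]
    refine Finset.sum_congr rfl fun k _ => ?_
    rw [← Finset.sum_add_distrib]
    refine Finset.sum_congr rfl fun l _ => ?_
    rw [hΓ k l j, hΓ k l i]; ring
  have d3 : ∑ k, ∑ l, ((Γ k k l + confShift g u V k k l) * (Γ l i j + confShift g u V l i j)
          - (Γ k j l + confShift g u V k j l) * (Γ l i k + confShift g u V l i k))
      = ∑ k, ∑ l, (Γ k k l * Γ l i j - Γ k j l * Γ l i k)
        + (∑ k, ∑ l, Γ k k l * confShift g u V l i j
          + ∑ k, ∑ l, confShift g u V k k l * Γ l i j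
          + ∑ k, ∑ l, confShift g u V k k l * confShift g u V l i j)
        - (∑ k, ∑ l, Γ k j l * confShift g u V l i k
          + ∑ k, ∑ l, confShift g u V k j l * Γ l i k
          + ∑ k, ∑ l, confShift g u V k j l * confShift g u V l i k) := by
    simp only [← Finset.sum_add_distrib, ← Finset.sum_sub_distrib]
    refine Finset.sum_congr rfl fun k _ => Finset.sum_congr rfl fun l _ => by ring
  rw [Finset.sum_add_distrib, d1, d2, d3, t1, t2, t3, t4, t5, t6, t8, t9, t10,
    Finset.sum_add_distrib]
  have c1 : ∑ k, Γ k k j * u i = ∑ k, Γ k j k * u i :=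
    Finset.sum_congr rfl fun k _ => by rw [hΓ]
  have c2 : u j * ∑ k, Γ k i k = ∑ k, Γ k k i * u j := by
    rw [Finset.mul_sum]; exact Finset.sum_congr rfl fun k _ => by rw [hΓ k i k]; ring
  have c3 : ∑ l, u l * Γ l i j = ∑ k, Γ k i j * u k :=
    Finset.sum_congr rfl fun k _ => by ring
  have c4 : ∑ k, Γ k j i * u k = ∑ k, Γ k i j * u k :=
    Finset.sum_congr rfl fun k _ => by rw [hΓ]
  rw [c1, c2, c3, c4, hdu j i, hg j i]
  ring

end ConformalAlgebra

/-! ### The Ricci tensor of a conformally rescaled metric -/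

section ConformalChange

variable {n : ℕ} {U : Set (Coord n)} {G : Coord n → Matrix (Fin n) (Fin n) ℝ} {x : Coord n}
  {Ξ : Coord n → ℝ}

lemma pair_sharp (a b : Fin n → ℝ) : pair a (sharp G x b) = dotCov G x a b := by
  unfold pair sharp dotCov
  simp_rw [Finset.mul_sum]
  exact Finset.sum_congr rfl fun k _ => Finset.sum_congr rfl fun l _ => by ring

/-- The logarithmic differential `Ξ⁻¹ dΞ`. -/
def logDiff (U : Set (Coord n)) (Ξ : Coord n → ℝ) (x : Coord n) (i : Fin n) : ℝ :=
  (Ξ x)⁻¹ * pd U i Ξ x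

/-- The metric `Ξ⁻² g`. -/
def rescaled (Ξ : Coord n → ℝ) (G : Coord n → Matrix (Fin n) (Fin n) ℝ) (x : Coord n) :
    Matrix (Fin n) (Fin n) ℝ := (Ξ x ^ 2)⁻¹ • G x

lemma rescaled_inv (h0 : Ξ x ≠ 0) (hd : (G x).det ≠ 0) :
    (rescaled Ξ G x)⁻¹ = (Ξ x ^ 2) • (G x)⁻¹ := by
  refine Matrix.inv_eq_left_inv ?_
  unfold rescaled
  rw [Matrix.smul_mul, Matrix.mul_smul, Matrix.nonsing_inv_mul _ (Ne.isUnit hd), smul_smul,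
    mul_inv_cancel₀ (pow_ne_zero 2 h0), one_smul]

namespace IsSmoothMetric

variable (hG : IsSmoothMetric U G) (hΞ : ContDiffOn ℝ ∞ Ξ U) (h0 : ∀ y ∈ U, Ξ y ≠ 0)
include hG

lemma smooth_sharp {w : Coord n → Fin n → ℝ} (hw : ∀ i, ContDiffOn ℝ ∞ (fun y => w y i) U)
    (k : Fin n) : ContDiffOn ℝ ∞ (fun y => sharp G y (w y) k) U := by
  unfold sharp
  exact ContDiffOn.sum fun i _ => (hG.smooth_inv _ _).mul (hw i)

/-- The divergence of `w♯` is the trace of `∇w`. -/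
lemma div_sharp {w : Coord n → Fin n → ℝ} (hw : ∀ i, ContDiffOn ℝ ∞ (fun y => w y i) U)
    (hx : x ∈ U) :
    ∑ k, (pd U k (fun y => sharp G y (w y) k) x
        + ∑ l, christoffel U G k k l x * sharp G x (w x) l)
      = ∑ i, ∑ j, (G x)⁻¹ i j * nablaCovector U G w i j x := by
  have e1 : ∀ k, pd U k (fun y => sharp G y (w y) k) x
      = ∑ l, (pd U k (fun y => (G y)⁻¹ k l) x * w x l + (G x)⁻¹ k l * pd U k (fun y => w y l) x) := by
    intro k
    unfold sharp
    rw [pd_sum _ hG.uniqueDiff hx fun l => (hG.smooth_inv k l).mul (hw l)]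
    exact Finset.sum_congr rfl fun l _ =>
      pd_mul hG.uniqueDiff hx (hG.smooth_inv k l) (hw l) k
  have e2 : ∑ k, ∑ l, pd U k (fun y => (G y)⁻¹ k l) x * w x l
      = -(∑ k, ∑ l, ∑ m, (G x)⁻¹ k m * christoffel U G l k m x * w x l)
        - ∑ k, ∑ l, ∑ m, (G x)⁻¹ l m * christoffel U G k k m x * w x l := by
    simp_rw [hG.pd_inv_metric hx, neg_mul, Finset.sum_mul, Finset.sum_neg_distrib, add_mul,
      Finset.sum_add_distrib]
    ring
  have e3 : ∑ k, ∑ l, christoffel U G k k l x * sharp G x (w x) l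
      = ∑ k, ∑ l, ∑ m, (G x)⁻¹ l m * christoffel U G k k m x * w x l := by
    unfold sharp
    refine Finset.sum_congr rfl fun k _ => ?_
    simp_rw [Finset.mul_sum]
    rw [Finset.sum_comm]
    refine Finset.sum_congr rfl fun l _ => Finset.sum_congr rfl fun m _ => ?_
    rw [hG.inv_symm hx l m]; ring
  have e4 : ∑ k, ∑ l, (G x)⁻¹ k l * ∑ m, christoffel U G m k l x * w x m
      = ∑ k, ∑ l, ∑ m, (G x)⁻¹ k m * christoffel U G l k m x * w x l := by
    simp_rw [Finset.mul_sum]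
    refine Finset.sum_congr rfl fun k _ => ?_
    rw [Finset.sum_comm]
    refine Finset.sum_congr rfl fun l _ => Finset.sum_congr rfl fun m _ => by ring
  simp_rw [e1]
  unfold nablaCovector
  simp_rw [mul_sub, Finset.sum_add_distrib, Finset.sum_sub_distrib]
  rw [e2, e3, e4]
  ring

include hΞ h0

omit hG in
lemma smooth_logDiff (hU : UniqueDiffOn ℝ U) (i : Fin n) :
    ContDiffOn ℝ ∞ (fun y => logDiff U Ξ y i) U := by
  unfold logDiff
  exact (hΞ.inv h0).mul (contDiffOn_pd hU hΞ i)

lemma pd_logDiff (hx : x ∈ U) (i j : Fin n) :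
    pd U i (fun y => logDiff U Ξ y j) x
      = (Ξ x)⁻¹ * pd U i (pd U j Ξ) x - logDiff U Ξ x i * logDiff U Ξ x j := by
  unfold logDiff
  rw [pd_mul hG.uniqueDiff hx (contDiffOn_fun_inv hΞ h0) (contDiffOn_pd hG.uniqueDiff hΞ j),
    pd_inv hG.uniqueDiff hx hΞ (h0 x hx)]
  have := h0 x hx
  field_simp
  ring

lemma pd_rescaled (hx : x ∈ U) (m i j : Fin n) :
    pd U m (fun y => rescaled Ξ G y i j) x
      = (Ξ x ^ 2)⁻¹ * (pd U m (fun y => G y i j) x - 2 * logDiff U Ξ x m * G x i j) := by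
  have e : (fun y => rescaled Ξ G y i j) = fun y => (Ξ y * Ξ y)⁻¹ * G y i j := by
    ext y; simp [rescaled, sq]
  have h2 : ContDiffOn ℝ ∞ (fun y => Ξ y * Ξ y) U := hΞ.mul hΞ
  have h3 : ∀ y ∈ U, Ξ y * Ξ y ≠ 0 := fun y hy => mul_ne_zero (h0 y hy) (h0 y hy)
  rw [e, pd_mul hG.uniqueDiff hx (contDiffOn_fun_inv h2 h3) (hG.smooth i j),
    pd_inv hG.uniqueDiff hx h2 (h3 x hx), pd_mul hG.uniqueDiff hx hΞ hΞ]
  unfold logDiff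
  have := h0 x hx
  field_simp
  ring

lemma rescaled_isSmoothMetric : IsSmoothMetric U (rescaled Ξ G) where
  uniqueDiff := hG.uniqueDiff
  subset_closure := hG.subset_closure
  smooth i j := by
    unfold rescaled
    exact ((hΞ.pow 2).inv fun y hy => pow_ne_zero 2 (h0 y hy)).mul (hG.smooth i j)
  symm y hy i j := by
    unfold rescaled
    simp only [Matrix.smul_apply]
    rw [hG.symm y hy i j]
  det_ne y hy := by
    unfold rescaled
    rw [Matrix.det_smul]
    exact mul_ne_zero (pow_ne_zero _ (inv_ne_zero (pow_ne_zero 2 (h0 y hy)))) (hG.det_ne y hy)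

/-- The Levi-Civita connection of `Ξ⁻² g`. -/
lemma christoffel_rescaled (hx : x ∈ U) (k i j : Fin n) :
    christoffel U (rescaled Ξ G) k i j x = christoffel U G k i j x
      + confShift (G x) (logDiff U Ξ x) (sharp G x (logDiff U Ξ x)) k i j := by
  have hf : ∀ l, christoffelFirst U (rescaled Ξ G) l i j x
      = (Ξ x ^ 2)⁻¹ * (christoffelFirst U G l i j x
        - (logDiff U Ξ x i * G x l j + logDiff U Ξ x j * G x l i
          - G x i j * logDiff U Ξ x l)) := by
    intro l
    unfold christoffelFirst
    rw [hG.pd_rescaled hΞ h0 hx, hG.pd_rescaled hΞ h0 hx, hG.pd_rescaled hΞ h0 hx,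
      hG.symm x hx j l, hG.symm x hx i l]
    ring
  rw [christoffel_eq_sum_first, christoffel_eq_sum_first, rescaled_inv (h0 x hx) (hG.det_ne x hx)]
  simp_rw [hf]
  have h4 : (Ξ x ^ 2) * (Ξ x ^ 2)⁻¹ = 1 := mul_inv_cancel₀ (pow_ne_zero 2 (h0 x hx))
  have e1 : ∀ l, ((Ξ x ^ 2) • (G x)⁻¹) k l * ((Ξ x ^ 2)⁻¹ * (christoffelFirst U G l i j x
        - (logDiff U Ξ x i * G x l j + logDiff U Ξ x j * G x l i
          - G x i j * logDiff U Ξ x l)))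
      = (G x)⁻¹ k l * christoffelFirst U G l i j x - (logDiff U Ξ x i * ((G x)⁻¹ k l * G x l j)
        + logDiff U Ξ x j * ((G x)⁻¹ k l * G x l i)
          - G x i j * ((G x)⁻¹ k l * logDiff U Ξ x l)) := by
    intro l
    rw [Matrix.smul_apply, smul_eq_mul, mul_mul_mul_comm, mul_comm ((G x)⁻¹ k l)]
    rw [show ∀ a b c d : ℝ, a * b * (c * d) = (a * c) * (b * d) by intros; ring]
    linear_combination (christoffelFirst U G l i j x
        - (logDiff U Ξ x i * G x l j + logDiff U Ξ x j * G x l i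
          - G x i j * logDiff U Ξ x l)) * (G x)⁻¹ k l * h4
  simp_rw [e1]
  rw [Finset.sum_sub_distrib, Finset.sum_sub_distrib, Finset.sum_add_distrib]
  simp_rw [← Finset.mul_sum]
  rw [hG.inv_mul hx, hG.inv_mul hx]
  unfold confShift sharp
  split_ifs <;> ring

/-- The Ricci tensor of `Ξ⁻² g`, with `u = Ξ⁻¹ dΞ`:
`R̃ = R + (n - 2)(∇u + u ⊗ u - |u|² g) + (div u) g`. -/
theorem ricci_rescaled (hx : x ∈ U) (i j : Fin n) :
    ricci U (rescaled Ξ G) i j x = ricci U G i j x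
      + ((n : ℝ) - 2) * (nablaCovector U G (logDiff U Ξ) i j x
        + logDiff U Ξ x i * logDiff U Ξ x j
        - dotCov G x (logDiff U Ξ x) (logDiff U Ξ x) * G x i j)
      + (∑ k, ∑ l, (G x)⁻¹ k l * nablaCovector U G (logDiff U Ξ) k l x) * G x i j := by
  have hu := smooth_logDiff hΞ h0 hG.uniqueDiff
  have hV := hG.smooth_sharp hu
  set u := logDiff U Ξ with hudef
  -- differentiate the formula for the Christoffel symbols
  have hpd : ∀ m k i j, pd U m (christoffel U (rescaled Ξ G) k i j) x
      = pd U m (christoffel U G k i j) x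
        + -((if k = i then pd U m (fun y => u y j) x else 0)
          + (if k = j then pd U m (fun y => u y i) x else 0)
          - (pd U m (fun y => G y i j) x * sharp G x (u x) k
            + G x i j * pd U m (fun y => sharp G y (u y) k) x)) := by
    intro m k i j
    rw [pd_congr (fun y hy => hG.christoffel_rescaled hΞ h0 hy k i j) hx]
    have s1 : ∀ a b : Fin n, ContDiffOn ℝ ∞ (fun y => if k = a then u y b else 0) U := by
      intro a b
      split_ifs
      · exact hu b
      · exact contDiffOn_const
    have p1 : ∀ a b : Fin n, pd U m (fun y => if k = a then u y b else 0) x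
        = if k = a then pd U m (fun y => u y b) x else 0 := by
      intro a b
      split_ifs
      · rfl
      · exact pd_const _ _
    have s2 : ContDiffOn ℝ ∞ (fun y => G y i j * sharp G y (u y) k) U := (hG.smooth i j).mul (hV k)
    unfold confShift
    rw [pd_add hG.uniqueDiff hx (hG.smooth_christoffel k i j)
      (((s1 i j).add (s1 j i)).sub s2).neg, pd_neg hG.uniqueDiff hx,
      pd_sub hG.uniqueDiff hx ((s1 i j).add (s1 j i)) s2,
      pd_add hG.uniqueDiff hx (s1 i j) (s1 j i), p1, p1,
      pd_mul hG.uniqueDiff hx (hG.smooth i j) (hV k)]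
  have hVu : ∀ i, ∑ k, G x i k * sharp G x (u x) k = u x i := fun i =>
    congrFun (hG.flat_sharp hx (u x)) i
  have alg := ricci_confShift (fun k i j => christoffel U G k i j x) (G x) (u x) (sharp G x (u x))
    (fun m i => pd U m (fun y => u y i) x) (fun m k => pd U m (fun y => sharp G y (u y) k) x)
    (fun m i j => pd U m (fun y => G y i j) x)
    (fun k i j => hG.christoffel_symm hx k i j) (hG.symm x hx) hVu
    (by
      intro i j
      simp only [hudef]
      rw [hG.pd_logDiff hΞ h0 hx, hG.pd_logDiff hΞ h0 hx,
        pd_comm hG.uniqueDiff hG.subset_closure hx hΞ]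
      ring)
    (fun m i j => hG.pd_metric hx m i j) i j
  rw [hG.div_sharp hu hx] at alg
  have hdot : ∑ k, u x k * sharp G x (u x) k = dotCov G x (u x) (u x) := pair_sharp _ _
  rw [hdot] at alg
  -- the contracted shift `Sᵏᵢₖ = -n uᵢ`
  have hct : ∑ k, pd U j (christoffel U (rescaled Ξ G) k i k) x
      = ∑ k, pd U j (christoffel U G k i k) x - n * pd U j (fun y => u y i) x := by
    have e : EqOn (fun y => ∑ k, christoffel U (rescaled Ξ G) k i k y)
        (fun y => ∑ k, christoffel U G k i k y + (-(n : ℝ)) * u y i) U := by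
      intro y hy
      simp only
      simp_rw [hG.christoffel_rescaled hΞ h0 hy]
      rw [Finset.sum_add_distrib, sum_confShift (G y) _ _
        (fun i => congrFun (hG.flat_sharp hy (u y)) i)]
    have := pd_congr e hx j
    rw [pd_sum _ hG.uniqueDiff hx
        (fun k => (hG.rescaled_isSmoothMetric hΞ h0).smooth_christoffel k i k),
      pd_add hG.uniqueDiff hx (ContDiffOn.sum fun k _ => hG.smooth_christoffel k i k)
        (contDiffOn_const.mul (hu i)),
      pd_sum _ hG.uniqueDiff hx (fun k => hG.smooth_christoffel k i k),
      pd_const_mul hG.uniqueDiff hx (hu i)] at this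
    rw [this]; ring
  unfold ricci
  rw [Finset.sum_add_distrib, Finset.sum_sub_distrib, hct]
  simp_rw [hpd, hG.christoffel_rescaled hΞ h0 hx]
  rw [Finset.sum_add_distrib] at alg ⊢
  simp only [Finset.sum_add_distrib, Finset.sum_sub_distrib] at alg ⊢
  simp only [nablaCovector] at alg ⊢
  linear_combination alg

end IsSmoothMetric

end ConformalChange

/-! ### The conformal field equations up to the boundary -/

section Locality

variable {n : ℕ} {U W : Set (Coord n)} {G : Coord n → Matrix (Fin n) (Fin n) ℝ} {x : Coord n}

lemma christoffel_of_mem_nhdsWithin (hW : W ∈ 𝓝[U] x) (hWU : W ⊆ U) (k i j : Fin n) :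
    christoffel W G k i j x = christoffel U G k i j x := by
  unfold christoffel
  simp_rw [pd_of_mem_nhdsWithin hW hWU]

lemma nablaCovector_of_mem_nhdsWithin {w : Coord n → Fin n → ℝ} (hW : W ∈ 𝓝[U] x)
    (hWU : W ⊆ U) (i j : Fin n) :
    nablaCovector W G w i j x = nablaCovector U G w i j x := by
  unfold nablaCovector
  simp_rw [pd_of_mem_nhdsWithin hW hWU, christoffel_of_mem_nhdsWithin hW hWU]

lemma ricci_of_mem_nhdsWithin (hW : ∀ y ∈ W, W ∈ 𝓝[U] y) (hWU : W ⊆ U) (hx : x ∈ W)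
    (i j : Fin n) : ricci W G i j x = ricci U G i j x := by
  have e : ∀ k i j m, pd W m (christoffel W G k i j) x = pd U m (christoffel U G k i j) x := by
    intro k i j m
    rw [pd_congr (fun y hy => christoffel_of_mem_nhdsWithin (hW y hy) hWU k i j) hx,
      pd_of_mem_nhdsWithin (hW x hx) hWU]
  unfold ricci
  simp_rw [e, christoffel_of_mem_nhdsWithin (hW x hx) hWU]

lemma IsSmoothMetric.inter_isOpen (hG : IsSmoothMetric U G) {V : Set (Coord n)} (hV : IsOpen V) :
    IsSmoothMetric (U ∩ V) G where
  uniqueDiff := hG.uniqueDiff.inter hV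
  subset_closure := by
    rw [interior_inter, hV.interior_eq]
    exact fun y hy => hV.closure_inter ⟨hG.subset_closure hy.1, hy.2⟩
  smooth i j := (hG.smooth i j).mono inter_subset_left
  symm y hy := hG.symm y hy.1
  det_ne y hy := hG.det_ne y hy.1

/-- Covariant differentiation of a metric product of covector fields. -/
lemma IsSmoothMetric.pd_dotCov (hG : IsSmoothMetric U G) (hx : x ∈ U)
    {α β : Coord n → Fin n → ℝ} (hα : ∀ i, ContDiffOn ℝ ∞ (fun y => α y i) U)
    (hβ : ∀ i, ContDiffOn ℝ ∞ (fun y => β y i) U) (m : Fin n) :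
    pd U m (fun y => dotCov G y (α y) (β y)) x
      = dotCov G x (fun i => nablaCovector U G α m i x) (β x)
        + dotCov G x (α x) (fun j => nablaCovector U G β m j x) := by
  have e1 : pd U m (fun y => dotCov G y (α y) (β y)) x
      = ∑ i, ∑ j, (pd U m (fun y => (G y)⁻¹ i j) x * α x i * β x j
        + (G x)⁻¹ i j * pd U m (fun y => α y i) x * β x j
        + (G x)⁻¹ i j * α x i * pd U m (fun y => β y j) x) := by
    unfold dotCov
    have s1 : ∀ i j, ContDiffOn ℝ ∞ (fun y => (G y)⁻¹ i j * α y i) U :=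
      fun i j => (hG.smooth_inv i j).mul (hα i)
    rw [pd_sum _ hG.uniqueDiff hx fun i => ContDiffOn.sum fun j _ => (s1 i j).mul (hβ j)]
    refine Finset.sum_congr rfl fun i _ => ?_
    rw [pd_sum _ hG.uniqueDiff hx fun j => (s1 i j).mul (hβ j)]
    refine Finset.sum_congr rfl fun j _ => ?_
    rw [pd_mul hG.uniqueDiff hx (s1 i j) (hβ j),
      pd_mul hG.uniqueDiff hx (hG.smooth_inv i j) (hα i)]
    ring
  have e2 : ∑ i, ∑ j, pd U m (fun y => (G y)⁻¹ i j) x * α x i * β x j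
      = -(∑ i, ∑ j, (G x)⁻¹ i j * α x i * ∑ k, christoffel U G k m j x * β x k)
        - ∑ i, ∑ j, (G x)⁻¹ i j * (∑ k, christoffel U G k m i x * α x k) * β x j := by
    simp_rw [hG.pd_inv_metric hx, neg_mul, Finset.sum_mul, Finset.sum_neg_distrib, add_mul,
      Finset.sum_add_distrib, Finset.mul_sum]
    rw [neg_add, ← sub_eq_add_neg]
    congr 1
    · congr 1
      refine Finset.sum_congr rfl fun i _ => ?_
      rw [Finset.sum_comm]
      refine Finset.sum_congr rfl fun j _ => Finset.sum_congr rfl fun k _ => by ring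
    · rw [Finset.sum_comm]
      simp_rw [Finset.sum_mul]
      rw [Finset.sum_comm (s := (Finset.univ : Finset (Fin n)))]
      conv_rhs => rw [Finset.sum_comm]
      rw [Finset.sum_comm]
      refine Finset.sum_congr rfl fun i _ => ?_
      rw [Finset.sum_comm]
      refine Finset.sum_congr rfl fun j _ => Finset.sum_congr rfl fun k _ => ?_
      rw [hG.inv_symm hx i j]; ring
  rw [e1]
  unfold dotCov nablaCovector
  simp_rw [mul_sub, sub_mul, Finset.sum_add_distrib, Finset.sum_sub_distrib]
  rw [e2]; ring

end Locality

section Traces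

variable {n : ℕ} {U : Set (Coord n)} {G : Coord n → Matrix (Fin n) (Fin n) ℝ} {x : Coord n}
  {ι : Type*} [Fintype ι]

/-- The metric trace of a covariant tensor of rank two. -/
def trace (G : Coord n → Matrix (Fin n) (Fin n) ℝ) (x : Coord n) (T : Fin n → Fin n → ℝ) : ℝ :=
  ∑ i, ∑ j, (G x)⁻¹ i j * T i j

lemma trace_add (S T : Fin n → Fin n → ℝ) :
    trace G x (fun i j => S i j + T i j) = trace G x S + trace G x T := by
  unfold trace; simp_rw [mul_add, Finset.sum_add_distrib]

lemma trace_sub (S T : Fin n → Fin n → ℝ) :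
    trace G x (fun i j => S i j - T i j) = trace G x S - trace G x T := by
  unfold trace; simp_rw [mul_sub, Finset.sum_sub_distrib]

lemma trace_mul_left (c : ℝ) (T : Fin n → Fin n → ℝ) :
    trace G x (fun i j => c * T i j) = c * trace G x T := by
  unfold trace; simp_rw [Finset.mul_sum]
  exact Finset.sum_congr rfl fun i _ => Finset.sum_congr rfl fun j _ => by ring

lemma IsSmoothMetric.trace_metric (hG : IsSmoothMetric U G) (hx : x ∈ U) :
    trace G x (fun i j => G x i j) = n := by
  unfold trace
  have : ∀ i, ∑ j, (G x)⁻¹ i j * G x i j = 1 := by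
    intro i
    have e := hG.inv_mul hx i i
    rw [if_pos rfl] at e
    rw [← e]
    exact Finset.sum_congr rfl fun j _ => by rw [hG.symm x hx i j]
  simp_rw [this]; simp

lemma trace_mul_metric (hG : IsSmoothMetric U G) (hx : x ∈ U) (c : ℝ) :
    trace G x (fun i j => c * G x i j) = c * n := by
  exact (trace_mul_left c fun i j => G x i j).trans (by rw [hG.trace_metric hx])

/-- In dimension four the stress tensor of the gauge fields is trace-free. -/
lemma trace_ymStress {U : Set (Coord 4)} {G : Coord 4 → Matrix (Fin 4) (Fin 4) ℝ} {x : Coord 4}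
    (hG : IsSmoothMetric U G) (hx : x ∈ U) (F : ι → Coord 4 → Fin 4 → Fin 4 → ℝ) :
    trace G x (fun i j => ymStress G F i j x) = 0 := by
  unfold ymStress
  rw [trace_sub, trace_mul_metric hG hx]
  unfold trace
  have : ∑ i, ∑ j, (G x)⁻¹ i j * ∑ p, ∑ c, ∑ d, (G x)⁻¹ c d * F p x i c * F p x j d
      = ∑ p, ∑ a, ∑ b, ∑ c, ∑ d,
      (G x)⁻¹ a c * (G x)⁻¹ b d * F p x a b * F p x c d := by
    simp_rw [Finset.mul_sum]
    have h1 : ∀ i : Fin 4, ∑ j, ∑ p, ∑ c, ∑ d,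
        (G x)⁻¹ i j * ((G x)⁻¹ c d * F p x i c * F p x j d)
      = ∑ p, ∑ j, ∑ c, ∑ d,
        (G x)⁻¹ i j * ((G x)⁻¹ c d * F p x i c * F p x j d) := fun i => Finset.sum_comm
    simp_rw [h1]
    rw [Finset.sum_comm]
    refine Finset.sum_congr rfl fun p _ => Finset.sum_congr rfl fun i _ => ?_
    rw [Finset.sum_comm]
    refine Finset.sum_congr rfl fun j _ => Finset.sum_congr rfl fun k _ =>
      Finset.sum_congr rfl fun l _ => by ring
  rw [this]; push_cast; ring

/-- The stress tensor has conformal weight two: with respect to `Ξ⁻² g` it is `Ξ²` times that of `g`. -/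
lemma ymStress_rescaled {Ξ : Coord n → ℝ} (h0 : Ξ x ≠ 0) (hd : (G x).det ≠ 0)
    (F : ι → Coord n → Fin n → Fin n → ℝ) (i j : Fin n) :
    ymStress (rescaled Ξ G) F i j x = Ξ x ^ 2 * ymStress G F i j x := by
  unfold ymStress
  rw [rescaled_inv h0 hd]
  unfold rescaled
  simp only [Matrix.smul_apply, smul_eq_mul]
  have e1 : ∑ p, ∑ a, ∑ b, ∑ c, ∑ d, Ξ x ^ 2 * (G x)⁻¹ a c * (Ξ x ^ 2 * (G x)⁻¹ b d)
        * F p x a b * F p x c d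
      = Ξ x ^ 2 * Ξ x ^ 2 * ∑ p, ∑ a, ∑ b, ∑ c, ∑ d,
      (G x)⁻¹ a c * (G x)⁻¹ b d * F p x a b * F p x c d := by
    simp_rw [Finset.mul_sum]
    refine Finset.sum_congr rfl fun p _ => Finset.sum_congr rfl fun a _ =>
      Finset.sum_congr rfl fun b _ => Finset.sum_congr rfl fun c _ =>
      Finset.sum_congr rfl fun d _ => by ring
  have e2 : ∑ p, ∑ c, ∑ d, Ξ x ^ 2 * (G x)⁻¹ c d * F p x i c * F p x j d
      = Ξ x ^ 2 * ∑ p, ∑ c, ∑ d, (G x)⁻¹ c d * F p x i c * F p x j d := by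
    simp_rw [Finset.mul_sum]
    refine Finset.sum_congr rfl fun p _ => Finset.sum_congr rfl fun c _ =>
      Finset.sum_congr rfl fun d _ => by ring
  rw [e1, e2]
  field_simp

lemma dotCov_metric_left (hG : IsSmoothMetric U G) (hx : x ∈ U) (a : Fin n) (w : Fin n → ℝ) :
    dotCov G x (fun i => G x a i) w = w a := by
  rw [← pair_sharp]
  exact congrFun (hG.flat_sharp hx w) a

lemma dotCov_smul_add (c d : ℝ) (α β w : Fin n → ℝ) :
    dotCov G x (fun i => c * α i + d * β i) w = c * dotCov G x α w + d * dotCov G x β w := by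
  unfold dotCov
  simp_rw [Finset.mul_sum, ← Finset.sum_add_distrib]
  exact Finset.sum_congr rfl fun i _ => Finset.sum_congr rfl fun j _ => by ring

lemma dotCov_comm (hG : IsSmoothMetric U G) (hx : x ∈ U) (α β : Fin n → ℝ) :
    dotCov G x α β = dotCov G x β α := by
  unfold dotCov
  rw [Finset.sum_comm]
  exact Finset.sum_congr rfl fun i _ => Finset.sum_congr rfl fun j _ => by
    rw [hG.inv_symm hx]; ring

end Traces

/-- The local data of a conformal extension: on the coordinate domain `U`, a smooth metric `g`, a
conformal factor `Ξ` whose zeros have dense complement in `U`, and gauge fields such that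
`Ξ⁻² g` solves Einstein's equations where `Ξ ≠ 0`. -/
structure IsLocalExtension {ι : Type*} [Fintype ι] (U : Set (Coord 4))
    (G : Coord 4 → Matrix (Fin 4) (Fin 4) ℝ) (Ξ : Coord 4 → ℝ) (lam : ℝ)
    (F : ι → Coord 4 → Fin 4 → Fin 4 → ℝ) : Prop where
  metric : IsSmoothMetric U G
  smooth_factor : ContDiffOn ℝ ∞ Ξ U
  smooth_field : ∀ p i j, ContDiffOn ℝ ∞ (fun x => F p x i j) U
  dense : U ⊆ closure {x | x ∈ U ∧ Ξ x ≠ 0}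
  einstein : ∀ x ∈ U, Ξ x ≠ 0 → ∀ i j, ricci U (rescaled Ξ G) i j x
    - (1 / 2) * scalarCurv U (rescaled Ξ G) x * rescaled Ξ G x i j
    + lam * rescaled Ξ G x i j = ymStress (rescaled Ξ G) F i j x

section LocalExtension

variable {ι : Type*} [Fintype ι] {U : Set (Coord 4)}
  {G : Coord 4 → Matrix (Fin 4) (Fin 4) ℝ} {Ξ : Coord 4 → ℝ} {lam : ℝ}
  {F : ι → Coord 4 → Fin 4 → Fin 4 → ℝ} {x : Coord 4}

/-- The tensor `L - ½ Ξ² T`, where `L` is the Schouten tensor of `g` and `T` the stress tensor of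
the gauge fields with respect to `g`. By Einstein's equations it is the smooth extension of `H`. -/
def smoothH (U : Set (Coord 4)) (G : Coord 4 → Matrix (Fin 4) (Fin 4) ℝ) (Ξ : Coord 4 → ℝ)
    (F : ι → Coord 4 → Fin 4 → Fin 4 → ℝ) (i j : Fin 4) (x : Coord 4) : ℝ :=
  schouten U G i j x - (1 / 2) * Ξ x ^ 2 * ymStress G F i j x

/-- The scalar `s = ¼ □Ξ + (1/24) R Ξ`. -/
def friedrichScalar (U : Set (Coord 4)) (G : Coord 4 → Matrix (Fin 4) (Fin 4) ℝ) (Ξ : Coord 4 → ℝ)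
    (x : Coord 4) : ℝ :=
  (1 / 4) * (∑ i, ∑ j, (G x)⁻¹ i j * nablaCovector U G (dComp U Ξ) i j x)
    + (1 / 24) * scalarCurv U G x * Ξ x

namespace IsLocalExtension

variable (h : IsLocalExtension U G Ξ lam F)
include h

lemma smooth_ymStress (i j : Fin 4) : ContDiffOn ℝ ∞ (ymStress G F i j) U := by
  unfold ymStress
  have hi := h.metric.smooth_inv
  have hF := h.smooth_field
  refine ContDiffOn.sub ((contDiffOn_const.mul ?_).mul (h.metric.smooth i j)) ?_
  · exact ContDiffOn.sum fun p _ => ContDiffOn.sum fun a _ => ContDiffOn.sum fun b _ =>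
      ContDiffOn.sum fun c _ => ContDiffOn.sum fun d _ =>
        (((hi a c).mul (hi b d)).mul (hF p a b)).mul (hF p c d)
  · exact ContDiffOn.sum fun p _ => ContDiffOn.sum fun c _ => ContDiffOn.sum fun d _ =>
        ((hi c d).mul (hF p i c)).mul (hF p j d)

lemma smooth_smoothH (i j : Fin 4) : ContDiffOn ℝ ∞ (smoothH U G Ξ F i j) U := by
  unfold smoothH schouten
  exact (contDiffOn_const.mul ((h.metric.smooth_ricci i j).sub
    ((h.metric.smooth_scalarCurv.div_const _).mul (h.metric.smooth i j)))).sub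
    ((contDiffOn_const.mul (h.smooth_factor.pow 2)).mul (h.smooth_ymStress i j))

lemma smooth_dComp (i : Fin 4) : ContDiffOn ℝ ∞ (fun y => dComp U Ξ y i) U :=
  contDiffOn_pd h.metric.uniqueDiff h.smooth_factor i

lemma smooth_friedrichScalar : ContDiffOn ℝ ∞ (friedrichScalar U G Ξ) U := by
  unfold friedrichScalar
  exact (contDiffOn_const.mul (ContDiffOn.sum fun i _ => ContDiffOn.sum fun j _ =>
    (h.metric.smooth_inv i j).mul (h.metric.smooth_nablaCovector h.smooth_dComp i j))).add
    ((contDiffOn_const.mul h.metric.smooth_scalarCurv).mul h.smooth_factor)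

lemma smooth_dotCov {α β : Coord 4 → Fin 4 → ℝ} (hα : ∀ i, ContDiffOn ℝ ∞ (fun y => α y i) U)
    (hβ : ∀ i, ContDiffOn ℝ ∞ (fun y => β y i) U) :
    ContDiffOn ℝ ∞ (fun y => dotCov G y (α y) (β y)) U := by
  unfold dotCov
  exact ContDiffOn.sum fun i _ => ContDiffOn.sum fun j _ =>
    ((h.metric.smooth_inv i j).mul (hα i)).mul (hβ j)

/-- Functions that are smooth on `U` and agree where `Ξ ≠ 0` agree on `U`. -/
lemma eqOn_of_eq {f f' : Coord 4 → ℝ} (hf : ContDiffOn ℝ ∞ f U) (hf' : ContDiffOn ℝ ∞ f' U)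
    (he : ∀ x ∈ U, Ξ x ≠ 0 → f x = f' x) : EqOn f f' U := by
  have he' : EqOn f f' {x | x ∈ U ∧ Ξ x ≠ 0} := fun y hy => he y hy.1 hy.2
  exact he'.of_subset_closure hf.continuousOn hf'.continuousOn (fun y hy => hy.1) h.dense

/-- The transformation law of the Schouten tensor and Einstein's equations:
`(λ/6) Ξ⁻² g - (∇u + u ⊗ u - ½ |u|² g) = L - ½ Ξ² T` where `Ξ ≠ 0`, with `u = Ξ⁻¹ dΞ`. -/
theorem smoothH_eq (hx : x ∈ U) (h0 : Ξ x ≠ 0) (i j : Fin 4) :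
    smoothH U G Ξ F i j x = lam / 6 * rescaled Ξ G x i j
      - (nablaCovector U G (logDiff U Ξ) i j x + logDiff U Ξ x i * logDiff U Ξ x j
        - (1 / 2) * dotCov G x (logDiff U Ξ x) (logDiff U Ξ x) * G x i j) := by
  -- pass to the relatively open set where `Ξ ≠ 0`
  obtain ⟨V, hVo, hV⟩ := (continuousOn_iff'.1 h.smooth_factor.continuousOn) {0}ᶜ
    isOpen_compl_singleton
  have hV' : ∀ y ∈ U, (Ξ y ≠ 0 ↔ y ∈ V) := by
    intro y hy
    have := Set.ext_iff.1 hV y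
    simpa [hy] using this
  set W := U ∩ V with hWdef
  have hxW : x ∈ W := ⟨hx, (hV' x hx).1 h0⟩
  have hWU : W ⊆ U := inter_subset_left
  have hWn : ∀ y ∈ W, W ∈ 𝓝[U] y := fun y hy =>
    inter_mem self_mem_nhdsWithin (mem_nhdsWithin_of_mem_nhds (hVo.mem_nhds hy.2))
  have hGW : IsSmoothMetric W G := h.metric.inter_isOpen hVo
  have hΞW := h.smooth_factor.mono hWU
  have h0W : ∀ y ∈ W, Ξ y ≠ 0 := fun y hy => (hV' y hy.1).2 hy.2
  have hRW := hGW.rescaled_isSmoothMetric hΞW h0W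
  have hlog : ∀ y ∈ W, logDiff W Ξ y = logDiff U Ξ y := by
    intro y hy; ext k
    unfold logDiff; rw [pd_of_mem_nhdsWithin (hWn y hy) hWU]
  have hnab : ∀ i j, nablaCovector W G (logDiff W Ξ) i j x
      = nablaCovector U G (logDiff U Ξ) i j x := by
    intro i j
    rw [← nablaCovector_of_mem_nhdsWithin (hWn x hxW) hWU]
    unfold nablaCovector
    rw [pd_congr (h := fun y => logDiff U Ξ y j) (fun y hy => by rw [hlog y hy]) hxW, hlog x hxW]
  have hric : ∀ i j, ricci U (rescaled Ξ G) i j x = ricci U G i j x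
      + 2 * (nablaCovector U G (logDiff U Ξ) i j x
        + logDiff U Ξ x i * logDiff U Ξ x j
        - dotCov G x (logDiff U Ξ x) (logDiff U Ξ x) * G x i j)
      + trace G x (fun k l => nablaCovector U G (logDiff U Ξ) k l x) * G x i j := by
    intro i j
    have := hGW.ricci_rescaled hΞW h0W hxW i j
    rw [ricci_of_mem_nhdsWithin hWn hWU hxW, ricci_of_mem_nhdsWithin hWn hWU hxW,
      hlog x hxW] at this
    simp_rw [hnab] at this
    rw [this]; unfold trace; push_cast; ring
  -- the trace of Einstein's equations
  have hsc : scalarCurv U (rescaled Ξ G) x = 4 * lam := by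
    have htr : trace (rescaled Ξ G) x (fun i j => ymStress (rescaled Ξ G) F i j x) = 0 :=
      trace_ymStress hRW hxW F
    simp_rw [← h.einstein x hx h0] at htr
    rw [trace_add, trace_sub, trace_mul_metric hRW hxW, trace_mul_metric hRW hxW] at htr
    have : trace (rescaled Ξ G) x (fun i j => ricci U (rescaled Ξ G) i j x)
        = scalarCurv U (rescaled Ξ G) x := rfl
    rw [this] at htr
    push_cast at htr
    linarith
  have hein : ∀ i j, ricci U (rescaled Ξ G) i j x
      = lam * (Ξ x ^ 2)⁻¹ * G x i j + Ξ x ^ 2 * ymStress G F i j x := by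
    intro i j
    have := h.einstein x hx h0 i j
    rw [hsc, ymStress_rescaled h0 (h.metric.det_ne x hx)] at this
    have hr : rescaled Ξ G x i j = (Ξ x ^ 2)⁻¹ * G x i j := rfl
    rw [hr] at this
    linarith
  set D := trace G x (fun k l => nablaCovector U G (logDiff U Ξ) k l x) with hD
  set Q := dotCov G x (logDiff U Ξ x) (logDiff U Ξ x) with hQ
  -- the transformation law solved for the Ricci tensor of `g`, and its trace
  have hRic : ∀ i j, ricci U G i j x = (lam * (Ξ x ^ 2)⁻¹ + 2 * Q - D) * G x i j
      + Ξ x ^ 2 * ymStress G F i j x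
      - 2 * (nablaCovector U G (logDiff U Ξ) i j x + logDiff U Ξ x i * logDiff U Ξ x j) := by
    intro i j
    have := hric i j
    rw [hein i j] at this
    linarith
  have hscal : scalarCurv U G x = 4 * (lam * (Ξ x ^ 2)⁻¹ + 2 * Q - D) - 2 * (D + Q) := by
    have e : scalarCurv U G x = trace G x (fun i j => ricci U G i j x) := rfl
    rw [e]
    simp_rw [hRic]
    rw [trace_sub, trace_add, trace_mul_metric h.metric hx, trace_mul_left, trace_mul_left,
      trace_add, trace_ymStress h.metric hx F]
    have e2 : trace G x (fun i j => logDiff U Ξ x i * logDiff U Ξ x j) = Q := by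
      rw [hQ]; unfold trace dotCov
      exact Finset.sum_congr rfl fun i _ => Finset.sum_congr rfl fun j _ => by ring
    rw [e2]; push_cast; ring
  unfold smoothH schouten
  rw [hRic i j, hscal]
  have hr : rescaled Ξ G x i j = (Ξ x ^ 2)⁻¹ * G x i j := rfl
  rw [hr]
  push_cast
  ring

/-- Only the Schouten tensor contributes to the trace of `L - ½ Ξ² T`, as `T` is trace-free. -/
lemma trace_smoothH (hx : x ∈ U) :
    trace G x (fun i j => smoothH U G Ξ F i j x) = scalarCurv U G x / 6 := by
  unfold smoothH schouten
  rw [trace_sub, trace_mul_left, trace_mul_left, trace_sub, trace_mul_metric h.metric hx,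
    trace_ymStress h.metric hx]
  have e : trace G x (fun i j => ricci U G i j x) = scalarCurv U G x := rfl
  rw [e]; push_cast; ring

/-- Where `Ξ ≠ 0`, the formula for `H` is multiplied by `Ξ` and written in terms of `∇dΞ`. Its
trace identifies `(|dΞ|² + λ/3) / (2 Ξ)` with `s`, and both equations follow. They involve no division
by `Ξ`, and hence extend to the boundary. -/
lemma hessian_and_norm_of_ne (hx : x ∈ U) (h0 : Ξ x ≠ 0) :
    dotCov G x (dComp U Ξ x) (dComp U Ξ x) + lam / 3 = 2 * Ξ x * friedrichScalar U G Ξ x ∧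
    ∀ i j, nablaCovector U G (dComp U Ξ) i j x
      = -Ξ x * smoothH U G Ξ F i j x + friedrichScalar U G Ξ x * G x i j := by
  obtain ⟨V, hVo, hV⟩ := (continuousOn_iff'.1 h.smooth_factor.continuousOn) {0}ᶜ
    isOpen_compl_singleton
  have hV' : ∀ y ∈ U, (Ξ y ≠ 0 ↔ y ∈ V) := by
    intro y hy
    have := Set.ext_iff.1 hV y
    simpa [hy] using this
  have hWn : U ∩ V ∈ 𝓝[U] x :=
    inter_mem self_mem_nhdsWithin (mem_nhdsWithin_of_mem_nhds (hVo.mem_nhds ((hV' x hx).1 h0)))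
  have hpd : ∀ i j, pd U i (fun y => logDiff U Ξ y j) x
      = (Ξ x)⁻¹ * pd U i (pd U j Ξ) x - logDiff U Ξ x i * logDiff U Ξ x j := by
    intro i j
    have hxW : x ∈ U ∩ V := ⟨hx, (hV' x hx).1 h0⟩
    have hs : ContDiffOn ℝ ∞ (pd U j Ξ) (U ∩ V) :=
      (contDiffOn_pd h.metric.uniqueDiff h.smooth_factor j).mono inter_subset_left
    have hu := h.metric.uniqueDiff.inter hVo
    have hΞV := h.smooth_factor.mono (inter_subset_left (t := V))
    have h0V : ∀ y ∈ U ∩ V, Ξ y ≠ 0 := fun y hy => (hV' y hy.1).2 hy.2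
    have key : pd (U ∩ V) i (fun y => (Ξ y)⁻¹ * pd U j Ξ y) x
        = (Ξ x)⁻¹ * pd (U ∩ V) i (pd U j Ξ) x - logDiff (U ∩ V) Ξ x i * logDiff U Ξ x j := by
      rw [pd_mul hu hxW (contDiffOn_fun_inv hΞV h0V) hs, pd_inv hu hxW hΞV h0]
      unfold logDiff
      field_simp
      ring
    unfold logDiff at key ⊢
    rw [pd_of_mem_nhdsWithin hWn inter_subset_left, pd_of_mem_nhdsWithin hWn inter_subset_left,
      pd_of_mem_nhdsWithin hWn inter_subset_left] at key
    exact key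
  have hnab : ∀ i j, nablaCovector U G (logDiff U Ξ) i j x
      = (Ξ x)⁻¹ * nablaCovector U G (dComp U Ξ) i j x - logDiff U Ξ x i * logDiff U Ξ x j := by
    intro i j
    unfold nablaCovector
    rw [hpd, mul_sub, Finset.mul_sum]
    have : ∑ k, christoffel U G k i j x * logDiff U Ξ x k
        = ∑ k, (Ξ x)⁻¹ * (christoffel U G k i j x * dComp U Ξ x k) :=
      Finset.sum_congr rfl fun k _ => by unfold logDiff dComp; ring
    rw [this]
    unfold dComp
    ring
  have hQ : dotCov G x (logDiff U Ξ x) (logDiff U Ξ x)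
      = (Ξ x)⁻¹ ^ 2 * dotCov G x (dComp U Ξ x) (dComp U Ξ x) := by
    unfold dotCov logDiff dComp
    simp_rw [Finset.mul_sum]
    exact Finset.sum_congr rfl fun i _ => Finset.sum_congr rfl fun j _ => by ring
  set N := dotCov G x (dComp U Ξ x) (dComp U Ξ x) with hN
  -- in `∇u + u ⊗ u` the quadratic terms cancel and `Ξ⁻¹ ∇dΞ` is left
  have hH : ∀ i j, Ξ x * smoothH U G Ξ F i j x
      = (1 / 2) * (Ξ x)⁻¹ * (N + lam / 3) * G x i j - nablaCovector U G (dComp U Ξ) i j x := by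
    intro i j
    rw [h.smoothH_eq hx h0, hnab, hQ]
    have hr : rescaled Ξ G x i j = (Ξ x ^ 2)⁻¹ * G x i j := rfl
    rw [hr]
    field_simp
    ring
  have htr : Ξ x * (scalarCurv U G x / 6) = 2 * (Ξ x)⁻¹ * (N + lam / 3)
      - trace G x (fun i j => nablaCovector U G (dComp U Ξ) i j x) := by
    rw [← h.trace_smoothH hx, ← trace_mul_left]
    simp_rw [hH]
    rw [trace_sub, trace_mul_metric h.metric hx]
    push_cast; ring
  have hs : friedrichScalar U G Ξ x = (1 / 2) * (Ξ x)⁻¹ * (N + lam / 3) := by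
    unfold friedrichScalar
    unfold trace at htr
    linear_combination (1 / 4 : ℝ) * htr
  refine ⟨?_, fun i j => ?_⟩
  · rw [hs]; field_simp
  · rw [hs]; linear_combination hH i j

/-- `∇ᵢ∇ⱼΞ = -Ξ Hᵢⱼ + s gᵢⱼ`. -/
theorem hessian (hx : x ∈ U) (i j : Fin 4) :
    nablaCovector U G (dComp U Ξ) i j x
      = -Ξ x * smoothH U G Ξ F i j x + friedrichScalar U G Ξ x * G x i j :=
  h.eqOn_of_eq (f := nablaCovector U G (dComp U Ξ) i j)
    (f' := fun x => -Ξ x * smoothH U G Ξ F i j x + friedrichScalar U G Ξ x * G x i j)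
    (h.metric.smooth_nablaCovector h.smooth_dComp i j)
    ((h.smooth_factor.neg.mul (h.smooth_smoothH i j)).add
      (h.smooth_friedrichScalar.mul (h.metric.smooth i j)))
    (fun _ hy h0 => (h.hessian_and_norm_of_ne hy h0).2 i j) hx

/-- `|dΞ|² + λ/3 = 2 Ξ s`. -/
theorem norm_dComp (hx : x ∈ U) :
    dotCov G x (dComp U Ξ x) (dComp U Ξ x) + lam / 3 = 2 * Ξ x * friedrichScalar U G Ξ x :=
  h.eqOn_of_eq (f := fun x => dotCov G x (dComp U Ξ x) (dComp U Ξ x) + lam / 3)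
    (f' := fun x => 2 * Ξ x * friedrichScalar U G Ξ x)
    ((h.smooth_dotCov h.smooth_dComp h.smooth_dComp).add contDiffOn_const)
    ((contDiffOn_const.mul h.smooth_factor).mul h.smooth_friedrichScalar)
    (fun _ hy h0 => (h.hessian_and_norm_of_ne hy h0).1) hx

/-- `∇ₐ s = -H(∂ₐ, ∇Ξ)`, obtained by differentiating `|dΞ|² + λ/3 = 2 Ξ s`. -/
theorem pd_friedrichScalar (hx : x ∈ U) (a : Fin 4) :
    pd U a (friedrichScalar U G Ξ) x
      = -dotCov G x (fun i => smoothH U G Ξ F a i x) (dComp U Ξ x) := by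
  refine h.eqOn_of_eq (f := pd U a (friedrichScalar U G Ξ))
    (f' := fun x => -dotCov G x (fun i => smoothH U G Ξ F a i x) (dComp U Ξ x))
    (contDiffOn_pd h.metric.uniqueDiff h.smooth_friedrichScalar a)
    (h.smooth_dotCov (α := fun x i => smoothH U G Ξ F a i x)
      (fun i => h.smooth_smoothH a i) h.smooth_dComp).neg
    (fun y hy h0 => ?_) hx
  have e := pd_congr (f := fun x => dotCov G x (dComp U Ξ x) (dComp U Ξ x) + lam / 3)
    (h := fun x => 2 * Ξ x * friedrichScalar U G Ξ x) (fun x hx => h.norm_dComp hx) hy a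
  rw [pd_add h.metric.uniqueDiff hy (h.smooth_dotCov h.smooth_dComp h.smooth_dComp)
      contDiffOn_const, pd_const, h.metric.pd_dotCov hy h.smooth_dComp h.smooth_dComp,
    dotCov_comm h.metric hy (dComp U Ξ y),
    pd_mul h.metric.uniqueDiff hy (contDiffOn_const.mul h.smooth_factor) h.smooth_friedrichScalar,
    pd_const_mul h.metric.uniqueDiff hy h.smooth_factor] at e
  simp_rw [h.hessian hy] at e
  rw [dotCov_smul_add, dotCov_metric_left h.metric hy] at e
  unfold dComp at e
  have : Ξ y * (pd U a (friedrichScalar U G Ξ) y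
      + dotCov G y (fun i => smoothH U G Ξ F a i y) (dComp U Ξ y)) = 0 := by
    unfold dComp
    linear_combination (-1 / 2 : ℝ) * e
  rcases mul_eq_zero.1 this with h1 | h1
  · exact absurd h1 h0
  · linarith

lemma smoothH_symm (hx : x ∈ U) (i j : Fin 4) :
    smoothH U G Ξ F i j x = smoothH U G Ξ F j i x := by
  refine h.eqOn_of_eq (h.smooth_smoothH i j) (h.smooth_smoothH j i) (fun y hy h0 => ?_) hx
  have e : nablaCovector U G (dComp U Ξ) i j y = nablaCovector U G (dComp U Ξ) j i y := by
    unfold nablaCovector dComp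
    have := pd_comm h.metric.uniqueDiff h.metric.subset_closure hy h.smooth_factor i j
    simp_rw [h.metric.christoffel_symm hy _ i j]
    rw [sub_left_inj]
    exact this
  rw [h.hessian hy, h.hessian hy, h.metric.symm y hy i j] at e
  have : Ξ y * (smoothH U G Ξ F i j y - smoothH U G Ξ F j i y) = 0 := by linear_combination -e
  rcases mul_eq_zero.1 this with h1 | h1
  · exact absurd h1 h0
  · linarith

end IsLocalExtension

end LocalExtension

/-! ### Linear differential equations on intervals -/

section ODE

/-- A point of an interval `J` has a compact interval as a neighbourhood in `J`, inside any given
neighbourhood. -/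
lemma exists_Icc_mem_nhdsWithin {J S : Set ℝ} (hJ : J.OrdConnected) {τ : ℝ} (hτ : τ ∈ J)
    (hS : S ∈ 𝓝[J] τ) {δ : ℝ} (hδ : 0 < δ) :
    ∃ a b, τ ∈ Icc a b ∧ Icc a b ⊆ J ∩ S ∧ Icc a b ∈ 𝓝[J] τ ∧ b - a ≤ δ := by
  obtain ⟨ε, hε, hεS⟩ := Metric.mem_nhdsWithin_iff.1 hS
  set η := min (ε / 2) (δ / 2) with hη
  have hη0 : 0 < η := by positivity
  have hηε : η < ε := lt_of_le_of_lt (min_le_left _ _) (by linarith)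
  have hηδ : η ≤ δ / 2 := min_le_right _ _
  have hleft : ∃ a, a ∈ J ∧ a ≤ τ ∧ τ - η ≤ a ∧ ∀ᶠ t in 𝓝[J] τ, a ≤ t := by
    by_cases hl : ∃ t ∈ J, t < τ
    · obtain ⟨t, htJ, ht⟩ := hl
      refine ⟨max t (τ - η), ?_, max_le ht.le (by linarith), le_max_right _ _, ?_⟩
      · exact hJ.out htJ hτ ⟨le_max_left _ _, max_le ht.le (by linarith)⟩
      · exact mem_nhdsWithin_of_mem_nhds (Ici_mem_nhds (max_lt ht (by linarith)))
    · push Not at hl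
      exact ⟨τ, hτ, le_rfl, by linarith, eventually_nhdsWithin_of_forall hl⟩
  have hright : ∃ b, b ∈ J ∧ τ ≤ b ∧ b ≤ τ + η ∧ ∀ᶠ t in 𝓝[J] τ, t ≤ b := by
    by_cases hl : ∃ t ∈ J, τ < t
    · obtain ⟨t, htJ, ht⟩ := hl
      refine ⟨min t (τ + η), ?_, le_min ht.le (by linarith), min_le_right _ _, ?_⟩
      · exact hJ.out hτ htJ ⟨le_min ht.le (by linarith), min_le_left _ _⟩
      · exact mem_nhdsWithin_of_mem_nhds (Iic_mem_nhds (lt_min ht (by linarith)))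
    · push Not at hl
      exact ⟨τ, hτ, le_rfl, by linarith, eventually_nhdsWithin_of_forall hl⟩
  obtain ⟨a, haJ, haτ, ha, hae⟩ := hleft
  obtain ⟨b, hbJ, hτb, hb, hbe⟩ := hright
  have hsub : Icc a b ⊆ J := hJ.out haJ hbJ
  refine ⟨a, b, ⟨haτ, hτb⟩, fun t ht => ⟨hsub ht, hεS ⟨?_, hsub ht⟩⟩, ?_, by linarith⟩
  · rw [Metric.mem_ball, Real.dist_eq, abs_lt]
    constructor <;> linarith [ht.1, ht.2]
  · filter_upwards [hae, hbe] with t h1 h2 using ⟨h1, h2⟩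

variable {E : Type*} [NormedAddCommGroup E] [NormedSpace ℝ E]

/-- Grönwall's inequality in both time directions from a zero `t₀`. -/
lemma eq_zero_on_Icc_of_norm_deriv_le {a b C : ℝ} {y y' : ℝ → E}
    (hy : ∀ t ∈ Icc a b, HasDerivWithinAt y (y' t) (Icc a b) t)
    (hC : ∀ t ∈ Icc a b, ‖y' t‖ ≤ C * ‖y t‖) {t₀ : ℝ} (ht₀ : t₀ ∈ Icc a b) (h0 : y t₀ = 0) :
    ∀ t ∈ Icc a b, y t = 0 := by
  intro t ht
  rcases le_total t₀ t with hle | hle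
  · have hsub : Icc t₀ b ⊆ Icc a b := Icc_subset_Icc_left ht₀.1
    refine eq_zero_of_abs_deriv_le_mul_abs_self_of_eq_zero_right (f := y) (f' := y') (K := C)
      (a := t₀) (b := b) (fun r hr => ((hy r (hsub hr)).mono hsub).continuousWithinAt)
      (fun r hr => ?_) h0 (fun r hr => hC r (hsub (Ico_subset_Icc_self hr))) t ⟨hle, ht.2⟩
    refine (hy r (hsub (Ico_subset_Icc_self hr))).mono_of_mem_nhdsWithin ?_
    exact mem_of_superset (Icc_mem_nhdsGE hr.2)
      (Icc_subset_Icc_left (ht₀.1.trans hr.1))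
  · -- reflect the time direction
    have hder : ∀ r ∈ Icc (-t₀) (-a), HasDerivWithinAt (fun r => y (-r)) (-y' (-r))
        (Icc (-t₀) (-a)) r := by
      intro r hr
      have hr' : -r ∈ Icc a b := ⟨by linarith [hr.2], by linarith [hr.1, ht₀.2]⟩
      have := (hy (-r) hr').scomp r ((hasDerivAt_neg r).hasDerivWithinAt (s := Icc (-t₀) (-a)))
        (fun s hs => ⟨by linarith [hs.2], by linarith [hs.1, ht₀.2]⟩)
      rw [neg_one_smul] at this
      exact this
    have := eq_zero_of_abs_deriv_le_mul_abs_self_of_eq_zero_right (f := fun r => y (-r))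
      (f' := fun r => -y' (-r)) (K := C) (a := -t₀) (b := -a)
      (fun r hr => (hder r hr).continuousWithinAt)
      (fun r hr => (hder r (Ico_subset_Icc_self hr)).mono_of_mem_nhdsWithin
        (mem_of_superset (Icc_mem_nhdsGE hr.2) (Icc_subset_Icc_left hr.1)))
      (by simpa using h0)
      (fun r hr => by
        rw [norm_neg]
        exact hC (-r) ⟨by linarith [hr.2], by linarith [hr.1, ht₀.2]⟩) (-t)
      ⟨by linarith, by linarith [ht.1]⟩
    simpa using this

/-- A function on an interval whose derivative is locally bounded by a multiple of the function
vanishes identically if it vanishes somewhere. -/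
theorem eq_zero_of_locally_norm_deriv_le {J : Set ℝ} (hJ : J.OrdConnected) {y : ℝ → E}
    (h : ∀ τ ∈ J, ∃ C, ∀ᶠ t in 𝓝[J] τ, ∃ y', HasDerivWithinAt y y' J t ∧ ‖y'‖ ≤ C * ‖y t‖)
    {τ₀ : ℝ} (hτ₀ : τ₀ ∈ J) (h0 : y τ₀ = 0) : ∀ τ ∈ J, y τ = 0 := by
  intro τ hτ
  have key : y τ₀ = 0 ↔ y τ = 0 := by
    refine hJ.isPreconnected.induction₂' (fun s t => (y s = 0 ↔ y t = 0)) (fun τ₁ hτ₁ => ?_)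
      (fun _ _ _ _ _ _ h1 h2 => h1.trans h2) hτ₀ hτ
    obtain ⟨C, hC⟩ := h τ₁ hτ₁
    obtain ⟨a, b, hmem, hsub, hnhds, -⟩ := exists_Icc_mem_nhdsWithin hJ hτ₁ hC one_pos
    choose! y' hy' using fun t (ht : t ∈ Icc a b) => (hsub ht).2
    have hz : ∀ s ∈ Icc a b, ∀ t ∈ Icc a b, y s = 0 → y t = 0 := fun s hs t ht hs0 =>
      eq_zero_on_Icc_of_norm_deriv_le (y' := y')
        (fun r hr => (hy' r hr).1.mono fun q hq => (hsub hq).1) (fun r hr => (hy' r hr).2)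
        hs hs0 t ht
    filter_upwards [hnhds] with t ht
    exact ⟨⟨hz _ hmem _ ht, hz _ ht _ hmem⟩, ⟨hz _ ht _ hmem, hz _ hmem _ ht⟩⟩
  exact key.1 h0

/-- Solutions of a linear system with continuous coefficients exist on short compact intervals;
the bound on the length depends only on a bound for the coefficients. -/
theorem exists_linear_solution {m : ℕ} {a b C : ℝ} {A : Fin m → Fin m → ℝ → ℝ}
    (hA : ∀ k j, ContinuousOn (A k j) (Icc a b)) (hC0 : 0 ≤ C)
    (hC : ∀ k j, ∀ t ∈ Icc a b, |A k j t| ≤ C) (hsmall : m * C * (b - a) ≤ 1 / 2)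
    {t₀ : ℝ} (ht₀ : t₀ ∈ Icc a b) (y₀ : Fin m → ℝ) :
    ∃ y : ℝ → Fin m → ℝ, y t₀ = y₀ ∧ ∀ t ∈ Icc a b, ∀ k,
      HasDerivWithinAt (fun t => y t k) (∑ j, A k j t * y t j) (Icc a b) t := by
  lift C to NNReal using hC0
  have hC0 : (0 : ℝ) ≤ C := C.2
  have hb : ∀ t ∈ Icc a b, ∀ w : Fin m → ℝ, ‖fun k => ∑ j, A k j t * w j‖ ≤ m * C * ‖w‖ := by
    intro t ht w
    rw [pi_norm_le_iff_of_nonneg (by positivity)]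
    intro k
    calc ‖∑ j, A k j t * w j‖ ≤ ∑ j, ‖A k j t * w j‖ := norm_sum_le _ _
      _ ≤ ∑ _j : Fin m, C * ‖w‖ := by
        refine Finset.sum_le_sum fun j _ => ?_
        rw [norm_mul]
        exact mul_le_mul (hC k j t ht) (norm_le_pi_norm w j) (norm_nonneg _) hC0
      _ = m * C * ‖w‖ := by simp [mul_assoc]
  -- on the ball of radius `‖y₀‖` about `y₀` the right-hand side is at most `2 m C ‖y₀‖`, so that
  -- solutions cannot leave the ball within a time `1 / (2 m C)`
  have hpl : IsPicardLindelof (fun t (w : Fin m → ℝ) k => ∑ j, A k j t * w j)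
      (⟨t₀, ht₀⟩ : Icc a b) y₀ ‖y₀‖₊ 0 ((m : NNReal) * C * (2 * ‖y₀‖₊))
      ((m : NNReal) * C) := by
    refine ⟨fun t ht => ?_, fun w _ => ?_, fun t ht w hw => ?_, ?_⟩
    · refine LipschitzOnWith.of_dist_le_mul fun w _ w' _ => ?_
      rw [dist_eq_norm, dist_eq_norm]
      have : (fun k => ∑ j, A k j t * w j) - (fun k => ∑ j, A k j t * w' j)
          = fun k => ∑ j, A k j t * (w - w') j := by
        ext k
        simp only [Pi.sub_apply, mul_sub, Finset.sum_sub_distrib]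
      rw [this]
      exact hb t ht _
    · exact continuousOn_pi.2 fun k => continuousOn_finsetSum _ fun j _ =>
        (hA k j).mul continuousOn_const
    · refine (hb t ht w).trans ?_
      have hw' : ‖w‖ ≤ 2 * ‖y₀‖ := by
        have h1 : ‖w - y₀‖ ≤ ‖y₀‖ := by simpa [dist_eq_norm] using hw
        have h2 := norm_add_le (w - y₀) y₀
        rw [sub_add_cancel] at h2
        linarith
      have : (((m : NNReal) * C * (2 * ‖y₀‖₊) : NNReal) : ℝ) = m * C * (2 * ‖y₀‖) := by
        simp
      rw [this]
      exact mul_le_mul_of_nonneg_left hw' (by positivity)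
    · have : (((m : NNReal) * C * (2 * ‖y₀‖₊) : NNReal) : ℝ) = m * C * (2 * ‖y₀‖) := by
        simp
      rw [this]
      have hmax : max (b - t₀) (t₀ - a) ≤ b - a :=
        max_le (by linarith [ht₀.1]) (by linarith [ht₀.2])
      have h1 := mul_le_mul_of_nonneg_left hmax
        (show 0 ≤ m * C * (2 * ‖y₀‖) by positivity)
      have h2 := mul_le_mul_of_nonneg_right hsmall (show 0 ≤ 2 * ‖y₀‖ by positivity)
      simp only [coe_nnnorm, NNReal.coe_zero, sub_zero]
      calc _ ≤ m * C * (2 * ‖y₀‖) * (b - a) := h1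
        _ = m * C * (b - a) * (2 * ‖y₀‖) := by ring
        _ ≤ 1 / 2 * (2 * ‖y₀‖) := h2
        _ = ‖y₀‖ := by ring
  obtain ⟨y, hy0, hy⟩ := hpl.exists_eq_forall_mem_Icc_hasDerivWithinAt₀
  exact ⟨y, hy0, fun t ht k => (hasDerivWithinAt_pi.1 (hy t ht)) k⟩

end ODE

/-! ### Differentiation along curves -/

section Curves

variable {n : ℕ} {U : Set (Coord n)} {G : Coord n → Matrix (Fin n) (Fin n) ℝ}
  {J : Set ℝ} {x : ℝ → Coord n} {z : ℝ → Fin n → ℝ} {τ : ℝ}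

lemma hasDerivWithinAt_sum_mul {m : ℕ} {f h : ℝ → Fin m → ℝ} {f' h' : Fin m → ℝ}
    (hf : ∀ k, HasDerivWithinAt (fun t => f t k) (f' k) J τ)
    (hh : ∀ k, HasDerivWithinAt (fun t => h t k) (h' k) J τ) :
    HasDerivWithinAt (fun t => ∑ k, f t k * h t k) (∑ k, (f' k * h τ k + f τ k * h' k)) J τ :=
  HasDerivWithinAt.fun_sum fun k _ => (hf k).fun_mul (hh k)

/-- Covariant differentiation of `⟨w, e⟩` along a curve, for a covector field `w`. -/
lemma hasDerivWithinAt_pair_field {w : Coord n → Fin n → ℝ}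
    (hw : ∀ i, ContDiffOn ℝ ∞ (fun y => w y i) U) (hτ : τ ∈ J) (hxU : ∀ᶠ t in 𝓝[J] τ, x t ∈ U)
    (hx : ∀ k, HasDerivWithinAt (fun t => x t k) (z τ k) J τ) {e : ℝ → Fin n → ℝ} {a : Fin n → ℝ}
    (he : ∀ k, HasDerivWithinAt (fun t => e t k)
      (-(∑ i, ∑ j, christoffel U G k i j (x τ) * z τ i * e τ j) + a k) J τ) :
    HasDerivWithinAt (fun t => pair (w (x t)) (e t))
      (∑ i, ∑ j, nablaCovector U G w i j (x τ) * z τ i * e τ j + pair (w (x τ)) a) J τ := by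
  have h := hasDerivWithinAt_sum_mul (fun k => hasDerivWithinAt_comp_curve (hw k) hτ hxU hx) he
  refine h.congr_deriv ?_
  unfold pair nablaCovector
  simp_rw [mul_add, sub_mul, Finset.sum_add_distrib, Finset.sum_sub_distrib, mul_neg,
    Finset.sum_neg_distrib, Finset.sum_mul, Finset.mul_sum]
  have e1 : ∑ k, ∑ i, ∑ j, w (x τ) k * (christoffel U G k i j (x τ) * z τ i * e τ j)
      = ∑ i, ∑ j, ∑ k, christoffel U G k i j (x τ) * w (x τ) k * z τ i * e τ j := by
    rw [Finset.sum_comm]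
    refine Finset.sum_congr rfl fun i _ => ?_
    rw [Finset.sum_comm]
    exact Finset.sum_congr rfl fun j _ => Finset.sum_congr rfl fun k _ => by ring
  rw [e1, Finset.sum_comm]
  ring

/-- Covariant differentiation of `g♯(b, w)` along a curve, for a covector field `w`. -/
lemma IsSmoothMetric.hasDerivWithinAt_dotCov_field (hG : IsSmoothMetric U G)
    {w : Coord n → Fin n → ℝ}
    (hw : ∀ i, ContDiffOn ℝ ∞ (fun y => w y i) U) (hτ : τ ∈ J) (hxU : ∀ᶠ t in 𝓝[J] τ, x t ∈ U)
    (hx : ∀ k, HasDerivWithinAt (fun t => x t k) (z τ k) J τ) {b : ℝ → Fin n → ℝ} {a : Fin n → ℝ}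
    (hb : ∀ k, HasDerivWithinAt (fun t => b t k)
      (∑ i, ∑ j, christoffel U G j i k (x τ) * z τ i * b τ j + a k) J τ) :
    HasDerivWithinAt (fun t => dotCov G (x t) (b t) (w (x t)))
      (∑ i, z τ i * dotCov G (x τ) (b τ) (fun j => nablaCovector U G w i j (x τ))
        + dotCov G (x τ) a (w (x τ))) J τ := by
  have hxτ : x τ ∈ U := hxU.self_of_nhdsWithin hτ
  have hV := hG.smooth_sharp hw
  have h := hasDerivWithinAt_sum_mul hb (fun k => hasDerivWithinAt_comp_curve (hV k) hτ hxU hx)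
  have e0 : (fun t => dotCov G (x t) (b t) (w (x t)))
      = fun t => ∑ k, b t k * sharp G (x t) (w (x t)) k := by
    ext t; exact (pair_sharp _ _).symm
  rw [e0]
  refine h.congr_deriv ?_
  -- `∂ᵢ wᵏ = (∇ᵢ w)ᵏ - Γᵏᵢⱼ wʲ`
  have e1 : ∀ i k, pd U i (fun y => sharp G y (w y) k) (x τ)
      = sharp G (x τ) (fun j => nablaCovector U G w i j (x τ)) k
        - ∑ j, christoffel U G k i j (x τ) * sharp G (x τ) (w (x τ)) j := by
    intro i k
    unfold sharp nablaCovector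
    rw [pd_sum _ hG.uniqueDiff hxτ fun l => (hG.smooth_inv k l).mul (hw l)]
    have e2 : ∀ l, pd U i (fun y => (G y)⁻¹ k l * w y l) (x τ)
        = (G (x τ))⁻¹ k l * pd U i (fun y => w y l) (x τ)
          - ∑ m, (G (x τ))⁻¹ k m * christoffel U G l i m (x τ) * w (x τ) l
          - ∑ m, (G (x τ))⁻¹ l m * christoffel U G k i m (x τ) * w (x τ) l := by
      intro l
      rw [pd_mul hG.uniqueDiff hxτ (hG.smooth_inv k l) (hw l), hG.pd_inv_metric hxτ,
        Finset.sum_add_distrib, ← Finset.sum_mul, ← Finset.sum_mul]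
      ring
    simp_rw [e2, mul_sub, Finset.sum_sub_distrib, Finset.mul_sum]
    congr 1
    · congr 1
      rw [Finset.sum_comm]
      exact Finset.sum_congr rfl fun l _ => Finset.sum_congr rfl fun m _ => by ring
    · rw [Finset.sum_comm]
      refine Finset.sum_congr rfl fun l _ => Finset.sum_congr rfl fun m _ => ?_
      rw [hG.inv_symm hxτ l m]; ring
  simp_rw [e1, ← pair_sharp]
  unfold pair
  simp only [add_mul, sub_mul, mul_sub, Finset.sum_add_distrib, Finset.sum_sub_distrib,
    Finset.sum_mul, Finset.mul_sum]
  have c1 : ∑ k, ∑ i, ∑ j, christoffel U G j i k (x τ) * z τ i * b τ j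
        * sharp G (x τ) (w (x τ)) k
      = ∑ k, ∑ i, ∑ j, b τ k * (christoffel U G k i j (x τ) * sharp G (x τ) (w (x τ)) j
        * z τ i) := by
    have : ∀ k, ∑ i, ∑ j, christoffel U G j i k (x τ) * z τ i * b τ j
        * sharp G (x τ) (w (x τ)) k = ∑ j, ∑ i, christoffel U G j i k (x τ) * z τ i * b τ j
        * sharp G (x τ) (w (x τ)) k := fun k => Finset.sum_comm
    simp_rw [this]
    rw [Finset.sum_comm]
    refine Finset.sum_congr rfl fun k _ => ?_
    rw [Finset.sum_comm]
    exact Finset.sum_congr rfl fun i _ => Finset.sum_congr rfl fun j _ => by ring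
  have c2 : ∑ k, ∑ i, b τ k * (sharp G (x τ) (fun j => nablaCovector U G w i j (x τ)) k * z τ i)
      = ∑ i, ∑ k, z τ i * (b τ k * sharp G (x τ) (fun j => nablaCovector U G w i j (x τ)) k) := by
    rw [Finset.sum_comm]
    exact Finset.sum_congr rfl fun i _ => Finset.sum_congr rfl fun j _ => by ring
  rw [c1, c2]
  ring

/-- Metric compatibility along a curve. -/
lemma IsSmoothMetric.hasDerivWithinAt_dotVec (hG : IsSmoothMetric U G)
    (hτ : τ ∈ J) (hxU : ∀ᶠ t in 𝓝[J] τ, x t ∈ U)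
    (hx : ∀ k, HasDerivWithinAt (fun t => x t k) (z τ k) J τ) {e f : ℝ → Fin n → ℝ}
    {α β : Fin n → ℝ}
    (he : ∀ k, HasDerivWithinAt (fun t => e t k)
      (-(∑ i, ∑ j, christoffel U G k i j (x τ) * z τ i * e τ j) + α k) J τ)
    (hf : ∀ k, HasDerivWithinAt (fun t => f t k)
      (-(∑ i, ∑ j, christoffel U G k i j (x τ) * z τ i * f τ j) + β k) J τ) :
    HasDerivWithinAt (fun t => dotVec G (x t) (e t) (f t))
      (dotVec G (x τ) α (f τ) + dotVec G (x τ) (e τ) β) J τ := by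
  have hxτ : x τ ∈ U := hxU.self_of_nhdsWithin hτ
  have h : HasDerivWithinAt (fun t => dotVec G (x t) (e t) (f t)) _ J τ :=
    HasDerivWithinAt.fun_sum (u := Finset.univ) fun i _ =>
      HasDerivWithinAt.fun_sum (u := Finset.univ) fun j _ =>
        ((hasDerivWithinAt_comp_curve (hG.smooth i j) hτ hxU hx).fun_mul (he i)).fun_mul (hf j)
  refine h.congr_deriv ?_
  simp_rw [hG.pd_metric hxτ]
  unfold dotVec
  simp only [add_mul, mul_add, Finset.sum_add_distrib, neg_mul, mul_neg, Finset.sum_mul,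
    Finset.mul_sum, Finset.sum_neg_distrib]
  have c1 : ∑ i, ∑ j, ∑ m, ∑ k, G (x τ) i k * christoffel U G k m j (x τ) * z τ m * e τ i * f τ j
      = ∑ i, ∑ j, ∑ m, ∑ k, G (x τ) i j * e τ i * (christoffel U G j m k (x τ) * z τ m * f τ k) := by
    refine Finset.sum_congr rfl fun i _ => ?_
    have : ∀ j, ∑ m, ∑ k, G (x τ) i k * christoffel U G k m j (x τ) * z τ m * e τ i * f τ j
      = ∑ k, ∑ m, G (x τ) i k * christoffel U G k m j (x τ) * z τ m * e τ i * f τ j :=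
      fun j => Finset.sum_comm
    simp_rw [this]
    rw [Finset.sum_comm]
    refine Finset.sum_congr rfl fun j _ => ?_
    rw [Finset.sum_comm]
    exact Finset.sum_congr rfl fun m _ => Finset.sum_congr rfl fun k _ => by ring
  have c2 : ∑ i, ∑ j, ∑ m, ∑ k, G (x τ) j k * christoffel U G k m i (x τ) * z τ m * e τ i * f τ j
      = ∑ i, ∑ j, ∑ m, ∑ k, G (x τ) i j * (christoffel U G i m k (x τ) * z τ m * e τ k) * f τ j := by
    rw [Finset.sum_comm]
    conv_rhs => rw [Finset.sum_comm]
    refine Finset.sum_congr rfl fun j _ => ?_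
    have : ∀ i, ∑ m, ∑ k, G (x τ) j k * christoffel U G k m i (x τ) * z τ m * e τ i * f τ j
      = ∑ k, ∑ m, G (x τ) j k * christoffel U G k m i (x τ) * z τ m * e τ i * f τ j :=
      fun j => Finset.sum_comm
    simp_rw [this]
    rw [Finset.sum_comm]
    refine Finset.sum_congr rfl fun i _ => ?_
    rw [Finset.sum_comm]
    refine Finset.sum_congr rfl fun m _ => Finset.sum_congr rfl fun k _ => ?_
    rw [hG.symm _ hxτ j i]; ring
  rw [c1, c2]
  ring

end Curves

/-! ### Propagation along conformal curves, in a chart -/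

section Products

variable {n : ℕ} {U : Set (Coord n)} {G : Coord n → Matrix (Fin n) (Fin n) ℝ} {x : Coord n}

lemma pair_combination (w z y : Fin n → ℝ) (c d : ℝ) :
    pair w (fun k => c * z k + d * y k) = c * pair w z + d * pair w y := by
  unfold pair
  simp_rw [Finset.mul_sum, ← Finset.sum_add_distrib]
  exact Finset.sum_congr rfl fun i _ => by ring

lemma dotVec_combination_left (e z y : Fin n → ℝ) (c d : ℝ) :
    dotVec G x (fun k => c * z k + d * y k) e = c * dotVec G x z e + d * dotVec G x y e := by
  unfold dotVec
  simp_rw [Finset.mul_sum, ← Finset.sum_add_distrib]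
  exact Finset.sum_congr rfl fun i _ => Finset.sum_congr rfl fun j _ => by ring

lemma dotVec_comm (hG : IsSmoothMetric U G) (hx : x ∈ U) (e f : Fin n → ℝ) :
    dotVec G x e f = dotVec G x f e := by
  unfold dotVec
  rw [Finset.sum_comm]
  exact Finset.sum_congr rfl fun i _ => Finset.sum_congr rfl fun j _ => by
    rw [hG.symm x hx j i]; ring

lemma dotVec_eq_pair_flat (e f : Fin n → ℝ) : dotVec G x e f = pair (flat G x f) e := by
  unfold dotVec pair flat
  simp_rw [Finset.sum_mul]
  exact Finset.sum_congr rfl fun i _ => Finset.sum_congr rfl fun j _ => by ring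

lemma dotVec_sharp (hG : IsSmoothMetric U G) (hx : x ∈ U) (b e : Fin n → ℝ) :
    dotVec G x (sharp G x b) e = pair b e := by
  rw [dotVec_comm hG hx, dotVec_eq_pair_flat, hG.flat_sharp hx]

lemma dotCov_flat (hG : IsSmoothMetric U G) (hx : x ∈ U) (z w : Fin n → ℝ) :
    dotCov G x (flat G x z) w = pair w z := by
  rw [dotCov_comm hG hx, ← pair_sharp, hG.sharp_flat hx]

lemma dotCov_sum_left {m : ℕ} (c : Fin m → ℝ) (α : Fin m → Fin n → ℝ) (w : Fin n → ℝ) :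
    dotCov G x (fun k => ∑ i, α i k * c i) w = ∑ i, c i * dotCov G x (α i) w := by
  unfold dotCov
  simp_rw [Finset.mul_sum, Finset.sum_mul]
  have : ∀ i : Fin n, ∑ j, ∑ k, (G x)⁻¹ i j * (α k i * c k) * w j
      = ∑ k, ∑ j, (G x)⁻¹ i j * (α k i * c k) * w j := fun i => Finset.sum_comm
  simp_rw [this]
  rw [Finset.sum_comm]
  exact Finset.sum_congr rfl fun i _ => Finset.sum_congr rfl fun j _ =>
    Finset.sum_congr rfl fun k _ => by ring

end Products

section Propagation

variable {ι : Type*} [Fintype ι] {U : Set (Coord 4)}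
  {G : Coord 4 → Matrix (Fin 4) (Fin 4) ℝ} {Ξ : Coord 4 → ℝ} {lam : ℝ}
  {F : ι → Coord 4 → Fin 4 → Fin 4 → ℝ} {H : Coord 4 → Fin 4 → Fin 4 → ℝ}
  {J : Set ℝ} {x : ℝ → Coord 4} {z b e f : ℝ → Fin 4 → ℝ} {τ : ℝ}

/-- The scalar `⟨b, ∇Ξ⟩ + s`, which vanishes along conformal curves in the boundary. -/
def obstruction (U : Set (Coord 4)) (G : Coord 4 → Matrix (Fin 4) (Fin 4) ℝ) (Ξ : Coord 4 → ℝ)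
    (x : Coord 4) (b : Fin 4 → ℝ) : ℝ :=
  dotCov G x b (dComp U Ξ x) + friedrichScalar U G Ξ x

/-- The product of two Weyl propagated vectors satisfies `g(e,f)' = -2⟨b,z⟩ g(e,f)`: the terms of
the propagation equation that are not proportional to the vectors form a skew endomorphism. -/
lemma IsSmoothMetric.hasDerivWithinAt_dotVec_weyl (hG : IsSmoothMetric U G) (hτ : τ ∈ J)
    (hxU : ∀ᶠ t in 𝓝[J] τ, x t ∈ U) (hc : ConformalCurveEqAt U G H J x z b τ)
    (he : WeylEqAt U G J x z b e τ) (hf : WeylEqAt U G J x z b f τ) :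
    HasDerivWithinAt (fun t => dotVec G (x t) (e t) (f t))
      (-2 * pair (b τ) (z τ) * dotVec G (x τ) (e τ) (f τ)) J τ := by
  have hxτ : x τ ∈ U := hxU.self_of_nhdsWithin hτ
  have shape : ∀ {e : ℝ → Fin 4 → ℝ}, WeylEqAt U G J x z b e τ → ∀ k,
      HasDerivWithinAt (fun t => e t k)
      (-(∑ i, ∑ j, christoffel U G k i j (x τ) * z τ i * e τ j)
        + (1 * (-pair (b τ) (e τ) * z τ k + -pair (b τ) (z τ) * e τ k)
          + dotVec G (x τ) (e τ) (z τ) * sharp G (x τ) (b τ) k)) J τ :=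
    fun he k => (he k).congr_deriv (by ring)
  have h := hG.hasDerivWithinAt_dotVec hτ hxU hc.position (shape he) (shape hf)
  refine h.congr_deriv ?_
  rw [dotVec_comm hG hxτ (e τ) (fun k => 1 * _ + _), dotVec_combination_left,
    dotVec_combination_left,
    dotVec_combination_left, dotVec_combination_left, dotVec_sharp hG hxτ, dotVec_sharp hG hxτ,
    dotVec_comm hG hxτ (z τ) (f τ), dotVec_comm hG hxτ (z τ) (e τ),
    dotVec_comm hG hxτ (f τ) (e τ)]
  ring

namespace IsLocalExtension

variable (h : IsLocalExtension U G Ξ lam F)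
include h

lemma hasDerivWithinAt_factor (hτ : τ ∈ J) (hxU : ∀ᶠ t in 𝓝[J] τ, x t ∈ U)
    (hc : ConformalCurveEqAt U G H J x z b τ) :
    HasDerivWithinAt (fun t => Ξ (x t)) (pair (dComp U Ξ (x τ)) (z τ)) J τ :=
  hasDerivWithinAt_comp_curve h.smooth_factor hτ hxU hc.position

/-- `⟨dΞ,z⟩' = -H(z,z) Ξ - 2⟨b,z⟩ ⟨dΞ,z⟩ + g(z,z) (⟨b,∇Ξ⟩ + s)`: the term `s g(z,z)` of the Hessian
of `Ξ` combines with the acceleration `g(z,z) b♯` to the last term. -/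
lemma hasDerivWithinAt_pair_dComp (hτ : τ ∈ J) (hxU : ∀ᶠ t in 𝓝[J] τ, x t ∈ U)
    (hc : ConformalCurveEqAt U G H J x z b τ) :
    HasDerivWithinAt (fun t => pair (dComp U Ξ (x t)) (z t))
      (-(∑ i, ∑ j, smoothH U G Ξ F i j (x τ) * z τ i * z τ j) * Ξ (x τ)
        - 2 * pair (b τ) (z τ) * pair (dComp U Ξ (x τ)) (z τ)
        + dotVec G (x τ) (z τ) (z τ) * obstruction U G Ξ (x τ) (b τ)) J τ := by
  have hxτ : x τ ∈ U := hxU.self_of_nhdsWithin hτ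
  have hd := hasDerivWithinAt_pair_field (e := z) (a := fun k => -2 * pair (b τ) (z τ) * z τ k
      + dotVec G (x τ) (z τ) (z τ) * sharp G (x τ) (b τ) k) h.smooth_dComp hτ hxU hc.position
    (fun k => (hc.velocity k).congr_deriv (by ring))
  refine hd.congr_deriv ?_
  rw [pair_combination, pair_sharp, dotCov_comm h.metric hxτ (dComp U Ξ (x τ))]
  simp_rw [h.hessian hxτ]
  unfold obstruction dotVec
  simp only [add_mul, Finset.sum_add_distrib, mul_add, Finset.sum_mul,
    neg_mul, Finset.sum_neg_distrib]
  have e1 : ∑ i, ∑ j, Ξ (x τ) * smoothH U G Ξ F i j (x τ) * z τ i * z τ j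
      = ∑ i, ∑ j, smoothH U G Ξ F i j (x τ) * z τ i * z τ j * Ξ (x τ) :=
    Finset.sum_congr rfl fun i _ => Finset.sum_congr rfl fun j _ => by ring
  have e2 : ∑ i, ∑ j, friedrichScalar U G Ξ (x τ) * G (x τ) i j * z τ i * z τ j
      = ∑ i, ∑ j, G (x τ) i j * z τ i * z τ j * friedrichScalar U G Ξ (x τ) :=
    Finset.sum_congr rfl fun i _ => Finset.sum_congr rfl fun j _ => by ring
  rw [e1, e2]
  ring

/-- `(⟨b,∇Ξ⟩ + s)' = -H(z,b♯) Ξ - ½ g♯(b,b) ⟨dΞ,z⟩ + ⟨b,z⟩ (⟨b,∇Ξ⟩ + s)`: the derivative of `s`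
cancels the term `H(z,∇Ξ)` which comes from the propagation of `b`. Thus `Ξ`, `⟨dΞ,z⟩` and
`⟨b,∇Ξ⟩ + s` satisfy a closed homogeneous linear system. -/
lemma hasDerivWithinAt_obstruction (hτ : τ ∈ J) (hxU : ∀ᶠ t in 𝓝[J] τ, x t ∈ U)
    (hc : ConformalCurveEqAt U G H J x z b τ)
    (hH : ∀ i k, H (x τ) i k = smoothH U G Ξ F i k (x τ)) :
    HasDerivWithinAt (fun t => obstruction U G Ξ (x t) (b t))
      (-(∑ i, z τ i * dotCov G (x τ) (fun j => smoothH U G Ξ F i j (x τ)) (b τ)) * Ξ (x τ)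
        - (1 / 2) * dotCov G (x τ) (b τ) (b τ) * pair (dComp U Ξ (x τ)) (z τ)
        + pair (b τ) (z τ) * obstruction U G Ξ (x τ) (b τ)) J τ := by
  have hxτ : x τ ∈ U := hxU.self_of_nhdsWithin hτ
  have hd := (h.metric.hasDerivWithinAt_dotCov_field (b := b)
    (a := fun k => 1 * (pair (b τ) (z τ) * b τ k
      + (-(1 / 2) * dotCov G (x τ) (b τ) (b τ)) * flat G (x τ) (z τ) k)
      + 1 * ∑ i, smoothH U G Ξ F i k (x τ) * z τ i)
    h.smooth_dComp hτ hxU hc.position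
    (fun k => (hc.covector k).congr_deriv (by simp_rw [hH]; ring))).fun_add
    (hasDerivWithinAt_comp_curve h.smooth_friedrichScalar hτ hxU hc.position)
  refine hd.congr_deriv ?_
  rw [dotCov_smul_add, dotCov_smul_add, dotCov_flat h.metric hxτ, dotCov_sum_left]
  simp_rw [h.hessian hxτ, h.pd_friedrichScalar hxτ]
  have e1 : ∀ i, dotCov G (x τ) (b τ) (fun j => -Ξ (x τ) * smoothH U G Ξ F i j (x τ)
        + friedrichScalar U G Ξ (x τ) * G (x τ) i j)
      = -Ξ (x τ) * dotCov G (x τ) (fun j => smoothH U G Ξ F i j (x τ)) (b τ)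
        + friedrichScalar U G Ξ (x τ) * b τ i := by
    intro i
    rw [dotCov_comm h.metric hxτ, dotCov_smul_add, dotCov_metric_left h.metric hxτ]
  simp_rw [e1]
  unfold obstruction
  have e2 : ∑ i, z τ i * (-Ξ (x τ) * dotCov G (x τ) (fun j => smoothH U G Ξ F i j (x τ)) (b τ)
        + friedrichScalar U G Ξ (x τ) * b τ i)
      = -(∑ i, z τ i * dotCov G (x τ) (fun j => smoothH U G Ξ F i j (x τ)) (b τ)) * Ξ (x τ)
        + friedrichScalar U G Ξ (x τ) * pair (b τ) (z τ) := by
    unfold pair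
    rw [neg_mul, Finset.sum_mul, Finset.mul_sum, ← Finset.sum_neg_distrib,
      ← Finset.sum_add_distrib]
    exact Finset.sum_congr rfl fun i _ => by ring
  have e3 : ∑ i, -dotCov G (x τ) (fun j => smoothH U G Ξ F i j (x τ)) (dComp U Ξ (x τ)) * z τ i
      = -∑ i, z τ i * dotCov G (x τ) (fun j => smoothH U G Ξ F i j (x τ)) (dComp U Ξ (x τ)) := by
    rw [← Finset.sum_neg_distrib]
    exact Finset.sum_congr rfl fun i _ => by ring
  rw [e2, e3]
  ring

/-- Along a conformal curve in the boundary, Weyl propagation preserves tangency to the boundary. -/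
lemma hasDerivWithinAt_pair_dComp_weyl (hτ : τ ∈ J) (hxU : ∀ᶠ t in 𝓝[J] τ, x t ∈ U)
    (hc : ConformalCurveEqAt U G H J x z b τ) (he : WeylEqAt U G J x z b e τ)
    (h0 : Ξ (x τ) = 0) (h1 : pair (dComp U Ξ (x τ)) (z τ) = 0)
    (h2 : obstruction U G Ξ (x τ) (b τ) = 0) :
    HasDerivWithinAt (fun t => pair (dComp U Ξ (x t)) (e t))
      (-pair (b τ) (z τ) * pair (dComp U Ξ (x τ)) (e τ)) J τ := by
  have hxτ : x τ ∈ U := hxU.self_of_nhdsWithin hτ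
  have hd := hasDerivWithinAt_pair_field (e := e)
    (a := fun k => 1 * (-pair (b τ) (e τ) * z τ k + -pair (b τ) (z τ) * e τ k)
      + dotVec G (x τ) (e τ) (z τ) * sharp G (x τ) (b τ) k) h.smooth_dComp hτ hxU hc.position
    (fun k => (he k).congr_deriv (by ring))
  refine hd.congr_deriv ?_
  have h3 : dotCov G (x τ) (b τ) (dComp U Ξ (x τ)) = -friedrichScalar U G Ξ (x τ) := by
    unfold obstruction at h2; linarith
  rw [pair_combination, pair_combination, pair_sharp,
    dotCov_comm h.metric hxτ (dComp U Ξ (x τ)), h1, h3]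
  simp_rw [h.hessian hxτ, h0]
  have e2 : ∑ i, ∑ j, (-0 * smoothH U G Ξ F i j (x τ)
        + friedrichScalar U G Ξ (x τ) * G (x τ) i j) * z τ i * e τ j
      = friedrichScalar U G Ξ (x τ) * dotVec G (x τ) (e τ) (z τ) := by
    rw [dotVec_comm h.metric hxτ]
    unfold dotVec
    simp_rw [Finset.mul_sum]
    exact Finset.sum_congr rfl fun i _ => Finset.sum_congr rfl fun j _ => by ring
  rw [e2]
  ring

end IsLocalExtension

end Propagation

/-! ### The curvature tensor -/

section Curvature

variable {n : ℕ} {U : Set (Coord n)} {G : Coord n → Matrix (Fin n) (Fin n) ℝ} {x : Coord n}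

/-- The curvature tensor `Rᵃ_{k i j}` of `∇ᵢ∇ⱼ - ∇ⱼ∇ᵢ`; the Ricci tensor is `R_{ij} = Rᵏ_{i k j}`. -/
def curv (U : Set (Coord n)) (G : Coord n → Matrix (Fin n) (Fin n) ℝ) (a k i j : Fin n)
    (x : Coord n) : ℝ :=
  pd U i (christoffel U G a k j) x - pd U j (christoffel U G a k i) x
    + ∑ l, (christoffel U G a i l x * christoffel U G l k j x
      - christoffel U G a j l x * christoffel U G l k i x)

lemma ricci_eq_sum_curv (i j : Fin n) : ricci U G i j x = ∑ k, curv U G k i k j x := rfl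

/-- The curvature tensor with all indices down, in terms of the Christoffel symbols of the first
kind. -/
lemma IsSmoothMetric.lower_curv (hG : IsSmoothMetric U G) (hx : x ∈ U) (l k i j : Fin n) :
    ∑ a, G x l a * curv U G a k i j x
      = pd U i (christoffelFirst U G l k j) x - pd U j (christoffelFirst U G l k i) x
        - (dotCov G x (fun a => christoffelFirst U G a i l x)
              (fun a => christoffelFirst U G a k j x)
          - dotCov G x (fun a => christoffelFirst U G a j l x)
              (fun a => christoffelFirst U G a k i x)) := by
  have e1 : ∀ i k j, pd U i (christoffelFirst U G l k j) x
      = ∑ a, (christoffelFirst U G a i l x * christoffel U G a k j x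
        + christoffelFirst U G l i a x * christoffel U G a k j x
        + G x l a * pd U i (christoffel U G a k j) x) := by
    intro i k j
    rw [← pd_congr (f := fun y => ∑ a, G y l a * christoffel U G a k j y)
      (fun y hy => hG.lower_christoffel hy l k j) hx,
      pd_sum _ hG.uniqueDiff hx fun a => (hG.smooth l a).mul (hG.smooth_christoffel a k j)]
    refine Finset.sum_congr rfl fun a _ => ?_
    rw [pd_mul hG.uniqueDiff hx (hG.smooth l a) (hG.smooth_christoffel a k j),
      hG.pd_metric_first hx]
    ring
  have e2 : ∀ i k j, dotCov G x (fun a => christoffelFirst U G a i l x)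
      (fun a => christoffelFirst U G a k j x)
      = ∑ a, christoffelFirst U G a i l x * christoffel U G a k j x := by
    intro i k j
    rw [← pair_sharp]
    unfold pair sharp
    simp_rw [christoffel_eq_sum_first]
  have e3 : ∀ i k j, ∑ a, G x l a * ∑ m, christoffel U G a i m x * christoffel U G m k j x
      = ∑ a, christoffelFirst U G l i a x * christoffel U G a k j x := by
    intro i k j
    simp_rw [← hG.lower_christoffel hx l, Finset.mul_sum, Finset.sum_mul]
    rw [Finset.sum_comm]
    exact Finset.sum_congr rfl fun a _ => Finset.sum_congr rfl fun m _ => by ring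
  rw [e1, e1, e2, e2]
  unfold curv
  simp_rw [mul_add, mul_sub, Finset.sum_sub_distrib, Finset.sum_add_distrib,
    Finset.sum_sub_distrib, mul_sub, Finset.sum_sub_distrib]
  rw [e3, e3]
  ring

lemma IsSmoothMetric.curv_eq_raise (hG : IsSmoothMetric U G) (hx : x ∈ U) (a k i j : Fin n) :
    curv U G a k i j x = ∑ l, (G x)⁻¹ a l * ∑ c, G x l c * curv U G c k i j x :=
  (congrFun (hG.sharp_flat hx (fun a => curv U G a k i j x)) a).symm

/-- The Ricci identity for the differential of a function. -/
lemma IsSmoothMetric.ricci_identity (hG : IsSmoothMetric U G) (hx : x ∈ U)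
    {f : Coord n → ℝ} (hf : ContDiffOn ℝ ∞ f U) (i j k : Fin n) :
    pd U k (nablaCovector U G (dComp U f) j i) x - pd U j (nablaCovector U G (dComp U f) k i) x
      - ∑ m, christoffel U G m k i x * nablaCovector U G (dComp U f) j m x
      + ∑ m, christoffel U G m j i x * nablaCovector U G (dComp U f) k m x
      = -∑ d, curv U G d i k j x * dComp U f x d := by
  have hw : ∀ i, ContDiffOn ℝ ∞ (fun y => dComp U f y i) U :=
    fun i => contDiffOn_pd hG.uniqueDiff hf i
  have e1 : ∀ k j, pd U k (nablaCovector U G (dComp U f) j i) x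
      = pd U k (pd U j (pd U i f)) x
        - ∑ d, (pd U k (christoffel U G d i j) x * dComp U f x d
          + christoffel U G d i j x * pd U k (fun y => dComp U f y d) x) := by
    intro k j
    unfold nablaCovector
    rw [pd_sub hG.uniqueDiff hx (contDiffOn_pd hG.uniqueDiff (hw i) j)
      (ContDiffOn.sum fun d _ => (hG.smooth_christoffel d j i).mul (hw d)),
      pd_sum _ hG.uniqueDiff hx fun d => (hG.smooth_christoffel d j i).mul (hw d)]
    congr 1
    refine Finset.sum_congr rfl fun d _ => ?_
    rw [pd_mul hG.uniqueDiff hx (hG.smooth_christoffel d j i) (hw d),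
      pd_congr (fun y hy => hG.christoffel_symm hy d j i) hx, hG.christoffel_symm hx d j i]
  rw [e1, e1, pd_comm hG.uniqueDiff hG.subset_closure hx
    (contDiffOn_pd hG.uniqueDiff hf i) k j]
  unfold nablaCovector curv
  simp only [add_mul, sub_mul, mul_sub, Finset.sum_add_distrib, Finset.sum_sub_distrib,
    Finset.sum_mul, Finset.mul_sum]
  have e2 : ∀ k j, ∑ d, ∑ l, christoffel U G d k l x * christoffel U G l i j x * dComp U f x d
      = ∑ m, ∑ d, christoffel U G m j i x * (christoffel U G d k m x * dComp U f x d) := by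
    intro k j
    rw [Finset.sum_comm]
    refine Finset.sum_congr rfl fun m _ => Finset.sum_congr rfl fun d _ => ?_
    rw [hG.christoffel_symm hx m i j]; ring
  rw [e2, e2]
  have e3 : ∀ k j, ∑ m, christoffel U G m j i x * pd U k (fun y => dComp U f y m) x
      = ∑ d, christoffel U G d i j x * pd U k (fun y => dComp U f y d) x := fun k j =>
    Finset.sum_congr rfl fun d _ => by rw [hG.christoffel_symm hx d j i]
  rw [e3, e3]
  ring

end Curvature

/-! ### The geometry of the boundary hypersurface -/

section Boundary

open AdSLikeExtension

/-- The inclusion of the boundary of the half-space, as a continuous linear map. -/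
def bdryInclusion : Coord 3 →L[ℝ] Coord 4 :=
  LinearMap.toContinuousLinearMap
    { toFun := bdryPt
      map_add' := fun u v => by
        ext i; refine Fin.cases ?_ (fun j => ?_) i <;> simp [bdryPt]
      map_smul' := fun c u => by
        ext i; refine Fin.cases ?_ (fun j => ?_) i <;> simp [bdryPt] }

lemma bdryInclusion_apply (y : Coord 3) : bdryInclusion y = bdryPt y := rfl

lemma bdryInclusion_single (i : Fin 3) :
    bdryInclusion (EuclideanSpace.single i 1) = EuclideanSpace.single i.succ 1 := by
  rw [bdryInclusion_apply]
  ext k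
  refine Fin.cases ?_ (fun j => ?_) k
  · simp [bdryPt]
  · simp [bdryPt]

variable {U : Set (Coord 4)} {y : Coord 3}

/-- Partial derivatives along the boundary are the tangential partial derivatives. -/
lemma pd_comp_bdryPt {f : Coord 4 → ℝ} (hD : IsOpen {y | bdryPt y ∈ U})
    (hf : ContDiffOn ℝ ∞ f U) (hy : bdryPt y ∈ U) (i : Fin 3) :
    pd {y | bdryPt y ∈ U} i (fun y => f (bdryPt y)) y = pd U i.succ f (bdryPt y) := by
  unfold pd
  have h1 : HasFDerivWithinAt bdryPt bdryInclusion {y | bdryPt y ∈ U} y :=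
    bdryInclusion.hasFDerivWithinAt
  have h2 := (ContDiffOn.diffWithin hf hy).hasFDerivWithinAt.comp y h1 (fun z hz => hz)
  have h3 := h2.fderivWithin (hD.uniqueDiffWithinAt hy)
  have e : (f ∘ bdryPt) = fun y => f (bdryPt y) := rfl
  rw [e] at h3
  rw [h3, ContinuousLinearMap.comp_apply, bdryInclusion_single]

lemma contDiffOn_comp_bdryPt {f : Coord 4 → ℝ} (hf : ContDiffOn ℝ ∞ f U) :
    ContDiffOn ℝ ∞ (fun y => f (bdryPt y)) {y | bdryPt y ∈ U} :=
  hf.comp (bdryInclusion.contDiff.contDiffOn) (fun _ hz => hz)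

/-- The metric induced on the boundary. -/
def inducedMetric (G : Coord 4 → Matrix (Fin 4) (Fin 4) ℝ) (y : Coord 3) :
    Matrix (Fin 3) (Fin 3) ℝ :=
  Matrix.of fun i j => G (bdryPt y) i.succ j.succ

section Inverse

variable {G : Coord 4 → Matrix (Fin 4) (Fin 4) ℝ}

/-- By Cramer's rule, the induced metric is nondegenerate iff `g⁰⁰ ≠ 0`, that is, iff the conormal of
the boundary is not null. -/
lemma det_inducedMetric (hd : (G (bdryPt y)).det ≠ 0) :
    (inducedMetric G y).det = (G (bdryPt y)).det * (G (bdryPt y))⁻¹ 0 0 := by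
  have h1 : (G (bdryPt y))⁻¹ 0 0 = ((G (bdryPt y)).det)⁻¹ * (G (bdryPt y)).adjugate 0 0 := by
    rw [Matrix.inv_def, Ring.inverse_eq_inv']
    simp
  rw [h1, mul_inv_cancel_left₀ hd, Matrix.adjugate_fin_succ_eq_det_submatrix]
  simp only [Fin.val_zero, add_zero, pow_zero, one_mul]
  congr 1

variable (hG : IsSmoothMetric U G) (hy : bdryPt y ∈ U) (hN : (G (bdryPt y))⁻¹ 0 0 ≠ 0)
include hG hy hN

/-- The inverse of the induced metric, as the Schur complement of `g⁰⁰` in the inverse of `g`: the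
normal part of `g♯` is removed. -/
lemma inducedMetric_inv (k l : Fin 3) :
    (inducedMetric G y)⁻¹ k l = (G (bdryPt y))⁻¹ k.succ l.succ
      - (G (bdryPt y))⁻¹ k.succ 0 * (G (bdryPt y))⁻¹ l.succ 0 / (G (bdryPt y))⁻¹ 0 0 := by
  have h : (inducedMetric G y)⁻¹ = Matrix.of fun k l : Fin 3 => (G (bdryPt y))⁻¹ k.succ l.succ
      - (G (bdryPt y))⁻¹ k.succ 0 * (G (bdryPt y))⁻¹ l.succ 0 / (G (bdryPt y))⁻¹ 0 0 := by
    refine Matrix.inv_eq_left_inv ?_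
    ext a b
    rw [Matrix.mul_apply, Matrix.one_apply]
    have h1 := hG.inv_mul hy a.succ b.succ
    have h2 := hG.inv_mul hy 0 b.succ
    rw [Fin.sum_univ_succ] at h1 h2
    rw [if_neg (Fin.succ_ne_zero b).symm] at h2
    simp only [Fin.succ_inj] at h1
    have h3 : ∑ j : Fin 3, Matrix.of (fun k l : Fin 3 => (G (bdryPt y))⁻¹ k.succ l.succ
        - (G (bdryPt y))⁻¹ k.succ 0 * (G (bdryPt y))⁻¹ l.succ 0 / (G (bdryPt y))⁻¹ 0 0) a j
          * inducedMetric G y j b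
        = ∑ j : Fin 3, (G (bdryPt y))⁻¹ a.succ j.succ * G (bdryPt y) j.succ b.succ
          - (G (bdryPt y))⁻¹ a.succ 0 / (G (bdryPt y))⁻¹ 0 0 *
            ∑ j : Fin 3, (G (bdryPt y))⁻¹ 0 j.succ * G (bdryPt y) j.succ b.succ := by
      rw [Finset.mul_sum, ← Finset.sum_sub_distrib]
      refine Finset.sum_congr rfl fun j _ => ?_
      simp only [Matrix.of_apply, inducedMetric]
      rw [hG.inv_symm hy 0 j.succ]
      ring
    rw [h3, ← h1]
    have h4 : ∑ j : Fin 3, (G (bdryPt y))⁻¹ 0 j.succ * G (bdryPt y) j.succ b.succ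
        = -((G (bdryPt y))⁻¹ 0 0 * G (bdryPt y) 0 b.succ) := by linarith
    rw [h4]
    field_simp
    ring
  rw [h, Matrix.of_apply]

/-- Tracing with the inverse of the induced metric removes the normal components. -/
lemma sum_inducedMetric_inv (T : Fin 4 → Fin 4 → ℝ) :
    ∑ k : Fin 3, ∑ l : Fin 3, (inducedMetric G y)⁻¹ k l * T k.succ l.succ
      = trace G (bdryPt y) T
        - (∑ k, ∑ l, (G (bdryPt y))⁻¹ k 0 * (G (bdryPt y))⁻¹ l 0 * T k l)
          / (G (bdryPt y))⁻¹ 0 0 := by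
  set gi := (G (bdryPt y))⁻¹ with hgi
  have e1 : ∑ k : Fin 3, ∑ l : Fin 3, (inducedMetric G y)⁻¹ k l * T k.succ l.succ
      = ∑ k : Fin 4, ∑ l : Fin 4, (gi k l - gi k 0 * gi l 0 / gi 0 0) * T k l := by
    rw [Fin.sum_univ_succ (n := 3)]
    have z1 : ∑ l, (gi 0 l - gi 0 0 * gi l 0 / gi 0 0) * T 0 l = 0 := by
      refine Finset.sum_eq_zero fun l _ => ?_
      rw [show gi 0 l = gi l 0 from hG.inv_symm hy 0 l]
      field_simp
      ring
    rw [z1, zero_add]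
    refine Finset.sum_congr rfl fun k _ => ?_
    rw [Fin.sum_univ_succ (n := 3)]
    have z2 : gi k.succ 0 - gi k.succ 0 * gi 0 0 / gi 0 0 = 0 := by
      field_simp
      ring
    rw [z2, zero_mul, zero_add]
    refine Finset.sum_congr rfl fun l _ => ?_
    rw [inducedMetric_inv hG hy hN]
  rw [e1]
  unfold trace
  simp_rw [sub_mul, Finset.sum_sub_distrib, Finset.sum_div]
  congr 1
  exact Finset.sum_congr rfl fun k _ => Finset.sum_congr rfl fun l _ => by ring

/-- For the pull-backs of covectors to the boundary, the induced product differs from `g♯` by the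
product of the normal components. -/
lemma dotCov_inducedMetric (a c : Fin 4 → ℝ) :
    dotCov (inducedMetric G) y (fun i => a i.succ) (fun i => c i.succ)
      = dotCov G (bdryPt y) a c
        - sharp G (bdryPt y) a 0 * sharp G (bdryPt y) c 0 / (G (bdryPt y))⁻¹ 0 0 := by
  have h := sum_inducedMetric_inv hG hy hN (fun k l => a k * c l)
  have e : ∑ k, ∑ l, (G (bdryPt y))⁻¹ k 0 * (G (bdryPt y))⁻¹ l 0 * (a k * c l)
      = sharp G (bdryPt y) a 0 * sharp G (bdryPt y) c 0 := by
    unfold sharp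
    rw [Finset.sum_mul_sum]
    refine Finset.sum_congr rfl fun k _ => Finset.sum_congr rfl fun l _ => ?_
    rw [hG.inv_symm hy 0 k, hG.inv_symm hy 0 l]; ring
  rw [e] at h
  unfold trace at h
  unfold dotCov
  simp_rw [mul_assoc]
  exact h

/-- Raising the index of a pulled back covector projects `a♯` orthogonally to the boundary. -/
lemma sharp_inducedMetric (a : Fin 4 → ℝ) (m : Fin 3) :
    sharp (inducedMetric G) y (fun i => a i.succ) m
      = sharp G (bdryPt y) a m.succ
        - (G (bdryPt y))⁻¹ m.succ 0 / (G (bdryPt y))⁻¹ 0 0 * sharp G (bdryPt y) a 0 := by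
  unfold sharp
  simp_rw [inducedMetric_inv hG hy hN]
  rw [Fin.sum_univ_succ (n := 3), Fin.sum_univ_succ (n := 3)]
  have e : ∑ x : Fin 3, ((G (bdryPt y))⁻¹ m.succ x.succ - (G (bdryPt y))⁻¹ m.succ 0 *
      (G (bdryPt y))⁻¹ x.succ 0 / (G (bdryPt y))⁻¹ 0 0) * a x.succ
      = ∑ x : Fin 3, (G (bdryPt y))⁻¹ m.succ x.succ * a x.succ
        - (G (bdryPt y))⁻¹ m.succ 0 / (G (bdryPt y))⁻¹ 0 0
          * ∑ x : Fin 3, (G (bdryPt y))⁻¹ 0 x.succ * a x.succ := by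
    rw [Finset.mul_sum, ← Finset.sum_sub_distrib]
    refine Finset.sum_congr rfl fun x _ => ?_
    rw [hG.inv_symm hy 0 x.succ]; ring
  rw [e]
  field_simp
  ring

end Inverse

end Boundary

/-! ### The umbilical boundary -/

section Boundary

open AdSLikeExtension

variable {ι : Type*} [Fintype ι] {U : Set (Coord 4)}
  {G : Coord 4 → Matrix (Fin 4) (Fin 4) ℝ} {Ξ : Coord 4 → ℝ} {lam : ℝ}
  {F : ι → Coord 4 → Fin 4 → Fin 4 → ℝ} {y : Coord 3}

namespace IsLocalExtension

variable (h : IsLocalExtension U G Ξ lam F) (hlam : 0 < lam)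
  (hD : IsOpen {y | bdryPt y ∈ U}) (hΞ : ∀ y, bdryPt y ∈ U → Ξ (bdryPt y) = 0)
include h hD hΞ

/-- On the boundary only the transversal component of `dΞ` survives. -/
lemma dComp_succ (hy : bdryPt y ∈ U) (i : Fin 3) : dComp U Ξ (bdryPt y) i.succ = 0 := by
  unfold dComp
  rw [← pd_comp_bdryPt hD h.smooth_factor hy,
    pd_congr (U := {y | bdryPt y ∈ U}) (h := fun _ => 0) (fun z hz => hΞ z hz) hy, pd_const]

lemma pair_dComp (hy : bdryPt y ∈ U) (z : Fin 4 → ℝ) :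
    pair (dComp U Ξ (bdryPt y)) z = dComp U Ξ (bdryPt y) 0 * z 0 := by
  unfold pair
  rw [Fin.sum_univ_succ]
  simp_rw [h.dComp_succ hD hΞ hy]
  simp

lemma dotCov_dComp (hy : bdryPt y ∈ U) (a : Fin 4 → ℝ) :
    dotCov G (bdryPt y) a (dComp U Ξ (bdryPt y))
      = sharp G (bdryPt y) a 0 * dComp U Ξ (bdryPt y) 0 := by
  rw [dotCov_comm h.metric hy, ← pair_sharp, h.pair_dComp hD hΞ hy, mul_comm]

/-- `g⁰⁰ (∂₀Ξ)² = -λ/3` on the boundary. -/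
lemma norm_dComp_bdry (hy : bdryPt y ∈ U) :
    (G (bdryPt y))⁻¹ 0 0 * dComp U Ξ (bdryPt y) 0 ^ 2 = -lam / 3 := by
  have h1 := h.norm_dComp hy
  rw [hΞ y hy, h.dotCov_dComp hD hΞ hy] at h1
  have h2 : sharp G (bdryPt y) (dComp U Ξ (bdryPt y)) 0
      = (G (bdryPt y))⁻¹ 0 0 * dComp U Ξ (bdryPt y) 0 := by
    unfold sharp
    rw [Fin.sum_univ_succ]
    simp_rw [h.dComp_succ hD hΞ hy]
    simp
  rw [h2] at h1
  linarith

include hlam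

lemma dComp_zero_ne (hy : bdryPt y ∈ U) : dComp U Ξ (bdryPt y) 0 ≠ 0 := by
  intro h0
  have := h.norm_dComp_bdry hD hΞ hy
  rw [h0] at this
  linarith

/-- The boundary is not null, because `λ ≠ 0`. -/
lemma inv_zero_zero_ne (hy : bdryPt y ∈ U) : (G (bdryPt y))⁻¹ 0 0 ≠ 0 := by
  intro h0
  have := h.norm_dComp_bdry hD hΞ hy
  rw [h0] at this
  linarith

lemma inducedMetric_isSmoothMetric :
    IsSmoothMetric {y | bdryPt y ∈ U} (inducedMetric G) where
  uniqueDiff := hD.uniqueDiffOn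
  subset_closure := by rw [hD.interior_eq]; exact subset_closure
  smooth i j := contDiffOn_comp_bdryPt (h.metric.smooth i.succ j.succ)
  symm y hy i j := h.metric.symm _ hy _ _
  det_ne y hy := by
    rw [det_inducedMetric (h.metric.det_ne _ hy)]
    exact mul_ne_zero (h.metric.det_ne _ hy) (h.inv_zero_zero_ne hlam hD hΞ hy)

omit hlam hΞ in
lemma christoffelFirst_inducedMetric (hy : bdryPt y ∈ U) (l i j : Fin 3) :
    christoffelFirst {y | bdryPt y ∈ U} (inducedMetric G) l i j y
      = christoffelFirst U G l.succ i.succ j.succ (bdryPt y) := by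
  unfold christoffelFirst
  rw [← pd_comp_bdryPt hD (h.metric.smooth _ _) hy, ← pd_comp_bdryPt hD (h.metric.smooth _ _) hy,
    ← pd_comp_bdryPt hD (h.metric.smooth _ _) hy]
  rfl

/-- The boundary is umbilical: `Γ⁰ᵢⱼ = -(s / ∂₀Ξ) gᵢⱼ` for tangential `i`, `j`. This is the tangential
part of `∇∇Ξ = -Ξ H + s g` at `Ξ = 0`. -/
lemma christoffel_zero (hy : bdryPt y ∈ U) (i j : Fin 3) :
    christoffel U G 0 i.succ j.succ (bdryPt y)
      = -(friedrichScalar U G Ξ (bdryPt y) / dComp U Ξ (bdryPt y) 0)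
        * G (bdryPt y) i.succ j.succ := by
  have h1 := h.hessian hy i.succ j.succ
  have h2 : pd U i.succ (fun y => dComp U Ξ y j.succ) (bdryPt y) = 0 := by
    rw [← pd_comp_bdryPt hD (h.smooth_dComp j.succ) hy,
      pd_congr (U := {y | bdryPt y ∈ U}) (h := fun _ => 0)
        (fun z hz => h.dComp_succ hD hΞ hz j) hy, pd_const]
  have h3 : ∑ k, christoffel U G k i.succ j.succ (bdryPt y) * dComp U Ξ (bdryPt y) k
      = christoffel U G 0 i.succ j.succ (bdryPt y) * dComp U Ξ (bdryPt y) 0 := by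
    rw [Fin.sum_univ_succ]
    simp_rw [h.dComp_succ hD hΞ hy]
    simp
  unfold nablaCovector at h1
  rw [h2, h3, hΞ y hy] at h1
  have := h.dComp_zero_ne hlam hD hΞ hy
  field_simp
  linarith

/-- The Gauss formula: the connection of the induced metric is the tangential part of that of `g`. -/
lemma christoffel_inducedMetric (hy : bdryPt y ∈ U) (m i j : Fin 3) :
    christoffel {y | bdryPt y ∈ U} (inducedMetric G) m i j y
      = christoffel U G m.succ i.succ j.succ (bdryPt y)
        - (G (bdryPt y))⁻¹ m.succ 0 / (G (bdryPt y))⁻¹ 0 0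
          * christoffel U G 0 i.succ j.succ (bdryPt y) := by
  have e : ∀ k, christoffel U G k i.succ j.succ (bdryPt y)
      = sharp G (bdryPt y) (fun l => christoffelFirst U G l i.succ j.succ (bdryPt y)) k :=
    fun k => christoffel_eq_sum_first k _ _ _
  rw [e, e, ← sharp_inducedMetric h.metric hy (h.inv_zero_zero_ne hlam hD hΞ hy),
    christoffel_eq_sum_first]
  simp_rw [h.christoffelFirst_inducedMetric hD hy]
  rfl

/-- The Gauss equation of the umbilical boundary. With all indices down, the curvature is the sum of
second derivatives of `g`, which restrict to the boundary, and of products of Christoffel symbols of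
the first kind, in which only the normal component is lost. -/
lemma lower_curv_inducedMetric (hy : bdryPt y ∈ U) (l k i j : Fin 3) :
    ∑ a, inducedMetric G y l a * curv {y | bdryPt y ∈ U} (inducedMetric G) a k i j y
      = ∑ a, G (bdryPt y) l.succ a * curv U G a k.succ i.succ j.succ (bdryPt y)
        + (friedrichScalar U G Ξ (bdryPt y) / dComp U Ξ (bdryPt y) 0) ^ 2
            / (G (bdryPt y))⁻¹ 0 0
          * (inducedMetric G y i l * inducedMetric G y k j
            - inducedMetric G y j l * inducedMetric G y k i) := by
  have hN := h.inv_zero_zero_ne hlam hD hΞ hy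
  rw [(h.inducedMetric_isSmoothMetric hlam hD hΞ).lower_curv hy, h.metric.lower_curv hy]
  have e1 : ∀ i l k j : Fin 3,
      dotCov (inducedMetric G) y
        (fun a => christoffelFirst {y | bdryPt y ∈ U} (inducedMetric G) a i l y)
        (fun a => christoffelFirst {y | bdryPt y ∈ U} (inducedMetric G) a k j y)
      = dotCov G (bdryPt y) (fun a => christoffelFirst U G a i.succ l.succ (bdryPt y))
        (fun a => christoffelFirst U G a k.succ j.succ (bdryPt y))
        - (friedrichScalar U G Ξ (bdryPt y) / dComp U Ξ (bdryPt y) 0) ^ 2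
            / (G (bdryPt y))⁻¹ 0 0
          * (inducedMetric G y i l * inducedMetric G y k j) := by
    intro i l k j
    simp_rw [h.christoffelFirst_inducedMetric hD hy]
    rw [dotCov_inducedMetric h.metric hy hN
      (fun a => christoffelFirst U G a i.succ l.succ (bdryPt y))
      (fun a => christoffelFirst U G a k.succ j.succ (bdryPt y))]
    have e : ∀ i j : Fin 3, sharp G (bdryPt y)
        (fun a => christoffelFirst U G a i.succ j.succ (bdryPt y)) 0
        = christoffel U G 0 i.succ j.succ (bdryPt y) :=
      fun i j => (christoffel_eq_sum_first 0 _ _ _).symm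
    rw [e, e, h.christoffel_zero hlam hD hΞ hy, h.christoffel_zero hlam hD hΞ hy]
    simp only [inducedMetric, Matrix.of_apply]
    ring
  have e2 : ∀ i k j : Fin 3,
      pd {y | bdryPt y ∈ U} i (christoffelFirst {y | bdryPt y ∈ U} (inducedMetric G) l k j) y
        = pd U i.succ (christoffelFirst U G l.succ k.succ j.succ) (bdryPt y) := by
    intro i k j
    rw [pd_congr (U := {y | bdryPt y ∈ U})
      (fun z hz => h.christoffelFirst_inducedMetric hD hz l k j) hy]
    exact pd_comp_bdryPt hD (h.metric.smooth_first l.succ k.succ j.succ) hy i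
  rw [e1, e1, e2, e2]
  ring

omit hlam hD in
/-- On the boundary the normal components of the curvature are determined by `H` and `ds`: the
covariant derivative of `∇∇Ξ = -Ξ H + s g`, skew-symmetrised by the Ricci identity, involves no
derivative of `H` where `Ξ = 0`. -/
lemma sum_curv_mul_dComp (hy : bdryPt y ∈ U) (i j k : Fin 4) :
    ∑ d, curv U G d i k j (bdryPt y) * dComp U Ξ (bdryPt y) d
      = dComp U Ξ (bdryPt y) k * smoothH U G Ξ F j i (bdryPt y)
        - dComp U Ξ (bdryPt y) j * smoothH U G Ξ F k i (bdryPt y)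
        - pd U k (friedrichScalar U G Ξ) (bdryPt y) * G (bdryPt y) j i
        + pd U j (friedrichScalar U G Ξ) (bdryPt y) * G (bdryPt y) k i := by
  have h1 := h.metric.ricci_identity hy h.smooth_factor i j k
  have e1 : ∀ k j, pd U k (nablaCovector U G (dComp U Ξ) j i) (bdryPt y)
      = -dComp U Ξ (bdryPt y) k * smoothH U G Ξ F j i (bdryPt y)
        + pd U k (friedrichScalar U G Ξ) (bdryPt y) * G (bdryPt y) j i
        + friedrichScalar U G Ξ (bdryPt y) * pd U k (fun y => G y j i) (bdryPt y) := by
    intro k j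
    have hu := h.metric.uniqueDiff
    rw [pd_congr (fun z hz => h.hessian hz j i) hy,
      pd_add hu hy (h.smooth_factor.neg.mul (h.smooth_smoothH j i))
        (h.smooth_friedrichScalar.mul (h.metric.smooth j i)),
      pd_mul hu hy h.smooth_factor.neg (h.smooth_smoothH j i),
      pd_mul hu hy h.smooth_friedrichScalar (h.metric.smooth j i), pd_neg hu hy, hΞ y hy]
    unfold dComp
    ring
  rw [e1, e1] at h1
  simp_rw [h.hessian hy, hΞ y hy] at h1
  have e2 : ∀ k j, ∑ m, christoffel U G m k i (bdryPt y)
        * (-0 * smoothH U G Ξ F j m (bdryPt y)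
          + friedrichScalar U G Ξ (bdryPt y) * G (bdryPt y) j m)
      = friedrichScalar U G Ξ (bdryPt y) * christoffelFirst U G j k i (bdryPt y) := by
    intro k j
    rw [← h.metric.lower_christoffel hy, Finset.mul_sum]
    exact Finset.sum_congr rfl fun m _ => by ring
  rw [e2, e2, h.metric.pd_metric_first hy, h.metric.pd_metric_first hy,
    IsSmoothMetric.first_symm hy h.metric.symm i k j] at h1
  linarith

end IsLocalExtension

end Boundary

/-! ### Conformal geodesics of the boundary -/

section Boundary

open AdSLikeExtension

variable {ι : Type*} [Fintype ι] {U : Set (Coord 4)}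
  {G : Coord 4 → Matrix (Fin 4) (Fin 4) ℝ} {Ξ : Coord 4 → ℝ} {lam : ℝ}
  {F : ι → Coord 4 → Fin 4 → Fin 4 → ℝ} {y : Coord 3}

namespace IsLocalExtension

variable (h : IsLocalExtension U G Ξ lam F) (hlam : 0 < lam)
  (hD : IsOpen {y | bdryPt y ∈ U}) (hΞ : ∀ y, bdryPt y ∈ U → Ξ (bdryPt y) = 0)
include h hlam hD hΞ

/-- The Ricci tensor of the boundary metric: the Gauss equation expresses its difference from the
Ricci tensor of `g` by the umbilicity factor, and the normal components of the curvature are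
known. -/
lemma ricci_inducedMetric (hy : bdryPt y ∈ U) (i j : Fin 3) :
    ricci {y | bdryPt y ∈ U} (inducedMetric G) i j y
      = ricci U G i.succ j.succ (bdryPt y)
        - smoothH U G Ξ F j.succ i.succ (bdryPt y)
        + (2 * ((friedrichScalar U G Ξ (bdryPt y) / dComp U Ξ (bdryPt y) 0) ^ 2
            / (G (bdryPt y))⁻¹ 0 0)
          + (∑ k, (G (bdryPt y))⁻¹ k 0 * pd U k (friedrichScalar U G Ξ) (bdryPt y))
            / ((G (bdryPt y))⁻¹ 0 0 * dComp U Ξ (bdryPt y) 0)) * inducedMetric G y i j := by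
  have hN := h.inv_zero_zero_ne hlam hD hΞ hy
  have hξ := h.dComp_zero_ne hlam hD hΞ hy
  have hl := h.inducedMetric_isSmoothMetric hlam hD hΞ
  set ρ := (friedrichScalar U G Ξ (bdryPt y) / dComp U Ξ (bdryPt y) 0) ^ 2
            / (G (bdryPt y))⁻¹ 0 0 with hρ
  set gi := (G (bdryPt y))⁻¹ with hgi
  set ξ := dComp U Ξ (bdryPt y) 0 with hξd
  have e1 : ricci {y | bdryPt y ∈ U} (inducedMetric G) i j y
      = ∑ k : Fin 3, ∑ l : Fin 3, (inducedMetric G y)⁻¹ k l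
          * ∑ a, G (bdryPt y) l.succ a * curv U G a i.succ k.succ j.succ (bdryPt y)
        + ρ * (∑ k : Fin 3, ∑ l : Fin 3, (inducedMetric G y)⁻¹ k l
          * (inducedMetric G y k l * inducedMetric G y i j)
          - ∑ k : Fin 3, ∑ l : Fin 3, (inducedMetric G y)⁻¹ k l
          * (inducedMetric G y j l * inducedMetric G y i k)) := by
    rw [ricci_eq_sum_curv]
    have : ∀ k, curv {y | bdryPt y ∈ U} (inducedMetric G) k i k j y
        = ∑ l, (inducedMetric G y)⁻¹ k l
          * (∑ a, G (bdryPt y) l.succ a * curv U G a i.succ k.succ j.succ (bdryPt y)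
            + ρ * (inducedMetric G y k l * inducedMetric G y i j
            - inducedMetric G y j l * inducedMetric G y i k)) := by
      intro k
      rw [hl.curv_eq_raise hy]
      refine Finset.sum_congr rfl fun l _ => ?_
      rw [h.lower_curv_inducedMetric hlam hD hΞ hy]
    simp_rw [this, mul_add, mul_sub, Finset.sum_add_distrib, Finset.mul_sum,
      ← Finset.sum_sub_distrib]
    congr 1
    exact Finset.sum_congr rfl fun k _ => Finset.sum_congr rfl fun l _ => by ring
  have e2 : ∑ k : Fin 3, ∑ l : Fin 3, (inducedMetric G y)⁻¹ k l
          * (inducedMetric G y k l * inducedMetric G y i j) = 3 * inducedMetric G y i j := by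
    have := hl.trace_metric hy
    unfold trace at this
    simp_rw [← mul_assoc, ← Finset.sum_mul, this]
    norm_num
  have e3 : ∑ k : Fin 3, ∑ l : Fin 3, (inducedMetric G y)⁻¹ k l
          * (inducedMetric G y j l * inducedMetric G y i k) = inducedMetric G y i j := by
    have : ∀ k, ∑ l, (inducedMetric G y)⁻¹ k l
          * (inducedMetric G y j l * inducedMetric G y i k)
        = (if k = j then 1 else 0) * inducedMetric G y i k := by
      intro k
      rw [← hl.inv_mul hy k j, Finset.sum_mul]
      refine Finset.sum_congr rfl fun l _ => ?_
      rw [hl.symm y hy j l]; ring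
    simp_rw [this]
    simp
  have e4 : ∑ k : Fin 3, ∑ l : Fin 3, (inducedMetric G y)⁻¹ k l
          * ∑ a, G (bdryPt y) l.succ a * curv U G a i.succ k.succ j.succ (bdryPt y)
      = ricci U G i.succ j.succ (bdryPt y)
        - (∑ k, gi k 0 * curv U G 0 i.succ k j.succ (bdryPt y)) / gi 0 0 := by
    have := sum_inducedMetric_inv h.metric hy hN
      (fun k l => ∑ a, G (bdryPt y) l a * curv U G a i.succ k j.succ (bdryPt y))
    rw [this]
    congr 1
    · rw [ricci_eq_sum_curv]
      unfold trace
      exact Finset.sum_congr rfl fun k _ => (h.metric.curv_eq_raise hy k i.succ k j.succ).symm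
    · congr 1
      refine Finset.sum_congr rfl fun k _ => ?_
      rw [h.metric.curv_eq_raise hy 0, Finset.mul_sum]
      refine Finset.sum_congr rfl fun l _ => ?_
      rw [h.metric.inv_symm hy 0 l]; ring
  -- the normal components of the curvature
  have e5 : (∑ k, gi k 0 * curv U G 0 i.succ k j.succ (bdryPt y)) * ξ
      = gi 0 0 * ξ * smoothH U G Ξ F j.succ i.succ (bdryPt y)
        - (∑ k, gi k 0 * pd U k (friedrichScalar U G Ξ) (bdryPt y))
          * inducedMetric G y i j := by
    have hk : ∀ k, curv U G 0 i.succ k j.succ (bdryPt y) * ξ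
        = dComp U Ξ (bdryPt y) k * smoothH U G Ξ F j.succ i.succ (bdryPt y)
        - pd U k (friedrichScalar U G Ξ) (bdryPt y) * G (bdryPt y) j.succ i.succ
        + pd U j.succ (friedrichScalar U G Ξ) (bdryPt y) * G (bdryPt y) k i.succ := by
      intro k
      have h1 := h.sum_curv_mul_dComp hΞ hy i.succ j.succ k
      rw [Fin.sum_univ_succ] at h1
      simp_rw [h.dComp_succ hD hΞ hy] at h1
      simp only [mul_zero, Finset.sum_const_zero, add_zero, zero_mul, sub_zero] at h1
      exact h1
    have h2 : ∑ k, gi k 0 * dComp U Ξ (bdryPt y) k = gi 0 0 * ξ := by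
      rw [Fin.sum_univ_succ]
      simp_rw [h.dComp_succ hD hΞ hy]
      simp [hξd]
    have h3 : ∑ k, gi k 0 * G (bdryPt y) k i.succ = 0 := by
      have := h.metric.inv_mul hy 0 i.succ
      rw [if_neg (Fin.succ_ne_zero i).symm] at this
      rw [← this]
      exact Finset.sum_congr rfl fun k _ => by rw [h.metric.inv_symm hy 0 k]
    have h4 : G (bdryPt y) j.succ i.succ = inducedMetric G y i j :=
      h.metric.symm _ hy _ _
    rw [h4] at hk
    rw [Finset.sum_mul]
    simp_rw [mul_assoc, hk, mul_add, mul_sub, Finset.sum_add_distrib, Finset.sum_sub_distrib]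
    have h5 : ∑ k, gi k 0 * (pd U j.succ (friedrichScalar U G Ξ) (bdryPt y)
        * G (bdryPt y) k i.succ) = 0 := by
      rw [← mul_zero (pd U j.succ (friedrichScalar U G Ξ) (bdryPt y)), ← h3, Finset.mul_sum]
      exact Finset.sum_congr rfl fun k _ => by ring
    rw [h5]
    simp_rw [← mul_assoc, ← Finset.sum_mul]
    rw [h2]
    ring
  rw [e1, e2, e3, e4]
  have e6 : (∑ k, gi k 0 * curv U G 0 i.succ k j.succ (bdryPt y)) / gi 0 0
      = smoothH U G Ξ F j.succ i.succ (bdryPt y)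
        - (∑ k, gi k 0 * pd U k (friedrichScalar U G Ξ) (bdryPt y)) / (gi 0 0 * ξ)
          * inducedMetric G y i j := by
    field_simp
    linear_combination e5
  rw [e6]
  ring

/-- On the boundary, `H` differs from the Schouten tensor of the induced metric only by a multiple
of that metric. With the umbilicity factor `κ = s / ∂₀Ξ` the multiple is `κ² / (2 g⁰⁰)`. The equation
`∇s = -H(·,∇Ξ)` accounts for the derivatives of `s` in the Gauss equation. -/
theorem schouten_inducedMetric (hy : bdryPt y ∈ U) (i j : Fin 3) :
    schouten {y | bdryPt y ∈ U} (inducedMetric G) i j y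
      = smoothH U G Ξ F i.succ j.succ (bdryPt y)
        + (1 / 2) * ((friedrichScalar U G Ξ (bdryPt y) / dComp U Ξ (bdryPt y) 0) ^ 2
            / (G (bdryPt y))⁻¹ 0 0) * inducedMetric G y i j := by
  have hN := h.inv_zero_zero_ne hlam hD hΞ hy
  have hξ := h.dComp_zero_ne hlam hD hΞ hy
  have hl := h.inducedMetric_isSmoothMetric hlam hD hΞ
  have hric := h.ricci_inducedMetric hlam hD hΞ hy
  set ρ := (friedrichScalar U G Ξ (bdryPt y) / dComp U Ξ (bdryPt y) 0) ^ 2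
            / (G (bdryPt y))⁻¹ 0 0 with hρ
  set σ := (∑ k, (G (bdryPt y))⁻¹ k 0 * pd U k (friedrichScalar U G Ξ) (bdryPt y))
            / ((G (bdryPt y))⁻¹ 0 0 * dComp U Ξ (bdryPt y) 0) with hσ
  set R := scalarCurv U G (bdryPt y) with hR
  have hH : ∀ i j, ricci U G i j (bdryPt y)
      = 2 * smoothH U G Ξ F i j (bdryPt y) + R / 6 * G (bdryPt y) i j := by
    intro i j
    unfold smoothH schouten
    rw [hΞ y hy, ← hR]
    push_cast; ring
  have hric' : ∀ i j : Fin 3, ricci {y | bdryPt y ∈ U} (inducedMetric G) i j y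
      = smoothH U G Ξ F i.succ j.succ (bdryPt y)
        + (R / 6 + 2 * ρ + σ) * inducedMetric G y i j := by
    intro i j
    rw [hric, hH, h.smoothH_symm hy j.succ i.succ]
    simp only [inducedMetric, Matrix.of_apply]
    ring
  have htr : ∑ k : Fin 3, ∑ l : Fin 3, (inducedMetric G y)⁻¹ k l
      * smoothH U G Ξ F k.succ l.succ (bdryPt y) = R / 6 + σ := by
    rw [sum_inducedMetric_inv h.metric hy hN (fun k l => smoothH U G Ξ F k l (bdryPt y)),
      h.trace_smoothH hy, hσ]
    have e : ∑ k, (G (bdryPt y))⁻¹ k 0 * pd U k (friedrichScalar U G Ξ) (bdryPt y)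
        = -(∑ k, ∑ l, (G (bdryPt y))⁻¹ k 0 * (G (bdryPt y))⁻¹ l 0
          * smoothH U G Ξ F k l (bdryPt y)) * dComp U Ξ (bdryPt y) 0 := by
      rw [neg_mul, Finset.sum_mul, ← Finset.sum_neg_distrib]
      refine Finset.sum_congr rfl fun k _ => ?_
      rw [h.pd_friedrichScalar hy, h.dotCov_dComp hD hΞ hy]
      unfold sharp
      rw [mul_neg, neg_inj, Finset.sum_mul, Finset.mul_sum, Finset.sum_mul]
      refine Finset.sum_congr rfl fun l _ => ?_
      rw [h.metric.inv_symm hy 0 l]; ring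
    rw [e, ← hR]
    field_simp
    ring
  have hsc : scalarCurv {y | bdryPt y ∈ U} (inducedMetric G) y
      = 4 * (R / 6 + σ) + 6 * ρ := by
    have e : scalarCurv {y | bdryPt y ∈ U} (inducedMetric G) y
        = trace (inducedMetric G) y
          (fun i j => ricci {y | bdryPt y ∈ U} (inducedMetric G) i j y) := rfl
    rw [e]
    simp_rw [hric']
    rw [trace_add, trace_mul_metric hl hy]
    have : trace (inducedMetric G) y
        (fun i j => smoothH U G Ξ F i.succ j.succ (bdryPt y)) = R / 6 + σ := htr
    rw [this]
    push_cast; ring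
  unfold schouten
  rw [hsc, hric']
  push_cast
  ring

/-- A solution of the conformal curve equations in the boundary with `⟨b, ∇Ξ⟩ = -s` solves the
conformal geodesic equations of the induced metric. The condition says that the normal component of
`b♯` is `-κ`. In the equation of the velocity the normal part of `∇_z z` is therefore that of
`g(z,z) b♯`. In the equation of the covector the second fundamental form contributes
`(κ² / g⁰⁰) z♭`, and this makes up for the normal component of `b` in `-½ g♯(b,b) z♭` and for the
difference between `H` and the Schouten tensor, which contribute half of it each. -/
theorem conformalCurveEqAt_inducedMetric {H : Coord 4 → Fin 4 → Fin 4 → ℝ} {J : Set ℝ}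
    {x : ℝ → Coord 4} {z b : ℝ → Fin 4 → ℝ} {τ : ℝ}
    (hc : ConformalCurveEqAt U G H J x z b τ)
    (hH : ∀ i k, H (x τ) i k = smoothH U G Ξ F i k (x τ))
    (hx : x τ ∈ U) (hx0 : x τ 0 = 0) (hz : pair (dComp U Ξ (x τ)) (z τ) = 0)
    (hb : obstruction U G Ξ (x τ) (b τ) = 0) :
    ConformalCurveEqAt {y | bdryPt y ∈ U} (inducedMetric G)
      (fun y i j => schouten {y | bdryPt y ∈ U} (inducedMetric G) i j y) J
      (fun t => WithLp.toLp 2 (fun i : Fin 3 => x t i.succ))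
      (fun t i => z t i.succ) (fun t i => b t i.succ) τ := by
  obtain ⟨y, hyx⟩ : ∃ y, bdryPt y = x τ :=
    ⟨WithLp.toLp 2 (fun i : Fin 3 => x τ i.succ), by
      ext k; refine Fin.cases ?_ (fun j => ?_) k
      · simp [bdryPt, hx0]
      · simp [bdryPt]⟩
  have hyτ : (WithLp.toLp 2 (fun i : Fin 3 => x τ i.succ) : Coord 3) = y := by
    ext j; simp [← hyx, bdryPt]
  have hy : bdryPt y ∈ U := by rw [hyx]; exact hx
  have hN := h.inv_zero_zero_ne hlam hD hΞ hy
  have hξ := h.dComp_zero_ne hlam hD hΞ hy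
  rw [← hyx, h.pair_dComp hD hΞ hy] at hz
  have hz0 : z τ 0 = 0 := (mul_eq_zero.1 hz).resolve_left hξ
  set κ := friedrichScalar U G Ξ (bdryPt y) / dComp U Ξ (bdryPt y) 0 with hκ
  have hb0 : sharp G (bdryPt y) (b τ) 0 = -κ := by
    unfold obstruction at hb
    rw [← hyx, h.dotCov_dComp hD hΞ hy] at hb
    rw [hκ]; field_simp; linarith
  have hΓ := h.christoffel_inducedMetric hlam hD hΞ hy
  have hΓ0 := h.christoffel_zero hlam hD hΞ hy
  rw [← hκ] at hΓ0
  -- products of tangential vectors agree with those of the boundary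
  have hpair : pair (fun i : Fin 3 => b τ i.succ) (fun i => z τ i.succ) = pair (b τ) (z τ) := by
    unfold pair; rw [Fin.sum_univ_succ (n := 3), hz0]; simp
  have hflat : ∀ k : Fin 3, flat (inducedMetric G) y (fun i => z τ i.succ) k
      = flat G (bdryPt y) (z τ) k.succ := by
    intro k; unfold flat; rw [Fin.sum_univ_succ (n := 3), hz0]; simp [inducedMetric]
  have hdot : dotVec (inducedMetric G) y (fun i => z τ i.succ) (fun i => z τ i.succ)
      = dotVec G (bdryPt y) (z τ) (z τ) := by
    rw [dotVec_eq_pair_flat, dotVec_eq_pair_flat]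
    unfold pair
    rw [Fin.sum_univ_succ (n := 3), hz0]
    simp_rw [hflat]
    simp
  have hsharp := sharp_inducedMetric h.metric hy hN (b τ)
  have hdc := dotCov_inducedMetric h.metric hy hN (b τ) (b τ)
  rw [hb0] at hdc
  have hflat' : ∀ k : Fin 3, ∑ i : Fin 3, G (bdryPt y) i.succ k.succ * z τ i.succ
      = flat G (bdryPt y) (z τ) k.succ := by
    intro k
    unfold flat
    rw [Fin.sum_univ_succ (n := 3), hz0, mul_zero, zero_add]
    exact Finset.sum_congr rfl fun i _ => by rw [h.metric.symm _ hy]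
  refine ⟨fun k => hc.position k.succ, fun k => ?_, fun k => ?_⟩
  · refine (hc.velocity k.succ).congr_deriv ?_
    simp only [hyτ]
    simp only [← hyx]
    rw [hpair, hdot, hsharp, hb0]
    simp_rw [hΓ, hΓ0]
    have e1 : ∑ i, ∑ j, christoffel U G k.succ i j (bdryPt y) * z τ i * z τ j
        = ∑ i : Fin 3, ∑ j : Fin 3, christoffel U G k.succ i.succ j.succ (bdryPt y)
          * z τ i.succ * z τ j.succ := by
      rw [Fin.sum_univ_succ (n := 3), hz0]
      simp only [mul_zero, zero_mul, Finset.sum_const_zero, zero_add]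
      refine Finset.sum_congr rfl fun i _ => ?_
      rw [Fin.sum_univ_succ (n := 3), hz0]
      simp
    have e2 : ∑ i : Fin 3, ∑ j : Fin 3,
        (christoffel U G k.succ i.succ j.succ (bdryPt y)
          - (G (bdryPt y))⁻¹ k.succ 0 / (G (bdryPt y))⁻¹ 0 0
            * (-κ * G (bdryPt y) i.succ j.succ)) * z τ i.succ * z τ j.succ
        = ∑ i : Fin 3, ∑ j : Fin 3, christoffel U G k.succ i.succ j.succ (bdryPt y)
          * z τ i.succ * z τ j.succ
        + (G (bdryPt y))⁻¹ k.succ 0 / (G (bdryPt y))⁻¹ 0 0 * κ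
          * dotVec G (bdryPt y) (z τ) (z τ) := by
      rw [← hdot]
      unfold dotVec
      simp_rw [Finset.mul_sum, ← Finset.sum_add_distrib]
      refine Finset.sum_congr rfl fun i _ => Finset.sum_congr rfl fun j _ => ?_
      simp only [inducedMetric, Matrix.of_apply]
      ring
    rw [e1, e2]
    ring
  · refine (hc.covector k.succ).congr_deriv ?_
    simp only [hyτ, hH]
    simp only [← hyx]
    rw [hpair, hdc, hflat]
    simp_rw [h.schouten_inducedMetric hlam hD hΞ hy, ← hκ, hΓ, hΓ0]
    have e1 : ∑ i, ∑ j, christoffel U G j i k.succ (bdryPt y) * z τ i * b τ j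
        = -κ * b τ 0 * flat G (bdryPt y) (z τ) k.succ
          + ∑ i : Fin 3, ∑ j : Fin 3, christoffel U G j.succ i.succ k.succ (bdryPt y)
          * z τ i.succ * b τ j.succ := by
      rw [Fin.sum_univ_succ (n := 3), hz0]
      simp only [mul_zero, zero_mul, Finset.sum_const_zero, zero_add]
      rw [← hflat', Finset.mul_sum, ← Finset.sum_add_distrib]
      refine Finset.sum_congr rfl fun i _ => ?_
      rw [Fin.sum_univ_succ (n := 3), hΓ0]
      ring
    have e2 : ∑ i : Fin 3, ∑ j : Fin 3,
        (christoffel U G j.succ i.succ k.succ (bdryPt y)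
          - (G (bdryPt y))⁻¹ j.succ 0 / (G (bdryPt y))⁻¹ 0 0
            * (-κ * G (bdryPt y) i.succ k.succ)) * z τ i.succ * b τ j.succ
        = ∑ i : Fin 3, ∑ j : Fin 3, christoffel U G j.succ i.succ k.succ (bdryPt y)
          * z τ i.succ * b τ j.succ
        + (∑ j : Fin 3, (G (bdryPt y))⁻¹ j.succ 0 * b τ j.succ) / (G (bdryPt y))⁻¹ 0 0 * κ
          * flat G (bdryPt y) (z τ) k.succ := by
      rw [← hflat', Finset.mul_sum, ← Finset.sum_add_distrib]
      refine Finset.sum_congr rfl fun i _ => ?_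
      rw [Finset.sum_div, Finset.sum_mul, Finset.sum_mul, ← Finset.sum_add_distrib]
      refine Finset.sum_congr rfl fun j _ => ?_
      ring
    have e3 : ∑ j : Fin 3, (G (bdryPt y))⁻¹ j.succ 0 * b τ j.succ
        = -κ - (G (bdryPt y))⁻¹ 0 0 * b τ 0 := by
      rw [← hb0]
      unfold sharp
      rw [Fin.sum_univ_succ (n := 3)]
      rw [add_sub_cancel_left]
      exact Finset.sum_congr rfl fun j _ => by rw [h.metric.inv_symm hy 0 j.succ]
    have e4 : ∑ i, smoothH U G Ξ F i k.succ (bdryPt y) * z τ i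
        = ∑ i : Fin 3, smoothH U G Ξ F i.succ k.succ (bdryPt y) * z τ i.succ := by
      rw [Fin.sum_univ_succ (n := 3), hz0]; simp
    have e5 : ∑ i : Fin 3, (smoothH U G Ξ F i.succ k.succ (bdryPt y)
        + 1 / 2 * (κ ^ 2 / (G (bdryPt y))⁻¹ 0 0) * inducedMetric G y i k) * z τ i.succ
        = ∑ i : Fin 3, smoothH U G Ξ F i.succ k.succ (bdryPt y) * z τ i.succ
          + 1 / 2 * (κ ^ 2 / (G (bdryPt y))⁻¹ 0 0) * flat G (bdryPt y) (z τ) k.succ := by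
      rw [← hflat', Finset.mul_sum, ← Finset.sum_add_distrib]
      refine Finset.sum_congr rfl fun i _ => ?_
      simp only [inducedMetric, Matrix.of_apply]
      ring
    rw [e1, e2, e3, e4, e5]
    field_simp
    ring

end IsLocalExtension

end Boundary

/-! ### Charts of a four-manifold with boundary -/

section Charts

variable {M : Type*} [TopologicalSpace M] [ChartedSpace (EuclideanHalfSpace 4) M]

lemma pt_mem_source {c : M} {x : Coord 4} (hx : x ∈ dom c) :
    pt c x ∈ (extChartAt (𝓡∂ 4) c).source := (extChartAt (𝓡∂ 4) c).map_target hx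

lemma ext_pt {c : M} {x : Coord 4} (hx : x ∈ dom c) :
    extChartAt (𝓡∂ 4) c (pt c x) = x := (extChartAt (𝓡∂ 4) c).right_inv hx

lemma pt_ext {c q : M} (hq : q ∈ (extChartAt (𝓡∂ 4) c).source) :
    pt c (extChartAt (𝓡∂ 4) c q) = q := (extChartAt (𝓡∂ 4) c).left_inv hq

lemma ext_mem_dom {c q : M} (hq : q ∈ (extChartAt (𝓡∂ 4) c).source) :
    extChartAt (𝓡∂ 4) c q ∈ dom c := (extChartAt (𝓡∂ 4) c).map_source hq

lemma nonneg_of_mem_dom {c : M} {x : Coord 4} (hx : x ∈ dom c) : 0 ≤ x 0 := by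
  have := extChartAt_target_subset_range c hx
  rw [range_modelWithCornersEuclideanHalfSpace] at this
  exact this

lemma dom_mem_nhdsWithin {c : M} {x : Coord 4} (hx : x ∈ dom c) :
    dom c ∈ 𝓝[range (𝓡∂ 4)] x := extChartAt_target_mem_nhdsWithin_of_mem hx

lemma mem_interior_dom_iff {c : M} {x : Coord 4} (hx : x ∈ dom c) :
    x ∈ interior (dom c) ↔ 0 < x 0 := by
  have hr := interior_range_modelWithCornersEuclideanHalfSpace 4
  constructor
  · intro h
    have h1 := interior_mono (extChartAt_target_subset_range c) h
    rw [hr] at h1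
    exact h1
  · intro h
    have h1 : x ∈ interior (range (𝓡∂ 4)) := by rw [hr]; exact h
    rw [mem_interior_iff_mem_nhds] at h1 ⊢
    have h2 := dom_mem_nhdsWithin hx
    rwa [nhdsWithin_eq_nhds.2 h1] at h2

lemma isOpen_bdryDom (c : M) : IsOpen (AdSLikeExtension.bdryDom c) := by
  rw [isOpen_iff_mem_nhds]
  intro y hy
  have h1 := dom_mem_nhdsWithin (c := c) hy
  have h2 : Tendsto AdSLikeExtension.bdryPt (𝓝 y)
      (𝓝[range (𝓡∂ 4)] (AdSLikeExtension.bdryPt y)) := by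
    refine tendsto_nhdsWithin_iff.2 ⟨bdryInclusion.continuous.tendsto y, ?_⟩
    refine Eventually.of_forall fun z => ?_
    rw [range_modelWithCornersEuclideanHalfSpace]
    exact le_refl (0 : ℝ)
  exact h2 h1

variable [IsManifold (𝓡∂ 4) ∞ M]

lemma isInteriorPoint_pt_iff {c : M} {x : Coord 4} (hx : x ∈ dom c) :
    (𝓡∂ 4).IsInteriorPoint (pt c x) ↔ 0 < x 0 := by
  have hs : pt c x ∈ (chartAt (EuclideanHalfSpace 4) c).source := by
    rw [← extChartAt_source (𝓡∂ 4)]; exact pt_mem_source hx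
  rw [ModelWithCorners.isInteriorPoint_iff_of_mem_atlas (n := ∞) (by simp)
    (chart_mem_atlas (EuclideanHalfSpace 4) c) hs, ← mem_interior_dom_iff hx]
  have e : ((chartAt (EuclideanHalfSpace 4) c).extend (𝓡∂ 4)) (pt c x) = x := ext_pt hx
  rw [e]; rfl

lemma tangentCoordChange_comp_apply {c d e q : M} (hc : q ∈ (extChartAt (𝓡∂ 4) c).source)
    (hd : q ∈ (extChartAt (𝓡∂ 4) d).source) (he : q ∈ (extChartAt (𝓡∂ 4) e).source)
    (v : Coord 4) :
    tangentCoordChange (𝓡∂ 4) d e q (tangentCoordChange (𝓡∂ 4) c d q v)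
      = tangentCoordChange (𝓡∂ 4) c e q v :=
  tangentCoordChange_comp ⟨⟨hc, hd⟩, he⟩

lemma coord_eq_sum_single (v : Coord 4) :
    v = ∑ k, v k • EuclideanSpace.single k (1 : ℝ) := by
  ext j; simp [Finset.sum_apply, Pi.single_apply]

lemma clm_apply_eq_sum {V : Type*} [AddCommGroup V] [Module ℝ V] [TopologicalSpace V]
    (L : Coord 4 →L[ℝ] V) (v : Coord 4) :
    L v = ∑ k, v k • L (EuclideanSpace.single k (1 : ℝ)) := by
  conv_lhs => rw [coord_eq_sum_single v]
  rw [map_sum]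
  exact Finset.sum_congr rfl fun k _ => map_smul _ _ _

/-- A tangent vector is the combination of the coordinate vectors given by its components. -/
lemma eq_sum_vecComp {c q : M} (hq : q ∈ (extChartAt (𝓡∂ 4) c).source)
    (w : TangentSpace (𝓡∂ 4) q) : w = ∑ k, vecComp c q w k • coordVec c q k := by
  have h1 : tangentCoordChange (𝓡∂ 4) c q q (tangentCoordChange (𝓡∂ 4) q c q w) = w :=
    (tangentCoordChange_comp_apply (mem_extChartAt_source q) hq (mem_extChartAt_source q)
      (show Coord 4 from w)).trans (tangentCoordChange_self (mem_extChartAt_source q))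
  have h2 := clm_apply_eq_sum (tangentCoordChange (𝓡∂ 4) c q q)
    (tangentCoordChange (𝓡∂ 4) q c q w)
  rw [h1] at h2
  exact h2

/-- The tangent vector with given components in the chart centred at `c`. -/
def vecOfComp (c q : M) (z : Fin 4 → ℝ) : TangentSpace (𝓡∂ 4) q :=
  tangentCoordChange (𝓡∂ 4) c q q (WithLp.toLp 2 z)

lemma vecComp_vecOfComp {c q : M} (hq : q ∈ (extChartAt (𝓡∂ 4) c).source) (z : Fin 4 → ℝ) :
    vecComp c q (vecOfComp c q z) = z := by
  ext k
  have h1 : tangentCoordChange (𝓡∂ 4) q c q (tangentCoordChange (𝓡∂ 4) c q q (WithLp.toLp 2 z))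
      = WithLp.toLp 2 z := by
    rw [tangentCoordChange_comp_apply hq (mem_extChartAt_source q) hq]
    exact tangentCoordChange_self hq
  exact congrArg (fun v : Coord 4 => v k) h1

lemma vecOfComp_vecComp {c q : M} (hq : q ∈ (extChartAt (𝓡∂ 4) c).source)
    (w : TangentSpace (𝓡∂ 4) q) : vecOfComp c q (vecComp c q w) = w := by
  have h1 : tangentCoordChange (𝓡∂ 4) c q q (tangentCoordChange (𝓡∂ 4) q c q w) = w :=
    (tangentCoordChange_comp_apply (mem_extChartAt_source q) hq (mem_extChartAt_source q)
      (show Coord 4 from w)).trans (tangentCoordChange_self (mem_extChartAt_source q))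
  exact h1

lemma vecComp_coordVec {c q : M} (hq : q ∈ (extChartAt (𝓡∂ 4) c).source) (i : Fin 4) :
    vecComp c q (coordVec c q i) = Pi.single i 1 := by
  have := vecComp_vecOfComp hq (Pi.single i 1)
  exact this

/-- The components of a vector in two charts are related by the derivative of the coordinate
change. -/
lemma vecComp_change {c d q : M} (hc : q ∈ (extChartAt (𝓡∂ 4) c).source)
    (hd : q ∈ (extChartAt (𝓡∂ 4) d).source) (w : TangentSpace (𝓡∂ 4) q) (k : Fin 4) :
    vecComp d q w k
      = (tangentCoordChange (𝓡∂ 4) c d q (WithLp.toLp 2 (vecComp c q w))) k := by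
  have h1 := tangentCoordChange_comp_apply (mem_extChartAt_source q) hc hd
    (show Coord 4 from w)
  exact congrArg (fun v : Coord 4 => v k) h1.symm

lemma form_eq_pair {c q : M} (hq : q ∈ (extChartAt (𝓡∂ 4) c).source)
    (b : TangentSpace (𝓡∂ 4) q →L[ℝ] ℝ) (w : TangentSpace (𝓡∂ 4) q) :
    b w = pair (covComp c q b) (vecComp c q w) := by
  conv_lhs => rw [eq_sum_vecComp hq w]
  rw [map_sum]
  unfold pair covComp
  refine Finset.sum_congr rfl fun k _ => ?_
  rw [map_smul, smul_eq_mul, mul_comm]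

lemma bilin_eq_sum {c q : M} (hq : q ∈ (extChartAt (𝓡∂ 4) c).source)
    (T : TangentSpace (𝓡∂ 4) q →L[ℝ] TangentSpace (𝓡∂ 4) q →L[ℝ] ℝ)
    (u w : TangentSpace (𝓡∂ 4) q) :
    T u w = ∑ i, ∑ j, T (coordVec c q i) (coordVec c q j) * vecComp c q u i * vecComp c q w j := by
  conv_lhs => rw [eq_sum_vecComp hq u]
  rw [map_sum, sum_apply]
  refine Finset.sum_congr rfl fun i _ => ?_
  rw [map_smul, smul_apply, smul_eq_mul, form_eq_pair hq (T (coordVec c q i)) w]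
  unfold pair covComp
  rw [Finset.mul_sum]
  refine Finset.sum_congr rfl fun j _ => ?_
  ring

end Charts

/-! ### Orthonormal frames -/

section Frames

variable {V : Type*} [AddCommGroup V] [Module ℝ V] [TopologicalSpace V]

lemma linearIndependent_of_orthogonal {h : V →L[ℝ] V →L[ℝ] ℝ} {e : Fin 4 → V}
    (h0 : ∀ a b, a ≠ b → h (e a) (e b) = 0) (h1 : ∀ a, h (e a) (e a) ≠ 0) :
    LinearIndependent ℝ e := by
  rw [Fintype.linearIndependent_iff]
  intro c hc a
  have h2 : h (∑ b, c b • e b) (e a) = 0 := by rw [hc]; simp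
  rw [map_sum, sum_apply, Finset.sum_eq_single a] at h2
  · rw [map_smul, smul_apply, smul_eq_mul] at h2
    exact (mul_eq_zero.1 h2).resolve_right (h1 a)
  · intro b _ hb
    rw [map_smul, smul_apply, h0 b a hb, smul_zero]
  · simp

lemma IsOrthonormalFrame.apply_ne {h : V →L[ℝ] V →L[ℝ] ℝ} {e : Fin 4 → V}
    (he : IsOrthonormalFrame h e) {a b : Fin 4} (hab : a ≠ b) : h (e a) (e b) = 0 := by
  rw [he, if_neg hab]

lemma IsOrthonormalFrame.apply_self_ne_zero {h : V →L[ℝ] V →L[ℝ] ℝ} {e : Fin 4 → V}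
    (he : IsOrthonormalFrame h e) (a : Fin 4) : h (e a) (e a) ≠ 0 := by
  rw [he, if_pos rfl]
  split_ifs <;> norm_num

lemma IsOrthonormalFrame.linearIndependent {h : V →L[ℝ] V →L[ℝ] ℝ} {e : Fin 4 → V}
    (he : IsOrthonormalFrame h e) : LinearIndependent ℝ e :=
  linearIndependent_of_orthogonal (fun _ _ => he.apply_ne) he.apply_self_ne_zero

omit [TopologicalSpace V] in
lemma exists_eq_sum_of_linearIndependent {q : ℕ} (hV : Module.finrank ℝ V = q) {e : Fin q → V}
    [FiniteDimensional ℝ V] (he : LinearIndependent ℝ e) (w : V) :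
    ∃ c : Fin q → ℝ, w = ∑ a, c a • e a := by
  have hs : Submodule.span ℝ (range e) = ⊤ :=
    he.span_eq_top_of_card_eq_finrank' (by simp [hV])
  have : w ∈ Submodule.span ℝ (range e) := by rw [hs]; trivial
  obtain ⟨c, hc⟩ := (Submodule.mem_span_range_iff_exists_fun ℝ).1 this
  exact ⟨c, hc.symm⟩

/-- A bilinear form with an orthonormal frame is nondegenerate. -/
lemma IsOrthonormalFrame.eq_zero [FiniteDimensional ℝ V] (hV : Module.finrank ℝ V = 4)
    {h : V →L[ℝ] V →L[ℝ] ℝ} {e : Fin 4 → V} (he : IsOrthonormalFrame h e) {w : V}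
    (hw : ∀ u, h w u = 0) : w = 0 := by
  obtain ⟨c, hc⟩ := exists_eq_sum_of_linearIndependent hV he.linearIndependent w
  rw [hc]
  refine Finset.sum_eq_zero fun a _ => ?_
  have h2 := hw (e a)
  rw [hc, map_sum, sum_apply, Finset.sum_eq_single a] at h2
  · rw [map_smul, smul_apply, smul_eq_mul] at h2
    rw [(mul_eq_zero.1 h2).resolve_right (he.apply_self_ne_zero a), zero_smul]
  · intro b _ hb
    rw [map_smul, smul_apply, he.apply_ne hb, smul_zero]
  · simp

/-- Every unit spacelike vector is, up to sign, the last vector of an orthonormal frame: a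
reflection carries the last vector of a given frame to it. -/
lemma IsOrthonormalFrame.exists_last {h : V →L[ℝ] V →L[ℝ] ℝ} (hs : ∀ u w, h u w = h w u)
    {e : Fin 4 → V} (he : IsOrthonormalFrame h e) {N : V} (hN : h N N = -1) :
    ∃ e', IsOrthonormalFrame h e' ∧ (e' 3 = N ∨ e' 3 = -N) := by
  have h33 : h (e 3) (e 3) = -1 := by rw [he]; simp
  -- the reflection in the hyperplane orthogonal to `e 3 - N'`
  have refl : ∀ N' : V, h N' N' = -1 → h (e 3 - N') (e 3 - N') ≠ 0 →
      ∃ e', IsOrthonormalFrame h e' ∧ e' 3 = N' := by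
    intro N' hN' hw
    set w := e 3 - N' with hwd
    refine ⟨fun a => e a - (2 * h (e a) w / h w w) • w, fun a b => ?_, ?_⟩
    · rw [← he a b]
      simp only [map_sub, map_smul, sub_apply, smul_apply,
        smul_eq_mul]
      rw [hs w (e b)]
      field_simp
      ring
    · have h1 : h w w = 2 * h (e 3) w := by
        rw [hwd]
        simp only [map_sub, sub_apply]
        rw [h33, hN', hs N' (e 3)]
        ring
      simp only
      rw [← h1, div_self hw, one_smul, hwd]
      abel
  -- `e 3 - N` and `e 3 + N` are not both null, their squares adding up to `-4`
  by_cases h0 : h (e 3 - N) (e 3 - N) = 0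
  · obtain ⟨e', h1, h2⟩ := refl (-N) (by simp [hN]) (by
      intro h1
      simp only [map_sub, map_neg, sub_apply, neg_apply]
        at h0 h1
      rw [h33, hN, hs N (e 3)] at h0 h1
      linarith)
    exact ⟨e', h1, Or.inr h2⟩
  · obtain ⟨e', h1, h2⟩ := refl N hN h0
    exact ⟨e', h1, Or.inl h2⟩

end Frames

/-! ### The conformal extension in a chart -/

namespace AdSLikeExtension

variable {M : Type*} [TopologicalSpace M] [ChartedSpace (EuclideanHalfSpace 4) M]
  [IsManifold (𝓡∂ 4) ∞ M]
  {𝔤 ι : Type*} [LieRing 𝔤] [LieAlgebra ℝ 𝔤] [Fintype ι] {B : Module.Basis ι ℝ 𝔤}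
  (X : AdSLikeExtension M B)

lemma factor_eq_zero_iff {c : M} {x : Coord 4} (hx : x ∈ dom c) :
    X.factor c x = 0 ↔ x 0 = 0 := by
  have h0 := nonneg_of_mem_dom hx
  have hI := isInteriorPoint_pt_iff hx
  constructor
  · intro h
    by_contra h1
    exact (X.Ξ_pos _ (hI.2 (lt_of_le_of_ne h0 (Ne.symm h1)))).ne' h
  · intro h
    refine X.Ξ_zero _ ?_
    rw [← ModelWithCorners.compl_interior]
    intro h1
    exact (hI.1 h1).ne' h

lemma factor_ext {c q : M} (hq : q ∈ (extChartAt (𝓡∂ 4) c).source) :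
    X.factor c (extChartAt (𝓡∂ 4) c q) = X.Ξ q := by
  unfold factor
  rw [pt_ext hq]

lemma metric_ext {c q : M} (hq : q ∈ (extChartAt (𝓡∂ 4) c).source) (i j : Fin 4) :
    X.metric c (extChartAt (𝓡∂ 4) c q) i j = X.g q (coordVec c q i) (coordVec c q j) := by
  change twoComp X.g c (extChartAt (𝓡∂ 4) c q) i j = _
  unfold twoComp
  rw [pt_ext hq]

lemma g_eq_dotVec {c q : M} (hq : q ∈ (extChartAt (𝓡∂ 4) c).source)
    (u w : TangentSpace (𝓡∂ 4) q) :
    X.g q u w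
      = dotVec (X.metric c) (extChartAt (𝓡∂ 4) c q) (vecComp c q u) (vecComp c q w) := by
  rw [bilin_eq_sum hq]
  unfold dotVec
  simp_rw [X.metric_ext hq]

omit [IsManifold (𝓡∂ 4) ∞ M] in
lemma finrank_tangentSpace (q : M) : Module.finrank ℝ (TangentSpace (𝓡∂ 4) q) = 4 := by
  change Module.finrank ℝ (Coord 4) = 4
  simp

instance (q : M) : FiniteDimensional ℝ (TangentSpace (𝓡∂ 4) q) :=
  inferInstanceAs (FiniteDimensional ℝ (Coord 4))

lemma eq_zero_of_g_eq_zero {q : M} {w : TangentSpace (𝓡∂ 4) q} (hw : ∀ u, X.g q w u = 0) :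
    w = 0 := by
  obtain ⟨e, he⟩ := X.g_lorentz q
  exact he.eq_zero (finrank_tangentSpace q) hw

lemma det_metric_ne {c : M} {x : Coord 4} (hx : x ∈ dom c) : (X.metric c x).det ≠ 0 := by
  intro h
  obtain ⟨z, hz0, hz⟩ := Matrix.exists_mulVec_eq_zero_iff.2 h
  have hs := pt_mem_source hx
  have h1 : vecOfComp c (pt c x) z = 0 := by
    refine X.eq_zero_of_g_eq_zero fun u => ?_
    rw [X.g_symm, X.g_eq_dotVec hs, vecComp_vecOfComp hs, ext_pt hx]
    unfold dotVec
    refine Finset.sum_eq_zero fun i _ => ?_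
    have h2 : ∑ j, X.metric c x i j * z j = 0 := congrFun hz i
    calc ∑ j, X.metric c x i j * vecComp c (pt c x) u i * z j
        = vecComp c (pt c x) u i * ∑ j, X.metric c x i j * z j := by
          rw [Finset.mul_sum]
          exact Finset.sum_congr rfl fun j _ => by ring
      _ = 0 := by rw [h2, mul_zero]
  apply hz0
  rw [← vecComp_vecOfComp hs z, h1]
  ext k
  exact congrArg (fun v : Coord 4 => v k) (map_zero (tangentCoordChange (𝓡∂ 4) (pt c x) c (pt c x)))

lemma smooth_factor (c : M) : ContDiffOn ℝ ∞ (X.factor c) (dom c) :=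
  contMDiffOn_iff_contDiffOn.1 (X.Ξ_smooth.comp_contMDiffOn (contMDiffOn_extChartAt_symm c))

lemma isSmoothMetric (c : M) : IsSmoothMetric (dom c) (X.metric c) where
  uniqueDiff := uniqueDiffOn_extChartAt_target c
  subset_closure := extChartAt_target_subset_closure_interior
  smooth := X.g_smooth c
  symm _ _ _ _ := X.g_symm _ _ _
  det_ne _ hy := X.det_metric_ne hy

lemma subset_closure_factor_ne_zero (c : M) :
    dom c ⊆ closure {x | x ∈ dom c ∧ X.factor c x ≠ 0} := by
  intro x hx
  refine closure_mono ?_ (extChartAt_target_subset_closure_interior hx)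
  intro y hy
  have hy' := interior_subset hy
  refine ⟨hy', fun h => ?_⟩
  exact ((mem_interior_dom_iff hy').1 hy).ne' ((X.factor_eq_zero_iff hy').1 h)

lemma isLocalExtension (c : M) : IsLocalExtension (dom c) (X.metric c) (X.factor c) X.lam
    (fun p => twoComp (X.F p) c) where
  metric := X.isSmoothMetric c
  smooth_factor := X.smooth_factor c
  smooth_field p i j := X.F_smooth p c i j
  dense := X.subset_closure_factor_ne_zero c
  einstein x hx h0 := (X.einsteinYangMills c x hx h0).einstein

/-- On `𝓘` the tensor `H`, defined there by a limit, takes the values of its smooth extension. -/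
theorem H_eq_smoothH {c : M} {x : Coord 4} (hx : x ∈ dom c) (i j : Fin 4) :
    X.H c x i j = smoothH (dom c) (X.metric c) (X.factor c) (fun p => twoComp (X.F p) c) i j x := by
  have key : ∀ y ∈ {y | y ∈ dom c ∧ X.factor c y ≠ 0}, X.interiorH c y i j
      = smoothH (dom c) (X.metric c) (X.factor c) (fun p => twoComp (X.F p) c) i j y :=
    fun y hy => ((X.isLocalExtension c).smoothH_eq hy.1 hy.2 i j).symm
  unfold H
  split_ifs with h0
  · have : (𝓝[{y | y ∈ dom c ∧ X.factor c y ≠ 0}] x).NeBot :=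
      mem_closure_iff_nhdsWithin_neBot.1 (X.subset_closure_factor_ne_zero c hx)
    refine Tendsto.limUnder_eq ?_
    have h1 := (((X.isLocalExtension c).smooth_smoothH i j).continuousOn x hx).mono_left
      (nhdsWithin_mono x (show {y | y ∈ dom c ∧ X.factor c y ≠ 0} ⊆ dom c from fun y hy => hy.1))
    exact h1.congr' (by
      filter_upwards [self_mem_nhdsWithin] with y hy using (key y hy).symm)
  · exact key x ⟨hx, h0⟩

theorem smooth_H (c : M) (i j : Fin 4) : ContDiffOn ℝ ∞ (fun x => X.H c x i j) (dom c) :=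
  ((X.isLocalExtension c).smooth_smoothH i j).congr fun _ hx => X.H_eq_smoothH hx i j

lemma dΞ_coordVec {c q : M} (hq : q ∈ (extChartAt (𝓡∂ 4) c).source) (i : Fin 4) :
    X.dΞ q (coordVec c q i) = dComp (dom c) (X.factor c) (extChartAt (𝓡∂ 4) c q) i := by
  have hd : MDifferentiableAt (𝓡∂ 4) 𝓘(ℝ, ℝ) X.Ξ q :=
    (X.Ξ_smooth q).mdifferentiableAt (by simp)
  have h1 : HasFDerivWithinAt (fun y => X.Ξ (pt q y)) (X.dΞ q : Coord 4 →L[ℝ] ℝ)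
      (range (𝓡∂ 4)) (extChartAt (𝓡∂ 4) q q) := hd.hasMFDerivAt.2
  have h2 := hasFDerivWithinAt_tangentCoordChange (I := 𝓡∂ 4) ⟨hq, mem_extChartAt_source q⟩
  have hpt : ((extChartAt (𝓡∂ 4) q) ∘ (extChartAt (𝓡∂ 4) c).symm) (extChartAt (𝓡∂ 4) c q)
      = extChartAt (𝓡∂ 4) q q := congrArg (extChartAt (𝓡∂ 4) q) (pt_ext hq)
  rw [← hpt] at h1
  have h3 := h1.comp (extChartAt (𝓡∂ 4) c q) h2
    (fun y _ => mem_range_self _)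
  have hev : ∀ᶠ y in 𝓝[dom c] (extChartAt (𝓡∂ 4) c q),
      pt c y ∈ (extChartAt (𝓡∂ 4) q).source := by
    have := continuousOn_extChartAt_symm (I := 𝓡∂ 4) c _ (ext_mem_dom hq)
    refine this ?_
    rw [show (extChartAt (𝓡∂ 4) c).symm (extChartAt (𝓡∂ 4) c q) = q from pt_ext hq]
    exact extChartAt_source_mem_nhds q
  have h4 : HasFDerivWithinAt (X.factor c)
      ((X.dΞ q : Coord 4 →L[ℝ] ℝ).comp (tangentCoordChange (𝓡∂ 4) c q q)) (dom c)
      (extChartAt (𝓡∂ 4) c q) := by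
    refine (h3.mono (extChartAt_target_subset_range c)).congr_of_eventuallyEq ?_
      (congrArg X.Ξ ?_)
    · filter_upwards [hev] with y hy
      exact congrArg X.Ξ (pt_ext hy).symm
    · exact (pt_ext (hev.self_of_nhdsWithin (ext_mem_dom hq))).symm
  unfold dComp pd
  rw [h4.fderivWithin (uniqueDiffOn_extChartAt_target c _ (ext_mem_dom hq))]
  rfl

lemma covComp_dΞ {c q : M} (hq : q ∈ (extChartAt (𝓡∂ 4) c).source) :
    covComp c q (X.dΞ q) = dComp (dom c) (X.factor c) (extChartAt (𝓡∂ 4) c q) :=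
  funext fun i => X.dΞ_coordVec hq i

lemma dΞ_eq_pair {c q : M} (hq : q ∈ (extChartAt (𝓡∂ 4) c).source)
    (u : TangentSpace (𝓡∂ 4) q) :
    X.dΞ q u = pair (dComp (dom c) (X.factor c) (extChartAt (𝓡∂ 4) c q)) (vecComp c q u) := by
  rw [form_eq_pair hq, X.covComp_dΞ hq]

/-- The vector `β♯` obtained from a covector by raising its index with the metric `g`. -/
def raise (q : M) (β : TangentSpace (𝓡∂ 4) q →L[ℝ] ℝ) : TangentSpace (𝓡∂ 4) q :=
  vecOfComp q q (sharp (X.metric q) (extChartAt (𝓡∂ 4) q q) (covComp q q β))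

lemma g_raise (q : M) (β : TangentSpace (𝓡∂ 4) q →L[ℝ] ℝ) (u : TangentSpace (𝓡∂ 4) q) :
    X.g q (X.raise q β) u = β u := by
  have hq := mem_extChartAt_source (I := 𝓡∂ 4) q
  rw [X.g_eq_dotVec hq, form_eq_pair hq, raise, vecComp_vecOfComp hq,
    dotVec_sharp (X.isSmoothMetric q) (ext_mem_dom hq)]

lemma eq_of_g_eq {q : M} {w w' : TangentSpace (𝓡∂ 4) q} (h : ∀ u, X.g q w u = X.g q w' u) :
    w = w' := by
  rw [← sub_eq_zero]
  refine X.eq_zero_of_g_eq_zero fun u => ?_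
  rw [map_sub, sub_apply, h, sub_self]

lemma vecComp_raise {c q : M} (hq : q ∈ (extChartAt (𝓡∂ 4) c).source)
    (β : TangentSpace (𝓡∂ 4) q →L[ℝ] ℝ) :
    vecComp c q (X.raise q β)
      = sharp (X.metric c) (extChartAt (𝓡∂ 4) c q) (covComp c q β) := by
  have h : X.raise q β
      = vecOfComp c q (sharp (X.metric c) (extChartAt (𝓡∂ 4) c q) (covComp c q β)) := by
    refine X.eq_of_g_eq fun u => ?_
    rw [X.g_raise, X.g_eq_dotVec hq, form_eq_pair hq, vecComp_vecOfComp hq,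
      dotVec_sharp (X.isSmoothMetric c) (ext_mem_dom hq)]
  rw [h, vecComp_vecOfComp hq]

/-- The gradient `∇ᵃΞ` of the conformal factor, with respect to the metric `g`. -/
def grad (q : M) : TangentSpace (𝓡∂ 4) q := X.raise q (X.dΞ q)

lemma g_grad (q : M) (u : TangentSpace (𝓡∂ 4) q) : X.g q (X.grad q) u = X.dΞ q u :=
  X.g_raise q _ u

lemma apply_grad {c q : M} (hq : q ∈ (extChartAt (𝓡∂ 4) c).source)
    (b : TangentSpace (𝓡∂ 4) q →L[ℝ] ℝ) :
    b (X.grad q) = dotCov (X.metric c) (extChartAt (𝓡∂ 4) c q) (covComp c q b)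
      (dComp (dom c) (X.factor c) (extChartAt (𝓡∂ 4) c q)) := by
  rw [form_eq_pair hq, grad, X.vecComp_raise hq, pair_sharp, X.covComp_dΞ hq]

lemma friedrichScalar_eq_of_ne {c q : M} (hq : q ∈ (extChartAt (𝓡∂ 4) c).source)
    (h0 : X.Ξ q ≠ 0) :
    friedrichScalar (dom c) (X.metric c) (X.factor c) (extChartAt (𝓡∂ 4) c q)
      = (X.dΞ q (X.grad q) + X.lam / 3) / (2 * X.Ξ q) := by
  have h := (X.isLocalExtension c).norm_dComp (ext_mem_dom hq)
  rw [← X.covComp_dΞ hq] at h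
  rw [X.apply_grad hq, ← X.covComp_dΞ hq, h, X.factor_ext hq]
  field_simp

/-- The scalar `s` does not depend on the chart: off `𝓘` it is determined by
`|dΞ|² + λ/3 = 2 Ξ s`, and the complement of `𝓘` is dense. -/
theorem friedrichScalar_ext {c q : M} (hq : q ∈ (extChartAt (𝓡∂ 4) c).source) :
    friedrichScalar (dom c) (X.metric c) (X.factor c) (extChartAt (𝓡∂ 4) c q) = X.s q := by
  set x := extChartAt (𝓡∂ 4) c q with hx
  set V := dom c ∩ (extChartAt (𝓡∂ 4) c).symm ⁻¹' (extChartAt (𝓡∂ 4) q).source with hV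
  have hxc : x ∈ dom c := ext_mem_dom hq
  have hxV : x ∈ V := ⟨hxc, by
    rw [mem_preimage, hx, show (extChartAt (𝓡∂ 4) c).symm _ = q from pt_ext hq]
    exact mem_extChartAt_source q⟩
  set f := fun y => friedrichScalar (dom c) (X.metric c) (X.factor c) y
  set f' := fun y => friedrichScalar (dom q) (X.metric q) (X.factor q)
    (extChartAt (𝓡∂ 4) q (pt c y))
  have hVn : V ∈ 𝓝[dom c] x := by
    refine inter_mem self_mem_nhdsWithin ?_
    refine continuousOn_extChartAt_symm (I := 𝓡∂ 4) c _ hxc ?_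
    rw [show (extChartAt (𝓡∂ 4) c).symm x = q from pt_ext hq]
    exact extChartAt_source_mem_nhds q
  have hf : ContinuousOn f V :=
    (X.isLocalExtension c).smooth_friedrichScalar.continuousOn.mono inter_subset_left
  have hf' : ContinuousOn f' V := by
    refine (X.isLocalExtension q).smooth_friedrichScalar.continuousOn.comp
      ((continuousOn_extChartAt q).comp
        ((continuousOn_extChartAt_symm c).mono inter_subset_left) fun y hy => hy.2)
      fun y hy => ext_mem_dom hy.2
  have hE : EqOn f f' {y | y ∈ V ∧ X.factor c y ≠ 0} := by
    intro y hy
    have h1 := X.friedrichScalar_eq_of_ne (pt_mem_source hy.1.1) hy.2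
    rw [ext_pt hy.1.1] at h1
    exact h1.trans (X.friedrichScalar_eq_of_ne (c := q) hy.1.2 hy.2).symm
  have hcl : x ∈ closure {y | y ∈ V ∧ X.factor c y ≠ 0} := by
    have h1 := mem_closure_iff_nhdsWithin_neBot.1 (X.subset_closure_factor_ne_zero c hxc)
    rw [mem_closure_iff_frequently]
    have h2 : ∃ᶠ y in 𝓝[{y | y ∈ dom c ∧ X.factor c y ≠ 0}] x, True :=
      frequently_true_iff_neBot _ |>.2 h1
    have h3 := frequently_nhdsWithin_iff.1 h2
    have h4 : ∀ᶠ y in 𝓝 x, y ∈ dom c → y ∈ V := mem_nhdsWithin_iff_eventually.1 hVn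
    exact (h3.and_eventually h4).mono fun y hy => ⟨hy.2 hy.1.2.1, hy.1.2.2⟩
  -- the agreement passes to the limit point `x`
  have hT := (hE.of_subset_closure (t := insert x {y | y ∈ V ∧ X.factor c y ≠ 0})
    (hf.mono (insert_subset hxV fun y hy => hy.1)) (hf'.mono (insert_subset hxV fun y hy => hy.1))
    (subset_insert _ _) (insert_subset hcl subset_closure)) (mem_insert _ _)
  change f x = _
  rw [hT]
  change friedrichScalar (dom q) (X.metric q) (X.factor q) (extChartAt (𝓡∂ 4) q (pt c x)) = _
  rw [hx, pt_ext hq]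
  rfl

lemma obstruction_ext {c q : M} (hq : q ∈ (extChartAt (𝓡∂ 4) c).source)
    (b : TangentSpace (𝓡∂ 4) q →L[ℝ] ℝ) :
    obstruction (dom c) (X.metric c) (X.factor c) (extChartAt (𝓡∂ 4) c q) (covComp c q b)
      = b (X.grad q) + X.s q := by
  unfold obstruction
  rw [X.apply_grad hq, X.friedrichScalar_ext hq]

end AdSLikeExtension

/-! ### Conformal curves remain in the boundary -/

section LocalBound

variable {ι : Type*} [Fintype ι] {U : Set (Coord 4)}
  {G : Coord 4 → Matrix (Fin 4) (Fin 4) ℝ} {Ξ : Coord 4 → ℝ} {lam : ℝ}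
  {F : ι → Coord 4 → Fin 4 → Fin 4 → ℝ} {H : Coord 4 → Fin 4 → Fin 4 → ℝ}
  {J : Set ℝ} {x : ℝ → Coord 4} {z b : ℝ → Fin 4 → ℝ} {τ : ℝ}

lemma ConformalCurveEqAt.continuousWithinAt_position {n : ℕ} {U : Set (Coord n)}
    {G : Coord n → Matrix (Fin n) (Fin n) ℝ} {H : Coord n → Fin n → Fin n → ℝ}
    {x : ℝ → Coord n} {z b : ℝ → Fin n → ℝ} (hc : ConformalCurveEqAt U G H J x z b τ) :
    ContinuousWithinAt x J τ :=
  (hasDerivWithinAt_of_coords hc.position).continuousWithinAt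

lemma continuousWithinAt_field {n : ℕ} {U : Set (Coord n)} {x : ℝ → Coord n} {f : Coord n → ℝ}
    (hf : ContDiffOn ℝ ∞ f U) (hτ : τ ∈ J) (hxU : ∀ᶠ t in 𝓝[J] τ, x t ∈ U)
    (hx : ContinuousWithinAt x J τ) : ContinuousWithinAt (fun t => f (x t)) J τ :=
  (hf.continuousOn _ (hxU.self_of_nhdsWithin hτ)).tendsto.comp
    (tendsto_nhdsWithin_iff.2 ⟨hx, hxU⟩)

lemma continuousWithinAt_sum {m : ℕ} {f : Fin m → ℝ → ℝ}
    (hf : ∀ i, ContinuousWithinAt (f i) J τ) : ContinuousWithinAt (fun t => ∑ i, f i t) J τ :=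
  tendsto_finsetSum _ fun i _ => hf i

/-- The triple `(Ξ, ⟨dΞ, z⟩, ⟨b, ∇Ξ⟩ + s)` along a conformal curve satisfies a homogeneous linear
system, whose coefficients are locally bounded. The sup norm of the product is used. -/
lemma IsLocalExtension.exists_bound (h : IsLocalExtension U G Ξ lam F) (hτ : τ ∈ J)
    (hxU : ∀ᶠ t in 𝓝[J] τ, x t ∈ U)
    (hc : ∀ᶠ t in 𝓝[J] τ, ConformalCurveEqAt U G H J x z b t)
    (hH : ∀ y ∈ U, ∀ i k, H y i k = smoothH U G Ξ F i k y) :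
    ∃ C, ∀ᶠ t in 𝓝[J] τ, ∃ y', HasDerivWithinAt (fun t => ((Ξ (x t),
        pair (dComp U Ξ (x t)) (z t), obstruction U G Ξ (x t) (b t)) : ℝ × ℝ × ℝ)) y' J t ∧
      ‖y'‖ ≤ C * ‖((Ξ (x t), pair (dComp U Ξ (x t)) (z t),
        obstruction U G Ξ (x t) (b t)) : ℝ × ℝ × ℝ)‖ := by
  have hcτ := hc.self_of_nhdsWithin hτ
  have hx := hcτ.continuousWithinAt_position
  have hz : ∀ k, ContinuousWithinAt (fun t => z t k) J τ :=
    fun k => (hcτ.velocity k).continuousWithinAt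
  have hb : ∀ k, ContinuousWithinAt (fun t => b t k) J τ :=
    fun k => (hcτ.covector k).continuousWithinAt
  have hG : ∀ i j, ContinuousWithinAt (fun t => G (x t) i j) J τ :=
    fun i j => continuousWithinAt_field (h.metric.smooth i j) hτ hxU hx
  have hGi : ∀ i j, ContinuousWithinAt (fun t => (G (x t))⁻¹ i j) J τ :=
    fun i j => continuousWithinAt_field (h.metric.smooth_inv i j) hτ hxU hx
  have hS : ∀ i j, ContinuousWithinAt (fun t => smoothH U G Ξ F i j (x t)) J τ :=
    fun i j => continuousWithinAt_field (h.smooth_smoothH i j) hτ hxU hx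
  set A := fun t => ∑ i, ∑ j, smoothH U G Ξ F i j (x t) * z t i * z t j with hA
  set P := fun t => pair (b t) (z t) with hP
  set D := fun t => dotVec G (x t) (z t) (z t) with hD
  set E := fun t => ∑ i, z t i * dotCov G (x t) (fun j => smoothH U G Ξ F i j (x t)) (b t) with hE
  set Q := fun t => dotCov G (x t) (b t) (b t) with hQ
  have cA : ContinuousWithinAt A J τ := by 
    exact continuousWithinAt_sum fun i => continuousWithinAt_sum fun j => by fun_prop
  have cP : ContinuousWithinAt P J τ := by 
    exact continuousWithinAt_sum fun i => by fun_prop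
  have cD : ContinuousWithinAt D J τ := by 
    exact continuousWithinAt_sum fun i => continuousWithinAt_sum fun j => 
      ((hG i j).mul (hz i)).mul (hz j)
  have cE : ContinuousWithinAt E J τ := by 
    refine continuousWithinAt_sum fun i => (hz i).mul ?_
    exact continuousWithinAt_sum fun i => continuousWithinAt_sum fun j => by fun_prop
  have cQ : ContinuousWithinAt Q J τ := by 
    exact continuousWithinAt_sum fun i => continuousWithinAt_sum fun j => by fun_prop
  set K := fun t => 1 + |A t| + 2 * |P t| + |D t| + |E t| + |Q t| with hK
  have cK : ContinuousWithinAt K J τ := by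
    have := cA.abs; have := cP.abs; have := cD.abs; have := cE.abs; have := cQ.abs
    rw [hK]; fun_prop
  refine ⟨K τ + 1, ?_⟩
  have hKb : ∀ᶠ t in 𝓝[J] τ, K t < K τ + 1 := cK.eventually_lt_const (lt_add_one _)
  have hxU' := eventually_eventually_nhdsWithin.2 hxU
  filter_upwards [hKb, hxU', hc, self_mem_nhdsWithin] with t hKt hxt hct htJ
  have hxtU := hxt.self_of_nhdsWithin htJ
  refine ⟨_, (h.hasDerivWithinAt_factor htJ hxt hct).prodMk
    ((h.hasDerivWithinAt_pair_dComp htJ hxt hct).prodMk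
      (h.hasDerivWithinAt_obstruction htJ hxt hct (hH _ hxtU))), ?_⟩
  set p := Ξ (x t)
  set q := pair (dComp U Ξ (x t)) (z t)
  set r := obstruction U G Ξ (x t) (b t)
  set m := ‖((p, q, r) : ℝ × ℝ × ℝ)‖ with hm
  have hp : |p| ≤ m := norm_fst_le ((p, q, r) : ℝ × ℝ × ℝ)
  have hqr : ‖((q, r) : ℝ × ℝ)‖ ≤ m := norm_snd_le ((p, q, r) : ℝ × ℝ × ℝ)
  have hq : |q| ≤ m := (norm_fst_le ((q, r) : ℝ × ℝ)).trans hqr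
  have hr : |r| ≤ m := (norm_snd_le ((q, r) : ℝ × ℝ)).trans hqr
  have hm0 : 0 ≤ m := norm_nonneg _
  have mul_bd : ∀ u w : ℝ, |w| ≤ m → |u * w| ≤ |u| * m := fun u w hw => by
    rw [abs_mul]; exact mul_le_mul_of_nonneg_left hw (abs_nonneg u)
  have hfin : K t * m ≤ (K τ + 1) * m := mul_le_mul_of_nonneg_right hKt.le hm0
  have nA := mul_nonneg (abs_nonneg (A t)) hm0
  have nP := mul_nonneg (abs_nonneg (P t)) hm0
  have nD := mul_nonneg (abs_nonneg (D t)) hm0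
  have nE := mul_nonneg (abs_nonneg (E t)) hm0
  have nQ := mul_nonneg (abs_nonneg (Q t)) hm0
  have hKm : K t * m = m + |A t| * m + 2 * (|P t| * m) + |D t| * m + |E t| * m + |Q t| * m := by
    rw [hK]; ring
  rw [Prod.norm_mk, Prod.norm_mk]
  refine max_le ?_ (max_le ?_ ?_) <;> refine le_trans ?_ hfin <;> rw [hKm, Real.norm_eq_abs]
  · linarith
  · have e : -(∑ i, ∑ j, smoothH U G Ξ F i j (x t) * z t i * z t j) * p
        - 2 * pair (b t) (z t) * q + dotVec G (x t) (z t) (z t) * r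
        = -(A t * p) - 2 * (P t * q) + D t * r := by simp only [hA, hP, hD]; ring
    rw [e]
    have h1 := abs_le.1 (mul_bd (A t) p hp)
    have h2 := abs_le.1 (mul_bd (P t) q hq)
    have h3 := abs_le.1 (mul_bd (D t) r hr)
    rw [abs_le]
    constructor <;> linarith
  · have e : -(∑ i, z t i * dotCov G (x t) (fun j => smoothH U G Ξ F i j (x t)) (b t)) * p
        - (1 / 2) * dotCov G (x t) (b t) (b t) * q + pair (b t) (z t) * r
        = -(E t * p) - (1 / 2) * (Q t * q) + P t * r := by simp only [hE, hP, hQ]; ring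
    rw [e]
    have h1 := abs_le.1 (mul_bd (E t) p hp)
    have h2 := abs_le.1 (mul_bd (Q t) q hq)
    have h3 := abs_le.1 (mul_bd (P t) r hr)
    rw [abs_le]
    constructor <;> linarith

end LocalBound

namespace AdSLikeExtension

variable {M : Type*} [TopologicalSpace M] [ChartedSpace (EuclideanHalfSpace 4) M]
  [IsManifold (𝓡∂ 4) ∞ M]
  {𝔤 ι : Type*} [LieRing 𝔤] [LieAlgebra ℝ 𝔤] [Fintype ι] {B : Module.Basis ι ℝ 𝔤}
  {X : AdSLikeExtension M B}
  {J : Set ℝ} {γ : ℝ → M} {v : (t : ℝ) → TangentSpace (𝓡∂ 4) (γ t)}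
  {b : (t : ℝ) → TangentSpace (𝓡∂ 4) (γ t) →L[ℝ] ℝ}

omit [IsManifold (𝓡∂ 4) ∞ M] in
lemma eventually_mem_source (hγ : ContinuousOn γ J) {τ : ℝ} (hτ : τ ∈ J) {c : M}
    (hc : γ τ ∈ (extChartAt (𝓡∂ 4) c).source) :
    ∀ᶠ t in 𝓝[J] τ, γ t ∈ (extChartAt (𝓡∂ 4) c).source :=
  hγ τ hτ ((isOpen_extChartAt_source c).mem_nhds hc)

namespace IsConformalCurve

variable (hC : X.IsConformalCurve J γ v b)
include hC

lemma eventually_mem_dom {τ : ℝ} (hτ : τ ∈ J) {c : M}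
    (hc : γ τ ∈ (extChartAt (𝓡∂ 4) c).source) :
    ∀ᶠ t in 𝓝[J] τ, extChartAt (𝓡∂ 4) c (γ t) ∈ dom c :=
  (eventually_mem_source hC.1 hτ hc).mono fun _ ht => ext_mem_dom ht

/-- A conformal curve tangent to `𝓘` at a point, with the right normal component of the covector
there, satisfies these conditions everywhere. -/
theorem boundary_conditions (hJ : J.OrdConnected) {τ₀ : ℝ} (hτ₀ : τ₀ ∈ J)
    (h0 : X.Ξ (γ τ₀) = 0) (h1 : X.dΞ (γ τ₀) (v τ₀) = 0)
    (h2 : b τ₀ (X.grad (γ τ₀)) + X.s (γ τ₀) = 0) :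
    ∀ τ ∈ J, X.Ξ (γ τ) = 0 ∧ X.dΞ (γ τ) (v τ) = 0 ∧ b τ (X.grad (γ τ)) + X.s (γ τ) = 0 := by
  set y : ℝ → ℝ × ℝ × ℝ := fun t =>
    (X.Ξ (γ t), X.dΞ (γ t) (v t), b t (X.grad (γ t)) + X.s (γ t)) with hy
  have key : ∀ τ ∈ J, y τ = 0 := by
    refine eq_zero_of_locally_norm_deriv_le hJ (fun τ hτ => ?_) hτ₀ (by simp [hy, h0, h1, h2])
    set c := γ τ
    have hs := eventually_mem_source hC.1 hτ (mem_extChartAt_source (I := 𝓡∂ 4) (γ τ))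
    have hcc : ∀ᶠ t in 𝓝[J] τ, ConformalCurveEqAt (dom c) (X.metric c) (X.H c) J
        (fun t => extChartAt (𝓡∂ 4) c (γ t))
        (fun t => vecComp c (γ t) (v t)) (fun t => covComp c (γ t) (b t)) t := by
      filter_upwards [hs, self_mem_nhdsWithin] with t ht htJ using hC.2 t htJ c ht
    obtain ⟨K, hK⟩ := (X.isLocalExtension c).exists_bound hτ
      (hC.eventually_mem_dom hτ (mem_extChartAt_source (γ τ))) hcc
      (fun y hy i k => X.H_eq_smoothH hy i k)
    refine ⟨K, ?_⟩
    have hyc : ∀ t, γ t ∈ (extChartAt (𝓡∂ 4) c).source →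
        y t = (X.factor c (extChartAt (𝓡∂ 4) c (γ t)),
          pair (dComp (dom c) (X.factor c) (extChartAt (𝓡∂ 4) c (γ t))) (vecComp c (γ t) (v t)),
          obstruction (dom c) (X.metric c) (X.factor c) (extChartAt (𝓡∂ 4) c (γ t))
            (covComp c (γ t) (b t))) := by
      intro t ht
      rw [X.factor_ext ht, ← X.dΞ_eq_pair ht, X.obstruction_ext ht]
    filter_upwards [hK, eventually_eventually_nhdsWithin.2 hs, self_mem_nhdsWithin]
      with t ⟨y', hy1, hy2⟩ hst htJ
    refine ⟨y', hy1.congr_of_eventuallyEq (hst.mono fun r hr => hyc r hr)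
      (hyc t (hst.self_of_nhdsWithin htJ)), ?_⟩
    rw [hyc t (hst.self_of_nhdsWithin htJ)]
    exact hy2
  intro τ hτ
  have := key τ hτ
  simpa [hy, Prod.ext_iff] using this

/-- A conformal curve in `𝓘` which is tangent to `𝓘` and satisfies `⟨b, ∇Ξ⟩ = -s` is a conformal
geodesic of the induced conformal structure. -/
theorem isBoundaryConformalGeodesic
    (h : ∀ τ ∈ J, X.Ξ (γ τ) = 0 ∧ X.dΞ (γ τ) (v τ) = 0 ∧ b τ (X.grad (γ τ)) + X.s (γ τ) = 0) :
    X.IsBoundaryConformalGeodesic J γ v b := by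
  refine ⟨hC.1, fun τ hτ => ⟨(h τ hτ).1, (h τ hτ).2.1, fun c hc => ?_⟩⟩
  have hx := ext_mem_dom hc
  obtain ⟨h0, h1, h2⟩ := h τ hτ
  refine (X.isLocalExtension c).conformalCurveEqAt_inducedMetric X.lam_pos (isOpen_bdryDom c)
    (fun y hy => (X.factor_eq_zero_iff hy).2 rfl) (hC.2 τ hτ c hc)
    (X.H_eq_smoothH hx) hx ?_ ?_ ?_
  · rw [← X.factor_eq_zero_iff hx, X.factor_ext hc, h0]
  · rw [← X.dΞ_eq_pair hc, h1]
  · rw [X.obstruction_ext hc, h2]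

end IsConformalCurve

end AdSLikeExtension

/-! ### Change of coordinates -/

section ChangeOfCoordinates

variable {n : ℕ} {U V : Set (Coord n)} {G G' : Coord n → Matrix (Fin n) (Fin n) ℝ}
  {φ : Coord n → Coord n} {x : Coord n}

/-- The Jacobian matrix `∂ᵢφᵏ` of a coordinate change. -/
def jac (U : Set (Coord n)) (φ : Coord n → Coord n) (k i : Fin n) (x : Coord n) : ℝ :=
  pd U i (fun y => φ y k) x

/-- A smooth map of coordinate domains which pulls the metric `G'` back to `G`. If both metrics are
nondegenerate, its Jacobian matrix is invertible. -/
structure IsIsometricChange (U V : Set (Coord n)) (G G' : Coord n → Matrix (Fin n) (Fin n) ℝ)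
    (φ : Coord n → Coord n) : Prop where
  mapsTo : MapsTo φ U V
  smooth : ∀ k, ContDiffOn ℝ ∞ (fun y => φ y k) U
  metric : ∀ y ∈ U, ∀ i j, G y i j = ∑ k, ∑ l, G' (φ y) k l * jac U φ k i y * jac U φ l j y

namespace IsIsometricChange

variable (hφ : IsIsometricChange U V G G' φ) (hG : IsSmoothMetric U G)
  (hG' : IsSmoothMetric V G')
include hφ hG

omit hG in
lemma contDiffOn : ContDiffOn ℝ ∞ φ U := contDiffOn_euclidean.2 hφ.smooth

lemma smooth_jac (k i : Fin n) : ContDiffOn ℝ ∞ (jac U φ k i) U :=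
  contDiffOn_pd hG.uniqueDiff (hφ.smooth k) i

lemma pd_comp (hx : x ∈ U) {f : Coord n → ℝ} (hf : ContDiffOn ℝ ∞ f V) (i : Fin n) :
    pd U i (fun y => f (φ y)) x = ∑ a, pd V a f (φ x) * jac U φ a i x := by
  have h1 := (ContDiffOn.diffWithin hf (hφ.mapsTo hx)).hasFDerivWithinAt
  have h2 := ((hφ.contDiffOn x hx).differentiableWithinAt (by simp)).hasFDerivWithinAt
  have h3 := h1.comp x h2 hφ.mapsTo
  have hk : ∀ k, fderivWithin ℝ φ U x (EuclideanSpace.single i 1) k = jac U φ k i x := by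
    intro k
    have h4 := (EuclideanSpace.proj (𝕜 := ℝ) k).hasFDerivAt.comp_hasFDerivWithinAt x h2
    have h5 := h4.fderivWithin (hG.uniqueDiff x hx)
    exact (congrArg (fun L : Coord n →L[ℝ] ℝ => L (EuclideanSpace.single i 1)) h5).symm
  have h6 : fderivWithin ℝ (fun y => f (φ y)) U x
      = (fderivWithin ℝ f V (φ x)).comp (fderivWithin ℝ φ U x) :=
    h3.fderivWithin (hG.uniqueDiff x hx)
  unfold pd
  rw [h6, ContinuousLinearMap.comp_apply, fderivWithin_apply_eq_sum]
  simp_rw [hk]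
  rfl

lemma pd_jac_symm (hx : x ∈ U) (k i j : Fin n) :
    pd U i (jac U φ k j) x = pd U j (jac U φ k i) x :=
  pd_comm hG.uniqueDiff hG.subset_closure hx (hφ.smooth k) i j

include hG'

/-- The transformation law of the Christoffel symbols of the first kind. -/
lemma first_eq (hx : x ∈ U) (l i j : Fin n) :
    christoffelFirst U G l i j x
      = (∑ k, ∑ a, ∑ b, christoffelFirst V G' k a b (φ x) * jac U φ k l x * jac U φ a i x
          * jac U φ b j x)
        + ∑ k, ∑ m, G' (φ x) k m * jac U φ k l x * pd U i (jac U φ m j) x := by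
  set T : Fin n → Fin n → Fin n → ℝ := fun i j l => ∑ k, ∑ m, ∑ a,
    pd V a (fun y => G' y k m) (φ x) * jac U φ a i x * jac U φ k j x * jac U φ m l x with hT
  set S : Fin n → Fin n → Fin n → ℝ := fun i j l => ∑ k, ∑ m,
    G' (φ x) k m * jac U φ k l x * pd U i (jac U φ m j) x with hS
  have hcomp : ∀ k m, ContDiffOn ℝ ∞ (fun y => G' (φ y) k m) U := fun k m =>
    (hG'.smooth k m).comp hφ.contDiffOn hφ.mapsTo
  have hpd : ∀ i j l, pd U i (fun y => G y j l) x = T i j l + (S i j l + S i l j) := by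
    intro i j l
    rw [pd_congr (h := fun y => ∑ k, ∑ m, G' (φ y) k m * jac U φ k j y * jac U φ m l y)
      (fun y hy => hφ.metric y hy j l) hx]
    rw [pd_sum _ hG.uniqueDiff hx (fun k => ContDiffOn.sum fun m _ =>
      ((hcomp k m).mul (hφ.smooth_jac hG k j)).mul (hφ.smooth_jac hG m l))]
    have e1 : ∀ k, pd U i (fun y => ∑ m, G' (φ y) k m * jac U φ k j y * jac U φ m l y) x
        = ∑ m, ((∑ a, pd V a (fun y => G' y k m) (φ x) * jac U φ a i x) * jac U φ k j x
            * jac U φ m l x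
          + (G' (φ x) k m * pd U i (jac U φ k j) x * jac U φ m l x
            + G' (φ x) k m * jac U φ k j x * pd U i (jac U φ m l) x)) := by
      intro k
      rw [pd_sum _ hG.uniqueDiff hx (fun m =>
        ((hcomp k m).mul (hφ.smooth_jac hG k j)).mul (hφ.smooth_jac hG m l))]
      refine Finset.sum_congr rfl fun m _ => ?_
      rw [pd_mul hG.uniqueDiff hx ((hcomp k m).mul (hφ.smooth_jac hG k j))
        (hφ.smooth_jac hG m l), pd_mul hG.uniqueDiff hx (hcomp k m) (hφ.smooth_jac hG k j),
        hφ.pd_comp hG hx (hG'.smooth k m)]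
      ring
    simp_rw [e1]
    simp only [Finset.sum_add_distrib]
    congr 1
    · simp only [hT, Finset.sum_mul]
    · congr 1
      rw [Finset.sum_comm]
      refine Finset.sum_congr rfl fun m _ => Finset.sum_congr rfl fun k _ => ?_
      rw [hG'.symm _ (hφ.mapsTo hx) k m]
      ring
  have hSs : ∀ i j l, S i j l = S j i l := fun i j l =>
    Finset.sum_congr rfl fun k _ => Finset.sum_congr rfl fun m _ => by
      rw [hφ.pd_jac_symm hG hx m i j]
  have hC : ∑ k, ∑ a, ∑ b, christoffelFirst V G' k a b (φ x) * jac U φ k l x * jac U φ a i x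
      * jac U φ b j x = (1 / 2) * (T i j l + T j i l - T l i j) := by
    have t1 : T i j l = ∑ k, ∑ a, ∑ b, pd V a (fun y => G' y b k) (φ x) * jac U φ k l x
        * jac U φ a i x * jac U φ b j x := by
      simp only [hT]
      rw [Finset.sum_comm]
      refine Finset.sum_congr rfl fun k _ => ?_
      rw [Finset.sum_comm]
      exact Finset.sum_congr rfl fun a _ => Finset.sum_congr rfl fun b _ => by ring
    have t2 : T j i l = ∑ k, ∑ a, ∑ b, pd V b (fun y => G' y a k) (φ x) * jac U φ k l x
        * jac U φ a i x * jac U φ b j x := by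
      simp only [hT]
      rw [Finset.sum_comm]
      exact Finset.sum_congr rfl fun k _ => Finset.sum_congr rfl fun a _ =>
        Finset.sum_congr rfl fun b _ => by ring
    have t3 : T l i j = ∑ k, ∑ a, ∑ b, pd V k (fun y => G' y a b) (φ x) * jac U φ k l x
        * jac U φ a i x * jac U φ b j x := by
      simp only [hT]
      have : ∀ a, ∑ b, ∑ k, pd V k (fun y => G' y a b) (φ x) * jac U φ k l x
          * jac U φ a i x * jac U φ b j x = ∑ k, ∑ b, pd V k (fun y => G' y a b) (φ x)
          * jac U φ k l x * jac U φ a i x * jac U φ b j x := fun a => Finset.sum_comm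
      simp_rw [this]
      rw [Finset.sum_comm]
    rw [t1, t2, t3, ← Finset.sum_add_distrib, ← Finset.sum_sub_distrib, Finset.mul_sum]
    refine Finset.sum_congr rfl fun k _ => ?_
    rw [← Finset.sum_add_distrib, ← Finset.sum_sub_distrib, Finset.mul_sum]
    refine Finset.sum_congr rfl fun a _ => ?_
    rw [← Finset.sum_add_distrib, ← Finset.sum_sub_distrib, Finset.mul_sum]
    refine Finset.sum_congr rfl fun b _ => ?_
    unfold christoffelFirst
    ring
  rw [hC]
  change _ = _ + S i j l
  unfold christoffelFirst
  rw [hpd, hpd, hpd, hSs j i l, hSs i l j, hSs j l i]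
  ring

/-- The transformation law of the Christoffel symbols. -/
theorem christoffel_eq (hx : x ∈ U) (m i j : Fin n) :
    ∑ k, jac U φ m k x * christoffel U G k i j x
      = (∑ a, ∑ b, christoffel V G' m a b (φ x) * jac U φ a i x * jac U φ b j x)
        + pd U i (jac U φ m j) x := by
  set P : Matrix (Fin n) (Fin n) ℝ := Matrix.of fun k i => jac U φ k i x with hP
  have hmat : G x = (P.transpose * G' (φ x)) * P := by
    ext i j
    rw [hφ.metric x hx, Matrix.mul_apply, Finset.sum_comm]
    refine Finset.sum_congr rfl fun l _ => ?_
    rw [Matrix.mul_apply, Finset.sum_mul]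
    exact Finset.sum_congr rfl fun k _ => by
      rw [Matrix.transpose_apply]; simp only [hP, Matrix.of_apply]; ring
  have hdet : (P.transpose * G' (φ x)).det ≠ 0 := by
    have := hG.det_ne x hx
    rw [hmat, Matrix.det_mul] at this
    exact left_ne_zero_of_mul this
  -- both sides become equal after contraction with the invertible matrix `∂φᵀ G'`
  set D : Fin n → ℝ := fun m => ∑ k, jac U φ m k x * christoffel U G k i j x
      - ((∑ a, ∑ b, christoffel V G' m a b (φ x) * jac U φ a i x * jac U φ b j x)
        + pd U i (jac U φ m j) x) with hD
  have hD0 : (P.transpose * G' (φ x)).mulVec D = 0 := by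
    ext l
    change ∑ m, (P.transpose * G' (φ x)) l m * D m = 0
    have e0 : ∀ m, (P.transpose * G' (φ x)) l m = ∑ r, jac U φ r l x * G' (φ x) r m := by
      intro m
      rw [Matrix.mul_apply]; rfl
    have h1 : ∑ m, (P.transpose * G' (φ x)) l m * ∑ k, jac U φ m k x * christoffel U G k i j x
        = christoffelFirst U G l i j x := by
      rw [← hG.lower_christoffel hx, hmat]
      simp_rw [Finset.mul_sum]
      rw [Finset.sum_comm]
      refine Finset.sum_congr rfl fun k _ => ?_
      rw [Matrix.mul_apply, Finset.sum_mul]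
      exact Finset.sum_congr rfl fun m _ => by simp only [hP, Matrix.of_apply]; ring
    have h2 : ∑ m, (P.transpose * G' (φ x)) l m
          * ∑ a, ∑ b, christoffel V G' m a b (φ x) * jac U φ a i x * jac U φ b j x
        = ∑ k, ∑ a, ∑ b, christoffelFirst V G' k a b (φ x) * jac U φ k l x * jac U φ a i x
          * jac U φ b j x := by
      simp_rw [← hG'.lower_christoffel (hφ.mapsTo hx), e0, Finset.sum_mul, Finset.mul_sum]
      rw [Finset.sum_comm]
      refine Finset.sum_congr rfl fun r _ => ?_
      rw [Finset.sum_comm]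
      refine Finset.sum_congr rfl fun a _ => ?_
      rw [Finset.sum_comm]
      exact Finset.sum_congr rfl fun b _ => Finset.sum_congr rfl fun m _ => by ring
    have h3 : ∑ m, (P.transpose * G' (φ x)) l m * pd U i (jac U φ m j) x
        = ∑ k, ∑ m, G' (φ x) k m * jac U φ k l x * pd U i (jac U φ m j) x := by
      simp_rw [e0, Finset.sum_mul]
      rw [Finset.sum_comm]
      exact Finset.sum_congr rfl fun r _ => Finset.sum_congr rfl fun m _ => by ring
    have h4 := hφ.first_eq hG hG' hx l i j
    rw [← h1, ← h2, ← h3] at h4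
    simp only [hD, mul_sub, mul_add, Finset.sum_sub_distrib, Finset.sum_add_distrib]
    linarith
  have hD1 : D = 0 := by
    by_contra hne
    exact hdet (Matrix.exists_mulVec_eq_zero_iff.1 ⟨D, hne, hD0⟩)
  have := congrFun hD1 m
  simp only [hD, Pi.zero_apply] at this
  linarith

/-- The covariant derivative along a curve does not depend on the coordinates: if
`e' = -Γ(z, e) + a`, then the transformed vector field satisfies the same equation with the
transformed `a`. -/
theorem hasDerivWithinAt_jac {J : Set ℝ} {x : ℝ → Coord n} {z : Fin n → ℝ} {e : ℝ → Fin n → ℝ}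
    {a : Fin n → ℝ} {τ : ℝ} (hτ : τ ∈ J) (hxU : ∀ᶠ t in 𝓝[J] τ, x t ∈ U)
    (hx : ∀ k, HasDerivWithinAt (fun t => x t k) (z k) J τ)
    (he : ∀ k, HasDerivWithinAt (fun t => e t k)
      (-(∑ i, ∑ j, christoffel U G k i j (x τ) * z i * e τ j) + a k) J τ) (m : Fin n) :
    HasDerivWithinAt (fun t => ∑ k, jac U φ m k (x t) * e t k)
      (-(∑ p, ∑ q, christoffel V G' m p q (φ (x τ)) * (∑ i, jac U φ p i (x τ) * z i)
          * ∑ j, jac U φ q j (x τ) * e τ j)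
        + ∑ k, jac U φ m k (x τ) * a k) J τ := by
  have hxτ : x τ ∈ U := hxU.self_of_nhdsWithin hτ
  have h := hasDerivWithinAt_sum_mul (f := fun t k => jac U φ m k (x t))
    (fun k => hasDerivWithinAt_comp_curve (hφ.smooth_jac hG m k) hτ hxU hx) he
  refine h.congr_deriv ?_
  have e1 : ∑ k, jac U φ m k (x τ) * ∑ i, ∑ j, christoffel U G k i j (x τ) * z i * e τ j
      = ∑ i, ∑ j, (∑ k, jac U φ m k (x τ) * christoffel U G k i j (x τ)) * z i * e τ j := by
    simp_rw [Finset.mul_sum, Finset.sum_mul]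
    rw [Finset.sum_comm]
    refine Finset.sum_congr rfl fun i _ => ?_
    rw [Finset.sum_comm]
    exact Finset.sum_congr rfl fun j _ => Finset.sum_congr rfl fun k _ => by ring
  have e2 : ∑ p, ∑ q, christoffel V G' m p q (φ (x τ)) * (∑ i, jac U φ p i (x τ) * z i)
          * ∑ j, jac U φ q j (x τ) * e τ j
      = ∑ i, ∑ j, (∑ p, ∑ q, christoffel V G' m p q (φ (x τ)) * jac U φ p i (x τ)
          * jac U φ q j (x τ)) * z i * e τ j := by
    simp_rw [Finset.sum_mul, Finset.mul_sum, Finset.sum_mul]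
    have s1 : ∀ p : Fin n, ∑ q, ∑ j, ∑ i, christoffel V G' m p q (φ (x τ))
          * (jac U φ p i (x τ) * z i) * (jac U φ q j (x τ) * e τ j)
        = ∑ i, ∑ j, ∑ q, christoffel V G' m p q (φ (x τ)) * jac U φ p i (x τ)
          * jac U φ q j (x τ) * z i * e τ j := by
      intro p
      rw [Finset.sum_comm]
      have : ∀ j, ∑ q, ∑ i, christoffel V G' m p q (φ (x τ))
          * (jac U φ p i (x τ) * z i) * (jac U φ q j (x τ) * e τ j)
        = ∑ i, ∑ q, christoffel V G' m p q (φ (x τ)) * jac U φ p i (x τ)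
          * jac U φ q j (x τ) * z i * e τ j := fun j => by
        rw [Finset.sum_comm]
        exact Finset.sum_congr rfl fun i _ => Finset.sum_congr rfl fun q _ => by ring
      simp_rw [this]
      rw [Finset.sum_comm]
    simp_rw [s1]
    rw [Finset.sum_comm]
    refine Finset.sum_congr rfl fun i _ => ?_
    rw [Finset.sum_comm]
  have e3 : ∑ k, (∑ i, pd U i (jac U φ m k) (x τ) * z i) * e τ k
      = ∑ i, ∑ j, pd U i (jac U φ m j) (x τ) * z i * e τ j := by
    simp_rw [Finset.sum_mul]
    rw [Finset.sum_comm]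
  simp_rw [hφ.christoffel_eq hG hG' hxτ] at e1
  simp only [mul_add, mul_neg, Finset.sum_add_distrib, Finset.sum_neg_distrib]
  rw [e1, e2, e3]
  simp only [add_mul, Finset.sum_add_distrib]
  ring

end IsIsometricChange

end ChangeOfCoordinates

/-! ### The Weyl propagation equation is independent of the chart -/

namespace AdSLikeExtension

variable {M : Type*} [TopologicalSpace M] [ChartedSpace (EuclideanHalfSpace 4) M]
  [IsManifold (𝓡∂ 4) ∞ M]
  {𝔤 ι : Type*} [LieRing 𝔤] [LieAlgebra ℝ 𝔤] [Fintype ι] {B : Module.Basis ι ℝ 𝔤}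
  (X : AdSLikeExtension M B)

/-- The set of coordinates in the chart at `c` of the points which lie in the chart at `d`. -/
def overlap (c d : M) : Set (Coord 4) :=
  dom c ∩ (extChartAt (𝓡∂ 4) c).symm ⁻¹' (extChartAt (𝓡∂ 4) d).source

omit [IsManifold (𝓡∂ 4) ∞ M] in
lemma exists_isOpen_overlap (c d : M) : ∃ W, IsOpen W ∧ overlap c d = dom c ∩ W := by
  obtain ⟨W, hW, h⟩ := (continuousOn_iff'.1 (continuousOn_extChartAt_symm (I := 𝓡∂ 4) c))
    _ (isOpen_extChartAt_source (I := 𝓡∂ 4) d)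
  exact ⟨W, hW, by unfold overlap; rw [inter_comm, h, inter_comm]⟩

omit [IsManifold (𝓡∂ 4) ∞ M] in
lemma overlap_mem_nhdsWithin {c d : M} {x : Coord 4} (hx : x ∈ overlap c d) :
    overlap c d ∈ 𝓝[dom c] x := by
  obtain ⟨W, hW, h⟩ := exists_isOpen_overlap c d
  rw [h] at hx ⊢
  exact inter_mem self_mem_nhdsWithin (mem_nhdsWithin_of_mem_nhds (hW.mem_nhds hx.2))

omit [IsManifold (𝓡∂ 4) ∞ M] in
lemma ext_mem_overlap {c d q : M} (hc : q ∈ (extChartAt (𝓡∂ 4) c).source)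
    (hd : q ∈ (extChartAt (𝓡∂ 4) d).source) : extChartAt (𝓡∂ 4) c q ∈ overlap c d := by
  refine ⟨ext_mem_dom hc, ?_⟩
  rw [mem_preimage, show (extChartAt (𝓡∂ 4) c).symm _ = q from pt_ext hc]
  exact hd

/-- The coordinate change from the chart at `c` to the chart at `d`. -/
def transition (c d : M) (x : Coord 4) : Coord 4 := extChartAt (𝓡∂ 4) d (pt c x)

lemma isSmoothMetric_overlap (c d : M) : IsSmoothMetric (overlap c d) (X.metric c) := by
  obtain ⟨W, hW, h⟩ := exists_isOpen_overlap c d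
  rw [h]
  exact (X.isSmoothMetric c).inter_isOpen hW

lemma jac_transition {c d : M} {x : Coord 4} (hx : x ∈ overlap c d) (k i : Fin 4) :
    jac (overlap c d) (transition c d) k i x
      = tangentCoordChange (𝓡∂ 4) c d (pt c x) (EuclideanSpace.single i 1) k := by
  have h1 := hasFDerivWithinAt_tangentCoordChange (I := 𝓡∂ 4) ⟨pt_mem_source hx.1, hx.2⟩
  rw [ext_pt hx.1] at h1
  have h2 := h1.mono (inter_subset_left.trans (extChartAt_target_subset_range c) :
    overlap c d ⊆ range (𝓡∂ 4))
  have h3 := (EuclideanSpace.proj (𝕜 := ℝ) k).hasFDerivAt.comp_hasFDerivWithinAt x h2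
  have hU : UniqueDiffWithinAt ℝ (overlap c d) x := by
    obtain ⟨W, hW, h⟩ := exists_isOpen_overlap c d
    rw [h] at hx ⊢
    exact (uniqueDiffOn_extChartAt_target c).inter hW x hx
  exact congrArg (fun L : Coord 4 →L[ℝ] ℝ => L (EuclideanSpace.single i 1)) (h3.fderivWithin hU)

/-- Tangent vectors transform with the Jacobian matrix of the coordinate change. -/
lemma vecComp_eq_sum_jac {c d q : M} (hc : q ∈ (extChartAt (𝓡∂ 4) c).source)
    (hd : q ∈ (extChartAt (𝓡∂ 4) d).source) (w : TangentSpace (𝓡∂ 4) q) (k : Fin 4) :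
    vecComp d q w k = ∑ i, jac (overlap c d) (transition c d) k i (extChartAt (𝓡∂ 4) c q)
      * vecComp c q w i := by
  rw [vecComp_change hc hd, clm_apply_eq_sum]
  simp_rw [jac_transition (ext_mem_overlap hc hd), pt_ext hc]
  rw [WithLp.ofLp_sum, Finset.sum_apply]
  exact Finset.sum_congr rfl fun i _ => mul_comm _ _

lemma isIsometricChange (c d : M) : IsIsometricChange (overlap c d) (dom d) (X.metric c)
    (X.metric d) (transition c d) where
  mapsTo x hx := ext_mem_dom hx.2
  smooth := by
    refine contDiffOn_euclidean.1 ?_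
    refine (contDiffOn_ext_coord_change (I := 𝓡∂ 4) (n := ∞) d c).mono fun x hx => ?_
    exact ⟨hx.1, hx.2⟩
  metric x hx i j := by
    have hs := pt_mem_source hx.1
    have h1 := X.metric_ext hs i j
    rw [ext_pt hx.1, X.g_eq_dotVec (c := d) hx.2] at h1
    rw [h1]
    unfold dotVec
    have h2 : ∀ k i, vecComp d (pt c x) (coordVec c (pt c x) i) k
        = jac (overlap c d) (transition c d) k i x := by
      intro k i
      rw [vecComp_eq_sum_jac hs hx.2, ext_pt hx.1]
      simp_rw [vecComp_coordVec hs]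
      simp [Pi.single_apply]
    simp_rw [h2]
    rfl

variable {X} {J : Set ℝ} {γ : ℝ → M} {v : (t : ℝ) → TangentSpace (𝓡∂ 4) (γ t)}
  {b : (t : ℝ) → TangentSpace (𝓡∂ 4) (γ t) →L[ℝ] ℝ}
  {e : (t : ℝ) → TangentSpace (𝓡∂ 4) (γ t)}

/-- The equation of Weyl propagation for `e` in the chart centred at `c`, at the parameter
value `τ`. -/
abbrev WeylIn (X : AdSLikeExtension M B) (J : Set ℝ) (γ : ℝ → M)
    (v : (t : ℝ) → TangentSpace (𝓡∂ 4) (γ t)) (b : (t : ℝ) → TangentSpace (𝓡∂ 4) (γ t) →L[ℝ] ℝ)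
    (e : (t : ℝ) → TangentSpace (𝓡∂ 4) (γ t)) (c : M) (τ : ℝ) : Prop :=
  WeylEqAt (dom c) (X.metric c) J (fun t => extChartAt (𝓡∂ 4) c (γ t))
    (fun t => vecComp c (γ t) (v t)) (fun t => covComp c (γ t) (b t))
    (fun t => vecComp c (γ t) (e t)) τ

/-- The right-hand side `-⟨b,e⟩ v - ⟨b,v⟩ e + g(e,v) b♯` of the equation of Weyl propagation. -/
def weylForce (X : AdSLikeExtension M B) (q : M) (v e : TangentSpace (𝓡∂ 4) q)
    (b : TangentSpace (𝓡∂ 4) q →L[ℝ] ℝ) : TangentSpace (𝓡∂ 4) q :=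
  -(b e) • v - (b v) • e + X.g q e v • X.raise q b

lemma vecComp_lin (c q : M) (r s : ℝ) (u w : TangentSpace (𝓡∂ 4) q) (k : Fin 4) :
    vecComp c q (r • u + s • w) k = r * vecComp c q u k + s * vecComp c q w k := by
  have h : ∀ (L : Coord 4 →L[ℝ] Coord 4) (u w : Coord 4),
      L (r • u + s • w) k = r * L u k + s * L w k := fun L u w => by simp
  exact h (tangentCoordChange (𝓡∂ 4) q c q) u w

lemma vecComp_weylForce {c q : M} (hq : q ∈ (extChartAt (𝓡∂ 4) c).source)
    (v e : TangentSpace (𝓡∂ 4) q) (b : TangentSpace (𝓡∂ 4) q →L[ℝ] ℝ) (k : Fin 4) :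
    vecComp c q (X.weylForce q v e b) k
      = -pair (covComp c q b) (vecComp c q e) * vecComp c q v k
        - pair (covComp c q b) (vecComp c q v) * vecComp c q e k
        + dotVec (X.metric c) (extChartAt (𝓡∂ 4) c q) (vecComp c q e) (vecComp c q v)
          * sharp (X.metric c) (extChartAt (𝓡∂ 4) c q) (covComp c q b) k := by
  have h : X.weylForce q v e b
      = (1 : ℝ) • (-(b e) • v + -(b v) • e) + X.g q e v • X.raise q b := by
    unfold weylForce; module
  rw [h, vecComp_lin, vecComp_lin, X.vecComp_raise hq, ← form_eq_pair hq, ← form_eq_pair hq,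
    ← X.g_eq_dotVec hq]
  ring

lemma weylIn_iff {c : M} {τ : ℝ} (hc : γ τ ∈ (extChartAt (𝓡∂ 4) c).source) :
    X.WeylIn J γ v b e c τ ↔ ∀ k, HasDerivWithinAt (fun t => vecComp c (γ t) (e t) k)
      (-(∑ i, ∑ j, christoffel (dom c) (X.metric c) k i j (extChartAt (𝓡∂ 4) c (γ τ))
          * vecComp c (γ τ) (v τ) i * vecComp c (γ τ) (e τ) j)
        + vecComp c (γ τ) (X.weylForce (γ τ) (v τ) (e τ) (b τ)) k) J τ := by
  refine forall_congr' fun k => ?_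
  rw [vecComp_weylForce hc]
  constructor <;> intro h <;> exact h.congr_deriv (by ring)

/-- If the equation of Weyl propagation holds in one chart, then it holds in every chart. -/
theorem IsConformalCurve.weylIn_change (hC : X.IsConformalCurve J γ v b) {τ : ℝ} (hτ : τ ∈ J)
    {c d : M} (hc : γ τ ∈ (extChartAt (𝓡∂ 4) c).source)
    (hd : γ τ ∈ (extChartAt (𝓡∂ 4) d).source) (h : X.WeylIn J γ v b e c τ) :
    X.WeylIn J γ v b e d τ := by
  rw [weylIn_iff hd]
  rw [weylIn_iff hc] at h
  have hφ := X.isIsometricChange c d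
  have hov := ext_mem_overlap hc hd
  have hsc := eventually_mem_source hC.1 hτ hc
  have hsd := eventually_mem_source hC.1 hτ hd
  have hev : ∀ᶠ t in 𝓝[J] τ, extChartAt (𝓡∂ 4) c (γ t) ∈ overlap c d := by
    filter_upwards [hsc, hsd] with t h1 h2 using ext_mem_overlap h1 h2
  have hΓ := christoffel_of_mem_nhdsWithin (G := X.metric c) (overlap_mem_nhdsWithin hov)
    inter_subset_left
  intro m
  have key := hφ.hasDerivWithinAt_jac (X.isSmoothMetric_overlap c d) (X.isSmoothMetric d) hτ hev
    (x := fun t => extChartAt (𝓡∂ 4) c (γ t)) (hC.2 τ hτ c hc).position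
    (e := fun t => vecComp c (γ t) (e t))
    (a := vecComp c (γ τ) (X.weylForce (γ τ) (v τ) (e τ) (b τ)))
    (fun k => (h k).congr_deriv (by simp_rw [hΓ])) m
  have key2 := key.congr_of_eventuallyEq (f₁ := fun t => vecComp d (γ t) (e t) m)
    (by filter_upwards [hsc, hsd] with t h1 h2 using vecComp_eq_sum_jac h1 h2 (e t) m)
    (vecComp_eq_sum_jac hc hd (e τ) m)
  refine key2.congr_deriv ?_
  have ht : transition c d (extChartAt (𝓡∂ 4) c (γ τ)) = extChartAt (𝓡∂ 4) d (γ τ) := by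
    unfold transition
    rw [pt_ext hc]
  simp_rw [← vecComp_eq_sum_jac hc hd, ht]

end AdSLikeExtension

/-! ### Existence and uniqueness of Weyl propagated vector fields -/

section WeylMatrix

variable {n : ℕ} {U : Set (Coord n)} {G : Coord n → Matrix (Fin n) (Fin n) ℝ}
  {H : Coord n → Fin n → Fin n → ℝ} {J : Set ℝ} {x : ℝ → Coord n} {z b e f : ℝ → Fin n → ℝ}
  {τ : ℝ}

/-- The coefficient matrix of the linear system `e' = A e` of Weyl propagation. -/
def weylMatrix (U : Set (Coord n)) (G : Coord n → Matrix (Fin n) (Fin n) ℝ) (x : ℝ → Coord n)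
    (z b : ℝ → Fin n → ℝ) (k j : Fin n) (t : ℝ) : ℝ :=
  -(∑ i, christoffel U G k i j (x t) * z t i) - b t j * z t k
    - (if k = j then pair (b t) (z t) else 0) + (∑ i, G (x t) j i * z t i) * sharp G (x t) (b t) k

lemma weylEqAt_iff : WeylEqAt U G J x z b e τ ↔ ∀ k, HasDerivWithinAt (fun t => e t k)
    (∑ j, weylMatrix U G x z b k j τ * e τ j) J τ := by
  refine forall_congr' fun k => ?_
  have h : ∑ j, weylMatrix U G x z b k j τ * e τ j
      = -(∑ i, ∑ j, christoffel U G k i j (x τ) * z τ i * e τ j)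
      - pair (b τ) (e τ) * z τ k - pair (b τ) (z τ) * e τ k
      + dotVec G (x τ) (e τ) (z τ) * sharp G (x τ) (b τ) k := by
    unfold weylMatrix
    simp only [add_mul, sub_mul, neg_mul, Finset.sum_add_distrib, Finset.sum_sub_distrib,
      Finset.sum_neg_distrib, ite_mul, zero_mul, Finset.sum_ite_eq, Finset.mem_univ, if_true]
    have e1 : ∑ j, (∑ i, christoffel U G k i j (x τ) * z τ i) * e τ j
        = ∑ i, ∑ j, christoffel U G k i j (x τ) * z τ i * e τ j := by
      simp_rw [Finset.sum_mul]
      exact Finset.sum_comm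
    have e2 : ∑ j, b τ j * z τ k * e τ j = pair (b τ) (e τ) * z τ k := by
      unfold pair
      rw [Finset.sum_mul]
      exact Finset.sum_congr rfl fun j _ => by ring
    have e3 : ∑ j, (∑ i, G (x τ) j i * z τ i) * sharp G (x τ) (b τ) k * e τ j
        = dotVec G (x τ) (e τ) (z τ) * sharp G (x τ) (b τ) k := by
      unfold dotVec
      rw [Finset.sum_mul]
      refine Finset.sum_congr rfl fun j _ => ?_
      rw [mul_assoc, mul_comm (sharp G (x τ) (b τ) k), ← mul_assoc, Finset.sum_mul]
      congr 1
      exact Finset.sum_congr rfl fun i _ => by ring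
    rw [e1, e2, e3]
  rw [h]

lemma IsSmoothMetric.continuousWithinAt_weylMatrix (hG : IsSmoothMetric U G) (hτ : τ ∈ J)
    (hxU : ∀ᶠ t in 𝓝[J] τ, x t ∈ U) (hc : ConformalCurveEqAt U G H J x z b τ) (k j : Fin n) :
    ContinuousWithinAt (weylMatrix U G x z b k j) J τ := by
  have hx := hc.continuousWithinAt_position
  have hz : ∀ k, ContinuousWithinAt (fun t => z t k) J τ :=
    fun k => (hc.velocity k).continuousWithinAt
  have hb : ∀ k, ContinuousWithinAt (fun t => b t k) J τ :=
    fun k => (hc.covector k).continuousWithinAt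
  have hGi : ∀ i j, ContinuousWithinAt (fun t => (G (x t))⁻¹ i j) J τ :=
    fun i j => continuousWithinAt_field (hG.smooth_inv i j) hτ hxU hx
  have hΓ : ∀ i, ContinuousWithinAt (fun t => christoffel U G k i j (x t)) J τ :=
    fun i => continuousWithinAt_field (hG.smooth_christoffel k i j) hτ hxU hx
  refine ContinuousWithinAt.add (((continuousWithinAt_sum fun i => (hΓ i).mul (hz i)).neg.sub
    ((hb j).mul (hz k))).sub ?_) (ContinuousWithinAt.mul (continuousWithinAt_sum fun i =>
      (continuousWithinAt_field (hG.smooth j i) hτ hxU hx).mul (hz i))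
      (continuousWithinAt_sum fun i => (hGi k i).mul (hb i)))
  split_ifs
  · exact continuousWithinAt_sum fun i => (hb i).mul (hz i)
  · exact continuousWithinAt_const

lemma WeylEqAt.mono {I : Set ℝ} (h : WeylEqAt U G J x z b e τ) (hI : I ⊆ J) :
    WeylEqAt U G I x z b e τ := fun k => (h k).mono hI

lemma WeylEqAt.mono_of_mem_nhdsWithin {I : Set ℝ} (h : WeylEqAt U G J x z b e τ)
    (hI : J ∈ 𝓝[I] τ) : WeylEqAt U G I x z b e τ :=
  fun k => (h k).mono_of_mem_nhdsWithin hI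

lemma WeylEqAt.congr (h : WeylEqAt U G J x z b e τ) (hτ : τ ∈ J) (hf : ∀ t ∈ J, f t = e t) :
    WeylEqAt U G J x z b f τ := by
  intro k
  have h1 := (h k).congr (f₁ := fun t => f t k) (fun t ht => congrFun (hf t ht) k)
    (congrFun (hf τ hτ) k)
  rw [← hf τ hτ] at h1
  exact h1

lemma ConformalCurveEqAt.mono {I : Set ℝ} (h : ConformalCurveEqAt U G H J x z b τ) (hI : I ⊆ J) :
    ConformalCurveEqAt U G H I x z b τ :=
  ⟨fun k => (h.position k).mono hI, fun k => (h.velocity k).mono hI,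
    fun k => (h.covector k).mono hI⟩

end WeylMatrix

namespace AdSLikeExtension

variable {M : Type*} [TopologicalSpace M] [ChartedSpace (EuclideanHalfSpace 4) M]
  [IsManifold (𝓡∂ 4) ∞ M]
  {𝔤 ι : Type*} [LieRing 𝔤] [LieAlgebra ℝ 𝔤] [Fintype ι] {B : Module.Basis ι ℝ 𝔤}
  {X : AdSLikeExtension M B}
  {I J : Set ℝ} {γ : ℝ → M} {v : (t : ℝ) → TangentSpace (𝓡∂ 4) (γ t)}
  {b : (t : ℝ) → TangentSpace (𝓡∂ 4) (γ t) →L[ℝ] ℝ}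
  {e f : (t : ℝ) → TangentSpace (𝓡∂ 4) (γ t)}

lemma IsWeylPropagated.mono (h : X.IsWeylPropagated J γ v b e) (hI : I ⊆ J) :
    X.IsWeylPropagated I γ v b e := fun τ hτ c hc => (h τ (hI hτ) c hc).mono hI

lemma IsWeylPropagated.congr (h : X.IsWeylPropagated J γ v b e) (hf : ∀ t ∈ J, f t = e t) :
    X.IsWeylPropagated J γ v b f := fun τ hτ c hc =>
  (h τ hτ c hc).congr hτ fun t ht => by rw [hf t ht]

lemma IsWeylPropagated.union (hI : X.IsWeylPropagated I γ v b e)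
    (hJ : X.IsWeylPropagated J γ v b e) (hIc : IsClosed I) (hJc : IsClosed J) :
    X.IsWeylPropagated (I ∪ J) γ v b e := by
  have hn : ∀ {I J : Set ℝ} {τ : ℝ}, τ ∉ J → IsClosed J → I ∈ 𝓝[I ∪ J] τ := by
    intro I J τ hτ hJc
    filter_upwards [self_mem_nhdsWithin, mem_nhdsWithin_of_mem_nhds (hJc.isOpen_compl.mem_nhds hτ)]
      with t h1 h2 using h1.resolve_right h2
  intro τ hτ c hc
  by_cases h1 : τ ∈ I
  · by_cases h2 : τ ∈ J
    · exact fun k => (hI τ h1 c hc k).union (hJ τ h2 c hc k)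
    · exact (hI τ h1 c hc).mono_of_mem_nhdsWithin (hn h2 hJc)
  · refine (hJ τ (hτ.resolve_left h1) c hc).mono_of_mem_nhdsWithin ?_
    rw [union_comm]
    exact hn h1 hIc

namespace IsConformalCurve

lemma mono (hC : X.IsConformalCurve J γ v b) (hI : I ⊆ J) : X.IsConformalCurve I γ v b :=
  ⟨hC.1.mono hI, fun τ hτ c hc => (hC.2 τ (hI hτ) c hc).mono hI⟩

variable (hC : X.IsConformalCurve J γ v b)
include hC

/-- Near each parameter value the coefficients of the equation of Weyl propagation, in a fixed
chart, are bounded. -/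
lemma exists_weylMatrix_bound {τ : ℝ} (hτ : τ ∈ J) :
    ∃ C, 0 < C ∧ ∀ᶠ t in 𝓝[J] τ, γ t ∈ (extChartAt (𝓡∂ 4) (γ τ)).source ∧ ∀ k j,
      |weylMatrix (dom (γ τ)) (X.metric (γ τ)) (fun t => extChartAt (𝓡∂ 4) (γ τ) (γ t))
        (fun t => vecComp (γ τ) (γ t) (v t)) (fun t => covComp (γ τ) (γ t) (b t)) k j t| ≤ C := by
  have hc := mem_extChartAt_source (I := 𝓡∂ 4) (γ τ)
  set A := weylMatrix (dom (γ τ)) (X.metric (γ τ)) (fun t => extChartAt (𝓡∂ 4) (γ τ) (γ t))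
        (fun t => vecComp (γ τ) (γ t) (v t)) (fun t => covComp (γ τ) (γ t) (b t)) with hA
  have hcont : ∀ k j, ContinuousWithinAt (A k j) J τ := fun k j =>
    (X.isSmoothMetric (γ τ)).continuousWithinAt_weylMatrix hτ (hC.eventually_mem_dom hτ hc)
      (hC.2 τ hτ _ hc) k j
  refine ⟨1 + ∑ k, ∑ j, |A k j τ|, by positivity,
    (eventually_mem_source hC.1 hτ hc).and ?_⟩
  refine eventually_all.2 fun k => eventually_all.2 fun j => ?_
  have h1 : |A k j τ| < 1 + ∑ k, ∑ j, |A k j τ| := by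
    have h2 : |A k j τ| ≤ ∑ j, |A k j τ| :=
      Finset.single_le_sum (f := fun j => |A k j τ|) (fun _ _ => abs_nonneg _) (Finset.mem_univ j)
    have h3 : ∑ j, |A k j τ| ≤ ∑ k, ∑ j, |A k j τ| :=
      Finset.single_le_sum (f := fun k => ∑ j, |A k j τ|)
        (fun _ _ => Finset.sum_nonneg fun _ _ => abs_nonneg _) (Finset.mem_univ k)
    linarith
  exact ((hcont k j).abs.eventually_lt_const h1).mono fun t ht => ht.le

/-- Weyl propagated vector fields exist locally, with any initial value at any parameter value. -/
lemma exists_weylPropagated_Icc (hJ : J.OrdConnected) {τ : ℝ} (hτ : τ ∈ J) :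
    ∃ α β, τ ∈ Icc α β ∧ Icc α β ⊆ J ∧ Icc α β ∈ 𝓝[J] τ ∧ ∀ t₀ ∈ Icc α β,
      ∀ e₀ : TangentSpace (𝓡∂ 4) (γ t₀), ∃ e : (t : ℝ) → TangentSpace (𝓡∂ 4) (γ t),
        e t₀ = e₀ ∧ X.IsWeylPropagated (Icc α β) γ v b e := by
  obtain ⟨C, hC0, hCb⟩ := hC.exists_weylMatrix_bound hτ
  obtain ⟨α, β, hmem, hsub, hnhds, hlen⟩ := exists_Icc_mem_nhdsWithin hJ hτ hCb
    (δ := 1 / (8 * C)) (by positivity)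
  have hsubJ : Icc α β ⊆ J := fun t ht => (hsub ht).1
  have hsrc : ∀ t ∈ Icc α β, γ t ∈ (extChartAt (𝓡∂ 4) (γ τ)).source := fun t ht => (hsub ht).2.1
  refine ⟨α, β, hmem, hsubJ, hnhds, fun t₀ ht₀ e₀ => ?_⟩
  have hCI := hC.mono hsubJ
  obtain ⟨y, hy0, hy⟩ := exists_linear_solution
    (A := weylMatrix (dom (γ τ)) (X.metric (γ τ)) (fun t => extChartAt (𝓡∂ 4) (γ τ) (γ t))
        (fun t => vecComp (γ τ) (γ t) (v t)) (fun t => covComp (γ τ) (γ t) (b t)))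
    (fun k j t ht => (X.isSmoothMetric (γ τ)).continuousWithinAt_weylMatrix ht
      (hCI.eventually_mem_dom ht (hsrc t ht)) (hCI.2 t ht _ (hsrc t ht)) k j) hC0.le
    (fun k j t ht => (hsub ht).2.2 k j) (by
      calc ((4 : ℕ) : ℝ) * C * (β - α) ≤ ((4 : ℕ) : ℝ) * C * (1 / (8 * C)) :=
            mul_le_mul_of_nonneg_left hlen (by positivity)
        _ = 1 / 2 := by field_simp; norm_num
        _ ≤ 1 / 2 := le_rfl) ht₀ (vecComp (γ τ) (γ t₀) e₀)
  refine ⟨fun t => vecOfComp (γ τ) (γ t) (y t), ?_, fun t ht c hc => ?_⟩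
  · change vecOfComp (γ τ) (γ t₀) (y t₀) = e₀
    rw [hy0, vecOfComp_vecComp (hsrc t₀ ht₀)]
  · refine hCI.weylIn_change ht (hsrc t ht) hc ?_
    have h1 : WeylEqAt (dom (γ τ)) (X.metric (γ τ)) (Icc α β)
        (fun t => extChartAt (𝓡∂ 4) (γ τ) (γ t)) (fun t => vecComp (γ τ) (γ t) (v t))
        (fun t => covComp (γ τ) (γ t) (b t)) y t := weylEqAt_iff.2 (hy t ht)
    exact h1.congr ht fun r hr => vecComp_vecOfComp (hsrc r hr) _

/-- A Weyl propagated vector field is determined by its value at one parameter value. -/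
lemma weylPropagated_unique (hJ : J.OrdConnected) (he : X.IsWeylPropagated J γ v b e)
    (hf : X.IsWeylPropagated J γ v b f) {t₀ : ℝ} (ht₀ : t₀ ∈ J) (h0 : e t₀ = f t₀) :
    ∀ t ∈ J, e t = f t := by
  intro t ht
  have key : e t₀ = f t₀ ↔ e t = f t := by
    refine hJ.isPreconnected.induction₂' (fun s t => (e s = f s ↔ e t = f t)) (fun τ hτ => ?_)
      (fun _ _ _ _ _ _ h1 h2 => h1.trans h2) ht₀ ht
    obtain ⟨C, hC0, hCb⟩ := hC.exists_weylMatrix_bound hτ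
    obtain ⟨α, β, hmem, hsub, hnhds, -⟩ := exists_Icc_mem_nhdsWithin hJ hτ hCb one_pos
    have hsubJ : Icc α β ⊆ J := fun t ht => (hsub ht).1
    have hsrc : ∀ t ∈ Icc α β, γ t ∈ (extChartAt (𝓡∂ 4) (γ τ)).source :=
      fun t ht => (hsub ht).2.1
    set A := weylMatrix (dom (γ τ)) (X.metric (γ τ)) (fun t => extChartAt (𝓡∂ 4) (γ τ) (γ t))
        (fun t => vecComp (γ τ) (γ t) (v t)) (fun t => covComp (γ τ) (γ t) (b t)) with hA
    set y : ℝ → Fin 4 → ℝ := fun t => vecComp (γ τ) (γ t) (e t) - vecComp (γ τ) (γ t) (f t)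
      with hy
    have hyz : ∀ t ∈ Icc α β, (y t = 0 ↔ e t = f t) := by
      intro t ht
      refine ⟨fun h => ?_, fun h => by simp only [hy]; rw [h, sub_self]⟩
      rw [← vecOfComp_vecComp (hsrc t ht) (e t), sub_eq_zero.1 h,
        vecOfComp_vecComp (hsrc t ht) (f t)]
    have hder : ∀ t ∈ Icc α β, HasDerivWithinAt y (fun k => ∑ j, A k j t * y t j) (Icc α β) t := by
      intro t ht
      rw [hasDerivWithinAt_pi]
      intro k
      have h1 := weylEqAt_iff.1 (he t (hsubJ ht) _ (hsrc t ht)) k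
      have h2 := weylEqAt_iff.1 (hf t (hsubJ ht) _ (hsrc t ht)) k
      refine ((h1.sub h2).mono hsubJ).congr_deriv ?_
      rw [← Finset.sum_sub_distrib]
      exact Finset.sum_congr rfl fun j _ => by simp only [hy, Pi.sub_apply]; ring
    have hbd : ∀ t ∈ Icc α β, ‖fun k => ∑ j, A k j t * y t j‖ ≤ (4 * C) * ‖y t‖ := by
      intro t ht
      refine (pi_norm_le_iff_of_nonneg (by positivity)).2 fun k => ?_
      calc ‖∑ j, A k j t * y t j‖ ≤ ∑ j : Fin 4, C * ‖y t‖ := by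
            refine norm_sum_le_of_le _ fun j _ => ?_
            rw [norm_mul]
            exact mul_le_mul ((hsub ht).2.2 k j) (norm_le_pi_norm (y t) j) (norm_nonneg _) hC0.le
        _ = 4 * C * ‖y t‖ := by simp; ring
    have hz : ∀ s ∈ Icc α β, ∀ t ∈ Icc α β, e s = f s → e t = f t := fun s hs t ht hs0 =>
      (hyz t ht).1 (eq_zero_on_Icc_of_norm_deriv_le
        (y' := fun t k => ∑ j, A k j t * y t j) hder hbd hs ((hyz s hs).2 hs0) t ht)
    filter_upwards [hnhds] with t ht
    exact ⟨⟨hz _ hmem _ ht, hz _ ht _ hmem⟩, ⟨hz _ ht _ hmem, hz _ hmem _ ht⟩⟩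
  exact key.1 h0

/-- A Weyl propagated vector field from `τ₀` to `s` and one near `s` can be joined to one from `τ₀`
to a nearby parameter value `t`. -/
lemma exists_weylPropagated_extend {τ₀ s t α β : ℝ}
    (hs : s ∈ Icc α β) (ht : t ∈ Icc α β) (hsub : Icc α β ⊆ J)
    (he : X.IsWeylPropagated (uIcc τ₀ s) γ v b e) (hf : X.IsWeylPropagated (Icc α β) γ v b f)
    (hef : e s = f s) :
    ∃ h : (t : ℝ) → TangentSpace (𝓡∂ 4) (γ t), h τ₀ = e τ₀ ∧ h t = f t ∧
      X.IsWeylPropagated (uIcc τ₀ t) γ v b h := by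
  have hst : uIcc s t ⊆ Icc α β := ordConnected_Icc.uIcc_subset hs ht
  classical
  set h : (t : ℝ) → TangentSpace (𝓡∂ 4) (γ t) := fun r => if r ∈ uIcc τ₀ s then e r else f r
    with hh
  have h1 : ∀ r ∈ uIcc τ₀ s, h r = e r := fun r hr => if_pos hr
  have h2 : ∀ r ∈ uIcc s t, h r = f r := by
    intro r hr
    by_cases hr' : r ∈ uIcc τ₀ s
    · -- the two fields agree at `s`, hence where both are defined
      rw [h1 r hr']
      exact (hC.mono (inter_subset_right.trans (hst.trans hsub))).weylPropagated_unique
        (ordConnected_uIcc.inter ordConnected_uIcc) (he.mono inter_subset_left)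
        ((hf.mono hst).mono inter_subset_right) ⟨right_mem_uIcc, left_mem_uIcc⟩ hef r ⟨hr', hr⟩
    · exact if_neg hr'
  refine ⟨h, h1 _ left_mem_uIcc, h2 _ right_mem_uIcc, ?_⟩
  exact ((he.congr h1).union ((hf.mono hst).congr h2) isClosed_Icc isClosed_Icc).mono
    uIcc_subset_uIcc_union_uIcc

/-- Weyl propagated vector fields exist along the whole curve, with any initial value. -/
theorem exists_weylPropagated (hJ : J.OrdConnected) {τ₀ : ℝ} (hτ₀ : τ₀ ∈ J)
    (e₀ : TangentSpace (𝓡∂ 4) (γ τ₀)) :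
    ∃ e : (t : ℝ) → TangentSpace (𝓡∂ 4) (γ t), e τ₀ = e₀ ∧ X.IsWeylPropagated J γ v b e := by
  have hex : ∀ τ ∈ J, ∃ e : (t : ℝ) → TangentSpace (𝓡∂ 4) (γ t), e τ₀ = e₀ ∧
      X.IsWeylPropagated (uIcc τ₀ τ) γ v b e := by
    intro τ hτ
    have h0 : ∃ e : (t : ℝ) → TangentSpace (𝓡∂ 4) (γ t), e τ₀ = e₀ ∧
        X.IsWeylPropagated (uIcc τ₀ τ₀) γ v b e := by
      obtain ⟨α, β, hmem, -, -, h⟩ := hC.exists_weylPropagated_Icc hJ hτ₀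
      obtain ⟨e, he0, he⟩ := h τ₀ hmem e₀
      exact ⟨e, he0, he.mono (by simpa using hmem)⟩
    -- existence on `uIcc τ₀ s` depends on `s` locally constantly
    revert h0
    refine Iff.mp (hJ.isPreconnected.induction₂' (fun s t =>
      ((∃ e : (t : ℝ) → TangentSpace (𝓡∂ 4) (γ t), e τ₀ = e₀ ∧
        X.IsWeylPropagated (uIcc τ₀ s) γ v b e) ↔
      ∃ e : (t : ℝ) → TangentSpace (𝓡∂ 4) (γ t), e τ₀ = e₀ ∧
        X.IsWeylPropagated (uIcc τ₀ t) γ v b e)) (fun τ hτ => ?_)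
      (fun _ _ _ _ _ _ h1 h2 => h1.trans h2) hτ₀ hτ)
    obtain ⟨α, β, hmem, hsub, hnhds, h⟩ := hC.exists_weylPropagated_Icc hJ hτ
    have hz : ∀ s ∈ Icc α β, ∀ t ∈ Icc α β,
        (∃ e : (t : ℝ) → TangentSpace (𝓡∂ 4) (γ t), e τ₀ = e₀ ∧
          X.IsWeylPropagated (uIcc τ₀ s) γ v b e) →
        ∃ e : (t : ℝ) → TangentSpace (𝓡∂ 4) (γ t), e τ₀ = e₀ ∧
          X.IsWeylPropagated (uIcc τ₀ t) γ v b e := by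
      rintro s hs t ht ⟨e, he0, he⟩
      obtain ⟨f, hf0, hf⟩ := h s hs (e s)
      obtain ⟨k, hk0, -, hk⟩ := hC.exists_weylPropagated_extend hs ht hsub he hf hf0.symm
      exact ⟨k, hk0.trans he0, hk⟩
    filter_upwards [hnhds] with t ht
    exact ⟨⟨hz _ hmem _ ht, hz _ ht _ hmem⟩, ⟨hz _ ht _ hmem, hz _ hmem _ ht⟩⟩
  choose! E hE0 hE using hex
  -- the value at `t` of the field on `uIcc τ₀ t`; by uniqueness these fields are compatible
  refine ⟨fun t => E t t, hE0 τ₀ hτ₀, fun τ hτ c hc => ?_⟩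
  obtain ⟨α, β, hmem, hsub, hnhds, h⟩ := hC.exists_weylPropagated_Icc hJ hτ
  obtain ⟨f, hf0, hf⟩ := h τ hmem (E τ τ)
  have hEf : ∀ t ∈ Icc α β, E t t = f t := by
    intro t ht
    obtain ⟨k, hk0, hkt, hk⟩ :=
      hC.exists_weylPropagated_extend hmem ht hsub (hE τ hτ) hf hf0.symm
    have htJ := hsub ht
    rw [← hkt]
    exact (hC.mono (hJ.uIcc_subset hτ₀ htJ)).weylPropagated_unique ordConnected_uIcc (hE t htJ) hk
      left_mem_uIcc (by rw [hk0, hE0 t htJ, hE0 τ hτ]) t right_mem_uIcc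
  exact ((hf.congr hEf) τ hmem c hc).mono_of_mem_nhdsWithin hnhds

end IsConformalCurve

end AdSLikeExtension

/-! ### Weyl propagated frames along curves in the boundary -/

/-- The zeros of a solution of `y' = a y` are preserved. -/
lemma eq_zero_iff_of_hasDerivWithinAt_mul {J : Set ℝ} (hJ : J.OrdConnected) {y a : ℝ → ℝ}
    (ha : ContinuousOn a J) (hy : ∀ τ ∈ J, HasDerivWithinAt y (a τ * y τ) J τ) {s t : ℝ}
    (hs : s ∈ J) (ht : t ∈ J) : y s = 0 ↔ y t = 0 := by
  have key : ∀ s ∈ J, y s = 0 → ∀ t ∈ J, y t = 0 := fun s hs h0 =>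
    eq_zero_of_locally_norm_deriv_le hJ (fun τ hτ => ⟨|a τ| + 1, by
      filter_upwards [(ha τ hτ).abs.eventually_lt_const (lt_add_one |a τ|), self_mem_nhdsWithin]
        with t hat htJ
      refine ⟨_, hy t htJ, ?_⟩
      rw [norm_mul]
      exact mul_le_mul_of_nonneg_right hat.le (norm_nonneg _)⟩) hs h0
  exact ⟨fun h => key s hs h t ht, fun h => key t ht h s hs⟩

namespace AdSLikeExtension

variable {M : Type*} [TopologicalSpace M] [ChartedSpace (EuclideanHalfSpace 4) M]
  [IsManifold (𝓡∂ 4) ∞ M]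
  {𝔤 ι : Type*} [LieRing 𝔤] [LieAlgebra ℝ 𝔤] [Fintype ι] {B : Module.Basis ι ℝ 𝔤}
  {X : AdSLikeExtension M B}

lemma dΞ_grad {q : M} (h0 : X.Ξ q = 0) : X.dΞ q (X.grad q) = -(X.lam / 3) := by
  have hq := mem_extChartAt_source (I := 𝓡∂ 4) q
  have h := (X.isLocalExtension q).norm_dComp (ext_mem_dom hq)
  rw [X.factor_ext hq, h0] at h
  rw [X.apply_grad hq, X.covComp_dΞ hq]
  linarith

lemma eq_smul_grad {q : M} {N : TangentSpace (𝓡∂ 4) q} (hN : X.IsUnitNormal q N) :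
    N = √(3 / X.lam) • X.grad q := by
  refine X.eq_of_g_eq fun u => ?_
  rw [hN, map_smul, smul_apply, X.g_grad, smul_eq_mul]

theorem exists_isAdaptedFrame {q : M} (h0 : X.Ξ q = 0) : ∃ E, X.IsAdaptedFrame q E := by
  obtain ⟨e, he⟩ := X.g_lorentz q
  have hN : X.g q (√(3 / X.lam) • X.grad q) (√(3 / X.lam) • X.grad q) = -1 := by
    have hl := X.lam_pos
    rw [map_smul, map_smul, smul_apply, X.g_grad, dΞ_grad h0, smul_eq_mul, smul_eq_mul,
      ← mul_assoc, Real.mul_self_sqrt (by positivity)]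
    field_simp
  obtain ⟨E, hE, h3⟩ := he.exists_last (X.g_symm q) hN
  refine ⟨E, hE, fun u hu => ?_⟩
  have h1 : X.g q (√(3 / X.lam) • X.grad q) u = 0 := by
    rw [map_smul, smul_apply, X.g_grad, show X.dΞ q u = 0 from hu, smul_zero]
  rcases h3 with h3 | h3
  · rw [h3, h1]
  · rw [h3, map_neg, neg_apply, h1, neg_zero]

/-- In an adapted frame, the differential `dΞ` vanishes on all vectors but the last. -/
lemma IsAdaptedFrame.dΞ_eq_zero_iff {q : M} (h0 : X.Ξ q = 0)
    {E : Fin 4 → TangentSpace (𝓡∂ 4) q} (hE : X.IsAdaptedFrame q E) (a : Fin 4) :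
    X.dΞ q (E a) = 0 ↔ a ≠ 3 := by
  have hd : X.dΞ q (X.grad q) ≠ 0 := by
    rw [dΞ_grad h0]
    have := X.lam_pos
    linarith
  -- remove from `E a` its component along the gradient to obtain a tangent vector
  have key : ∀ a, X.g q (E 3) (E a) * X.dΞ q (X.grad q) = X.dΞ q (E a) * X.dΞ q (E 3) := by
    intro a
    have h1 := hE.2 (E a - (X.dΞ q (E a) / X.dΞ q (X.grad q)) • X.grad q) (by
      change X.dΞ q _ = 0
      rw [map_sub, map_smul, smul_eq_mul, div_mul_cancel₀ _ hd, sub_self])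
    rw [map_sub, map_smul, smul_eq_mul, X.g_symm q (E 3) (X.grad q), X.g_grad] at h1
    field_simp at h1
    linarith
  have h3 : X.dΞ q (E 3) ≠ 0 := by
    intro h
    have := key 3
    rw [h, zero_mul] at this
    exact (mul_ne_zero (hE.1.apply_self_ne_zero 3) hd) this
  constructor
  · rintro h rfl
    exact h3 h
  · intro ha
    have := key a
    rw [hE.1.apply_ne (Ne.symm ha), zero_mul] at this
    exact (mul_eq_zero.1 this.symm).resolve_right h3

variable {J : Set ℝ} {γ : ℝ → M} {v : (t : ℝ) → TangentSpace (𝓡∂ 4) (γ t)}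
  {b : (t : ℝ) → TangentSpace (𝓡∂ 4) (γ t) →L[ℝ] ℝ}

namespace IsConformalCurve

variable (hC : X.IsConformalCurve J γ v b)
include hC

lemma continuousOn_apply : ContinuousOn (fun t => b t (v t)) J := by
  intro τ hτ
  have hc := mem_extChartAt_source (I := 𝓡∂ 4) (γ τ)
  have h := hC.2 τ hτ _ hc
  have h1 : ContinuousWithinAt
      (fun t => pair (covComp (γ τ) (γ t) (b t)) (vecComp (γ τ) (γ t) (v t))) J τ :=
    continuousWithinAt_sum fun i =>
      (h.covector i).continuousWithinAt.mul (h.velocity i).continuousWithinAt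
  exact h1.congr_of_eventuallyEq
    ((eventually_mem_source hC.1 hτ hc).mono fun t ht => form_eq_pair ht _ _) (form_eq_pair hc _ _)

/-- Weyl propagation preserves the metric up to a conformal factor. -/
lemma hasDerivWithinAt_g {e f : (t : ℝ) → TangentSpace (𝓡∂ 4) (γ t)}
    (he : X.IsWeylPropagated J γ v b e) (hf : X.IsWeylPropagated J γ v b f) {τ : ℝ} (hτ : τ ∈ J) :
    HasDerivWithinAt (fun t => X.g (γ t) (e t) (f t))
      (-2 * b τ (v τ) * X.g (γ τ) (e τ) (f τ)) J τ := by
  have hc := mem_extChartAt_source (I := 𝓡∂ 4) (γ τ)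
  have h := (X.isSmoothMetric (γ τ)).hasDerivWithinAt_dotVec_weyl hτ (hC.eventually_mem_dom hτ hc)
    (hC.2 τ hτ _ hc) (he τ hτ _ hc) (hf τ hτ _ hc)
  refine (h.congr_of_eventuallyEq ((eventually_mem_source hC.1 hτ hc).mono fun t ht =>
    X.g_eq_dotVec ht _ _) (X.g_eq_dotVec hc _ _)).congr_deriv ?_
  rw [form_eq_pair hc, ← X.g_eq_dotVec hc]

/-- Weyl propagation preserves tangency to `𝓘`, along conformal curves in `𝓘`. -/
lemma hasDerivWithinAt_dΞ
    (h : ∀ τ ∈ J, X.Ξ (γ τ) = 0 ∧ X.dΞ (γ τ) (v τ) = 0 ∧ b τ (X.grad (γ τ)) + X.s (γ τ) = 0)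
    {e : (t : ℝ) → TangentSpace (𝓡∂ 4) (γ t)} (he : X.IsWeylPropagated J γ v b e) {τ : ℝ}
    (hτ : τ ∈ J) :
    HasDerivWithinAt (fun t => X.dΞ (γ t) (e t)) (-b τ (v τ) * X.dΞ (γ τ) (e τ)) J τ := by
  have hc := mem_extChartAt_source (I := 𝓡∂ 4) (γ τ)
  obtain ⟨h0, h1, h2⟩ := h τ hτ
  have hd := (X.isLocalExtension (γ τ)).hasDerivWithinAt_pair_dComp_weyl hτ
    (hC.eventually_mem_dom hτ hc) (hC.2 τ hτ _ hc) (he τ hτ _ hc)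
    (by rw [X.factor_ext hc, h0]) (by rw [← X.dΞ_eq_pair hc, h1])
    (by rw [X.obstruction_ext hc, h2])
  refine (hd.congr_of_eventuallyEq ((eventually_mem_source hC.1 hτ hc).mono fun t ht =>
    X.dΞ_eq_pair ht _) (X.dΞ_eq_pair hc _)).congr_deriv ?_
  rw [form_eq_pair hc, ← X.dΞ_eq_pair hc]

/-- Weyl propagation of an adapted frame along a curve in `𝓘` yields frames whose last vector is
normal to `𝓘` and whose other vectors are tangent to `𝓘`. -/
theorem frame_of_isAdaptedFrame (hJ : J.OrdConnected)
    (h : ∀ τ ∈ J, X.Ξ (γ τ) = 0 ∧ X.dΞ (γ τ) (v τ) = 0 ∧ b τ (X.grad (γ τ)) + X.s (γ τ) = 0)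
    {τ₀ : ℝ} (hτ₀ : τ₀ ∈ J) {E : Fin 4 → TangentSpace (𝓡∂ 4) (γ τ₀)}
    (hE : X.IsAdaptedFrame (γ τ₀) E) {e : Fin 4 → (t : ℝ) → TangentSpace (𝓡∂ 4) (γ t)}
    (he0 : ∀ a, e a τ₀ = E a) (he : ∀ a, X.IsWeylPropagated J γ v b (e a)) {τ : ℝ} (hτ : τ ∈ J) :
    LinearIndependent ℝ (fun a => e a τ) ∧ X.IsNormalToScri (γ τ) (e 3 τ) ∧
      ∀ a, a ≠ 3 → X.IsTangentToScri (γ τ) (e a τ) := by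
  have hg : ∀ a c, X.g (γ τ) (e a τ) (e c τ) = 0 ↔ X.g (γ τ₀) (E a) (E c) = 0 := by
    intro a c
    rw [← he0 a, ← he0 c]
    exact eq_zero_iff_of_hasDerivWithinAt_mul hJ (continuousOn_const.mul hC.continuousOn_apply)
      (fun t ht => hC.hasDerivWithinAt_g (he a) (he c) ht) hτ hτ₀
  have hd : ∀ a, X.dΞ (γ τ) (e a τ) = 0 ↔ a ≠ 3 := by
    intro a
    rw [← hE.dΞ_eq_zero_iff (h τ₀ hτ₀).1, ← he0 a]
    exact eq_zero_iff_of_hasDerivWithinAt_mul hJ hC.continuousOn_apply.neg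
      (fun t ht => hC.hasDerivWithinAt_dΞ h (he a) ht) hτ hτ₀
  have ho : ∀ a c, a ≠ c → X.g (γ τ) (e a τ) (e c τ) = 0 :=
    fun a c hac => (hg a c).2 (hE.1.apply_ne hac)
  have hli : LinearIndependent ℝ (fun a => e a τ) :=
    linearIndependent_of_orthogonal ho fun a ha => hE.1.apply_self_ne_zero a ((hg a a).1 ha)
  refine ⟨hli, fun u hu => ?_, fun a ha => (hd a).2 ha⟩
  obtain ⟨c, rfl⟩ := exists_eq_sum_of_linearIndependent (finrank_tangentSpace (γ τ)) hli u
  have hu' : X.dΞ (γ τ) (∑ a, c a • e a τ) = 0 := hu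
  rw [map_sum, Finset.sum_eq_single 3 (fun a _ ha => by
    rw [map_smul, (hd a).2 ha, smul_zero]) (by simp), map_smul, smul_eq_mul] at hu'
  have hc3 : c 3 = 0 := (mul_eq_zero.1 hu').resolve_right fun h3 => (hd 3).1 h3 rfl
  rw [map_sum]
  refine Finset.sum_eq_zero fun a _ => ?_
  by_cases ha : a = 3
  · rw [ha, hc3, zero_smul, map_zero]
  · rw [map_smul, ho 3 a (Ne.symm ha), smul_zero]

end IsConformalCurve

end AdSLikeExtension

end ConfBoundary

end

theorem mainTheorem3 {M : Type*} [TopologicalSpace M] [T2Space M]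
    [ChartedSpace (EuclideanHalfSpace 4) M] [IsManifold (𝓡∂ 4) ∞ M]
    {𝔤 ι : Type*} [LieRing 𝔤] [LieAlgebra ℝ 𝔤] [Fintype ι] (B : Module.Basis ι ℝ 𝔤)
    (X : ConfBoundary.AdSLikeExtension M B) :
    -- the tensor `H` which arises from `H̃ = (λ/6) g̃` is smooth up to the conformal boundary
    (∀ c i j, ContDiffOn ℝ ∞ (fun x => X.H c x i j) (ConfBoundary.dom c)) ∧
    ∀ (J : Set ℝ) (γ : ℝ → M) (v : (t : ℝ) → TangentSpace (𝓡∂ 4) (γ t))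
      (b : (t : ℝ) → TangentSpace (𝓡∂ 4) (γ t) →L[ℝ] ℝ),
      J.OrdConnected → X.IsConformalCurve J γ v b →
      ∀ τ₀ ∈ J, γ τ₀ ∈ X.scri → X.IsTangentToScri (γ τ₀) (v τ₀) →
      ∀ N : TangentSpace (𝓡∂ 4) (γ τ₀), X.IsUnitNormal (γ τ₀) N →
      b τ₀ N = -√(3 / X.lam) * X.s (γ τ₀) →
      -- the curve remains in the conformal boundary
      (∀ τ ∈ J, γ τ ∈ X.scri) ∧
      -- it is a conformal geodesic there
      X.IsBoundaryConformalGeodesic J γ v b ∧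
      -- Weyl propagation admits a frame that contains a normal of the conformal boundary
      (∃ E, X.IsAdaptedFrame (γ τ₀) E) ∧
      ∀ E, X.IsAdaptedFrame (γ τ₀) E →
        ∃ e : Fin 4 → (t : ℝ) → TangentSpace (𝓡∂ 4) (γ t),
          (∀ a, e a τ₀ = E a) ∧
          (∀ a, X.IsWeylPropagated J γ v b (e a)) ∧
          ∀ τ ∈ J, LinearIndependent ℝ (fun a => e a τ) ∧
            X.IsNormalToScri (γ τ) (e 3 τ) ∧
            ∀ a, a ≠ 3 → X.IsTangentToScri (γ τ) (e a τ) := by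
  refine ⟨X.smooth_H, fun J γ v b hJ hC τ₀ hτ₀ h0 h1 N hN hb => ?_⟩
  have hl := X.lam_pos
  have h2 : b τ₀ (X.grad (γ τ₀)) + X.s (γ τ₀) = 0 := by
    rw [X.eq_smul_grad hN, map_smul, smul_eq_mul, neg_mul, ← mul_neg] at hb
    have hs : √(3 / X.lam) ≠ 0 := (Real.sqrt_pos.2 (by positivity)).ne'
    rw [mul_left_cancel₀ hs hb, neg_add_cancel]
  have h := hC.boundary_conditions hJ hτ₀ h0 h1 h2
  refine ⟨fun τ hτ => (h τ hτ).1, hC.isBoundaryConformalGeodesic h, X.exists_isAdaptedFrame h0,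
    fun E hE => ?_⟩
  choose e he0 he using fun a => hC.exists_weylPropagated hJ hτ₀ (E a)
  exact ⟨e, he0, he, fun τ hτ => hC.frame_of_isAdaptedFrame hJ h hτ₀ hE he0 he hτ⟩
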